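/- Throughout, $|\cdot|$ is the Euclidean norm on $\mathbb R^2$, $\lambda^2$ is Lebesgue measure on $\mathbb R^2$, $A^\circ$, $\overline A$, $\partial A$ are interior, closure and boundary of $A$, $\operatorname{diam}$ is the diameter, $U(x,\varepsilon)$ is the open disc of radius $\varepsilon$ around $(x,0)$, $B(h)$ is the closed disc of radius $a-h$ around the origin ($0\le h<a$), and $Q_1,\dots,Q_4$ are the open quadrants, numbered anti-clockwise from $Q_1=\{x>0,y>0\}$. Let $P$ be a probability measure on $\mathbb R^2$ with $\lambda^2$-density $f$, let $E\subset\mathbb R^2$ be compact with $P(E)=1$ and $P(E\setminus\overline{E^\circ})=0$ (for instance, $E$ is the support of $P$ and the closure of its interior), and put $E_i:=E\cap Q_i$. Assume: A1) There is $a>0$ with $\operatorname{diam}(E)=2a$, $\inf\{x:(x,y)\in E\}=-a$ and $\sup\{x:(x,y)\in E\}=a$. A2) $\operatorname{diam}\bigl(E\setminus(U(-a,\varepsilon)\cup U(a,\varepsilon))\bigr)<2a$ for each $\varepsilon>0$. A3) For $i\in\{1,4\}$, $j\in\{2,3\}$ and each $\varepsilon>0$: $\lambda^2(E_i\cap U(a,\varepsilon))>0$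 and $\lambda^2(E_j\cap U(-a,\varepsilon))>0$. A4) For some $\nu\in[0,a)$ and continuous functions $g_1:[\nu,a]\to\mathbb R_{\ge0}$, $g_4:[\nu,a]\to\mathbb R_{\le0}$, $g_2:[-a,-\nu]\to\mathbb R_{\ge0}$, $g_3:[-a,-\nu]\to\mathbb R_{\le0}$ with $g_1(a)=g_4(a)=g_2(-a)=g_3(-a)=0$ we have $E^\circ\cap\{x>\nu\}=\{(x,y):\nu<x<a,\ g_4(x)<y<g_1(x)\}$ and $E^\circ\cap\{x<-\nu\}=\{(x,y):-a<x<-\nu,\ g_3(x)<y<g_2(x)\}$. A5) With $f_a(x):=\sqrt{a^2-x^2}/2$ there are constants $0<q_i<2$, $i\in\{1,2,3,4\}$, such that $g_1(x)/f_a(x)\to q_1$ and $-g_4(x)/f_a(x)\to q_4$ as $x\to a$, and $g_2(x)/f_a(x)\to q_2$ and $-g_3(x)/f_a(x)\to q_3$ as $x\to-a$. A6) For each $i\in\{1,2,3,4\}$ and all sufficiently small $h>0$, $E_i^\circ\cap\{(x,y):|x|<\nu\}\subset B(h)$, and the graph of $g_i$ meets the circle $\partial B(h)$ in exactly one point. A7)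 For sufficiently small $\varepsilon>0$, $f$ is continuous on $E\cap U(a,\varepsilon)$ and on $E\cap U(-a,\varepsilon)$, and $p_1:=p_4:=f((a,0))>0$, $p_2:=p_3:=f((-a,0))>0$. Put, for $i\in\{1,2,3,4\}$, $$c_i:=\frac{2q_i\sqrt{2a}}{3\sqrt{4-q_i^2}},\qquad \sigma_i:=(p_ic_i)^{-2/3},\qquad \tau_i:=\frac{3}{2a}c_i .$$ For $\sigma,\tau>0$ let $\mathrm{NA}_\infty(\sigma,\tau)$ be the law of the random sequence $(Z_{1,m},Z_{2,m})_{m\ge1}$ with $Z_{1,m}:=\sigma S_m^{2/3}$ and $Z_{2,m}:=U_m\,\tau\,\sigma^{1/2}S_m^{1/3}$, where $S_m:=Y_1+\dots+Y_m$ and $Y_1,U_1,Y_2,U_2,\dots$ are independent, each $Y_m$ being unit exponential and each $U_m$ uniform on $[0,1]$. Let $(Z^i_{1,k},Z^i_{2,k})_{k\ge1}\sim\mathrm{NA}_\infty(\sigma_i,\tau_i)$, $i\in\{1,2,3,4\}$, be independent, and put $$S^{i,j}:=\min_{k,l\in\mathbb N}\Bigl\{Z^i_{1,k}+Z^j_{1,l}+\tfrac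 a4\bigl(Z^i_{2,k}-Z^j_{2,l}\bigr)^2\Bigr\},\quad (i,j)\in\{(1,3),(2,4)\},$$ $$S^{i,j}:=\min_{k,l\in\mathbb N}\Bigl\{Z^i_{1,k}+Z^j_{1,l}+\tfrac a4\bigl(Z^i_{2,k}+Z^j_{2,l}\bigr)^2\Bigr\},\quad (i,j)\in\{(1,2),(3,4)\}.$$ These minima are attained almost surely. For each $n\in\mathbb N$ let $\Phi_n$ be a Poisson process in $\mathbb R^2$ with intensity measure $nP$, and let $\operatorname{diam}(\Phi_n)$ be the diameter of its support. Then, as $n\to\infty$, $$n^{2/3}\bigl(2a-\operatorname{diam}(\Phi_n)\bigr)\ \overset{\mathcal D}{\longrightarrow}\ \min\{S^{1,2},S^{1,3},S^{2,4},S^{3,4}\}.$$ -/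

import Mathlib

open MeasureTheory ProbabilityTheory Filter Set
open scoped Topology ENNReal NNReal

namespace PlanarDiameter

noncomputable section

/-- The Euclidean plane. -/
abbrev Plane : Type := EuclideanSpace ℝ (Fin 2)

/-- `Φ` is a Poisson process on the probability space `(Ω, μ)` with intensity measure `Λ`:
a random counting measure such that `Φ(B)` has the Poisson distribution with mean `Λ(B)`
(and is almost surely infinite if `Λ(B) = ∞`), and such that the values on pairwise disjoint
sets are independent. -/
structure IsPoissonProcess {Ω X : Type*} [MeasurableSpace Ω] [MeasurableSpace X]
    (Φ : Ω → Measure X) (Λ : Measure X) (μ : Measure Ω) : Prop where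
  measurable : Measurable Φ
  counting : ∀ ω (B : Set X), MeasurableSet B → ∃ k : ℕ∞, Φ ω B = (k : ℝ≥0∞)
  law : ∀ B : Set X, MeasurableSet B → Λ B ≠ ∞ →
    μ.map (fun ω => Φ ω B) = (poissonMeasure (Λ B).toNNReal).map (fun k : ℕ => (k : ℝ≥0∞))
  law_top : ∀ B : Set X, MeasurableSet B → Λ B = ∞ → ∀ᵐ ω ∂μ, Φ ω B = ∞
  indep : ∀ (m : ℕ) (B : Fin m → Set X), (∀ i, MeasurableSet (B i)) →
    Pairwise (fun i j => Disjoint (B i) (B j)) →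
    iIndepFun (fun i ω => Φ ω (B i)) μ

/-- The right pole `(a, 0)`. The left pole is `pole (-a)`. -/
def pole (a : ℝ) : Plane := !₂[a, 0]

/-- The open quadrants in anti-clockwise order; the index `i` stands for the quadrant `i + 1`. -/
def quadrant : Fin 4 → Set Plane
  | 0 => {z | 0 < z 0 ∧ 0 < z 1}
  | 1 => {z | z 0 < 0 ∧ 0 < z 1}
  | 2 => {z | z 0 < 0 ∧ z 1 < 0}
  | 3 => {z | 0 < z 0 ∧ z 1 < 0}

/-- The interval on which the boundary function of the given quadrant is defined. -/
def boundaryDomain (a ν : ℝ) : Fin 4 → Set ℝ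
  | 0 => Icc ν a
  | 1 => Icc (-a) (-ν)
  | 2 => Icc (-a) (-ν)
  | 3 => Icc ν a

/-- The upper boundary function of an ellipse with major axis `2a` and minor axis `a`. -/
def ellipseFun (a x : ℝ) : ℝ := √(a ^ 2 - x ^ 2) / 2

/-- The geometric assumptions on the set `E` : it has the unique major axis from `(-a, 0)` to
`(a, 0)`, and its boundary, described by the functions `g i`, behaves near the poles like
`q i` times the boundary of an ellipse. -/
structure IsAdmissibleSet (E : Set Plane) (a ν : ℝ) (g : Fin 4 → ℝ → ℝ) (q : Fin 4 → ℝ) :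
    Prop where
  isCompact : IsCompact E
  -- diameter and orientation
  pos : 0 < a
  diam_eq : Metric.diam E = 2 * a
  isGLB : IsGLB ((fun z : Plane => z 0) '' E) (-a)
  isLUB : IsLUB ((fun z : Plane => z 0) '' E) a
  -- uniqueness of the major axis
  diam_lt : ∀ ε > 0,
    Metric.diam (E \ (Metric.ball (pole (-a)) ε ∪ Metric.ball (pole a) ε)) < 2 * a
  -- positive area near the poles in each quadrant
  area_right : ∀ i ∈ ({0, 3} : Set (Fin 4)), ∀ ε > 0,
    0 < volume (E ∩ quadrant i ∩ Metric.ball (pole a) ε)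
  area_left : ∀ i ∈ ({1, 2} : Set (Fin 4)), ∀ ε > 0,
    0 < volume (E ∩ quadrant i ∩ Metric.ball (pole (-a)) ε)
  -- boundary functions
  nu_nonneg : 0 ≤ ν
  nu_lt : ν < a
  continuousOn : ∀ i, ContinuousOn (g i) (boundaryDomain a ν i)
  upper_nonneg : ∀ i ∈ ({0, 1} : Set (Fin 4)), ∀ x ∈ boundaryDomain a ν i, 0 ≤ g i x
  lower_nonpos : ∀ i ∈ ({2, 3} : Set (Fin 4)), ∀ x ∈ boundaryDomain a ν i, g i x ≤ 0
  right_eq_zero : g 0 a = 0 ∧ g 3 a = 0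
  left_eq_zero : g 1 (-a) = 0 ∧ g 2 (-a) = 0
  interior_right : interior E ∩ {z | ν < z 0} =
    {z | ν < z 0 ∧ z 0 < a ∧ g 3 (z 0) < z 1 ∧ z 1 < g 0 (z 0)}
  interior_left : interior E ∩ {z | z 0 < -ν} =
    {z | -a < z 0 ∧ z 0 < -ν ∧ g 2 (z 0) < z 1 ∧ z 1 < g 1 (z 0)}
  -- elliptical decay at the poles
  q_mem : ∀ i, q i ∈ Ioo (0 : ℝ) 2
  decay_one : Tendsto (fun x => g 0 x / ellipseFun a x) (𝓝[<] a) (𝓝 (q 0))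
  decay_four : Tendsto (fun x => -g 3 x / ellipseFun a x) (𝓝[<] a) (𝓝 (q 3))
  decay_two : Tendsto (fun x => g 1 x / ellipseFun a x) (𝓝[>] (-a)) (𝓝 (q 1))
  decay_three : Tendsto (fun x => -g 2 x / ellipseFun a x) (𝓝[>] (-a)) (𝓝 (q 2))
  -- away from the poles `E` stays inside slightly smaller discs
  inside_disc : ∀ i, ∀ᶠ h in 𝓝[>] (0 : ℝ),
    interior (E ∩ quadrant i) ∩ {z | |z 0| < ν} ⊆ Metric.closedBall 0 (a - h)
  unique_crossing : ∀ i, ∀ᶠ h in 𝓝[>] (0 : ℝ),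
    ∃! x, x ∈ boundaryDomain a ν i ∧ (!₂[x, g i x] : Plane) ∈ Metric.sphere 0 (a - h)

/-- The assumptions on the distribution `P` : it has the Lebesgue density `f`, it is concentrated
on `E` and gives no mass to the part of `E` outside the closure of the interior of `E`, and `f`
is continuous on `E` near the poles and positive at the poles. -/
structure IsAdmissibleDensity (P : Measure Plane) (f : Plane → ℝ) (E : Set Plane) (a : ℝ) :
    Prop where
  measurable : Measurable f
  nonneg : ∀ z, 0 ≤ f z
  eq_withDensity : P = volume.withDensity (fun z => ENNReal.ofReal (f z))
  compl_null : P Eᶜ = 0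
  thin_null : P (E \ closure (interior E)) = 0
  continuousOn : ∃ ε > 0, ContinuousOn f (E ∩ Metric.ball (pole a) ε) ∧
    ContinuousOn f (E ∩ Metric.ball (pole (-a)) ε)
  pos_right : 0 < f (pole a)
  pos_left : 0 < f (pole (-a))

/-- The value of the density at the pole belonging to the given quadrant. -/
def poleDensity (f : Plane → ℝ) (a : ℝ) : Fin 4 → ℝ
  | 0 => f (pole a)
  | 1 => f (pole (-a))
  | 2 => f (pole (-a))
  | 3 => f (pole a)

/-- `c = 2 q √(2a) / (3 √(4 - q²))`. -/
def capConst (a q : ℝ) : ℝ := 2 * q * √(2 * a) / (3 * √(4 - q ^ 2))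

/-- `σ = (p c)^(-2/3)`. -/
def sigmaConst (a q p : ℝ) : ℝ := (p * capConst a q) ^ (-(2 / 3) : ℝ)

/-- `τ = 3 c / (2a)`. -/
def tauConst (a q : ℝ) : ℝ := 3 / (2 * a) * capConst a q

/-- The norm-angle distribution `NA_∞(σ, τ)` : the law of the sequence
`(σ S_m^(2/3), U_m τ σ^(1/2) S_m^(1/3))`, `m = 1, 2, …`, where `S_m = Y_1 + … + Y_m` and
`Y_1, U_1, Y_2, U_2, …` are independent, the `Y`s with unit exponential distribution and the
`U`s uniform on `[0, 1]`. Sequences are indexed from `0`. -/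
def normAngle (σ τ : ℝ) : Measure (ℕ → ℝ × ℝ) :=
  (Measure.infinitePi
      (fun _ : ℕ => (expMeasure 1).prod ((volume : Measure ℝ).restrict (Icc 0 1)))).map
    (fun (yu : ℕ → ℝ × ℝ) (m : ℕ) =>
      (σ * (∑ j ∈ Finset.range (m + 1), (yu j).1) ^ (2 / 3 : ℝ),
        (yu m).2 * τ * σ ^ (1 / 2 : ℝ) *
          (∑ j ∈ Finset.range (m + 1), (yu j).1) ^ (1 / 3 : ℝ)))

/-- `z_{1,k} + w_{1,l} + (a/4) (z_{2,k} - w_{2,l})²`. -/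
def costMinus (a : ℝ) (z w : ℕ → ℝ × ℝ) (kl : ℕ × ℕ) : ℝ :=
  (z kl.1).1 + (w kl.2).1 + a / 4 * ((z kl.1).2 - (w kl.2).2) ^ 2

/-- `z_{1,k} + w_{1,l} + (a/4) (z_{2,k} + w_{2,l})²`. -/
def costPlus (a : ℝ) (z w : ℕ → ℝ × ℝ) (kl : ℕ × ℕ) : ℝ :=
  (z kl.1).1 + (w kl.2).1 + a / 4 * ((z kl.1).2 + (w kl.2).2) ^ 2

/-- The minimum of `costMinus` over all pairs of indices. -/
def minMinus (a : ℝ) (z w : ℕ → ℝ × ℝ) : ℝ := ⨅ kl : ℕ × ℕ, costMinus a z w kl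

/-- The minimum of `costPlus` over all pairs of indices. -/
def minPlus (a : ℝ) (z w : ℕ → ℝ × ℝ) : ℝ := ⨅ kl : ℕ × ℕ, costPlus a z w kl

end

end PlanarDiameter

open PlanarDiameter

/-! The closure of the interior of `E` can reach the circle of radius `a` only at the poles. Hence a
pair at distance close to `2a` has one point near each pole (`exists_near_poles`). Since every `q i`
is below `2`, the norm falls at least linearly in `a - |x|` there (`exists_norm_le_near_poles`). A
pair whose defect is of order `n^(-2/3)` is therefore within order `n^(-2/3)` of the poles
horizontally and `n^(-1/3)` vertically. With `k = n^(1/3)`, blow up horizontally by `k²` and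
vertically by `k`. In these coordinates the defect, multiplied by `k² = n^(2/3)`, converges
uniformly on bounded windows to the explicit function `limitCost` (`tendsto_scaledCost`). The
intensity `n P = k³ P` converges to the constant density `p i` on the region below a parabola, one
region per quadrant (`IsAdmissibleDensity.tendsto_scaled_measure`).

The norm-angle sequences are Poisson processes on exactly these regions. Exponential partial sums
with uniform marks have the void probabilities of a unit-rate process on the strip of positive times
and marks in `[0, 1]` (`measure_voidEvent`). The map from (arrival time, mark) to rescaled position
has constant Jacobian (`hasFDerivAt_arrivalMap`). The constants `σ` and `τ` are those for which the
image has density `p i` and fills the parabolic region (`normAngle_void`).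

To compare the two, convergence of void probabilities on all measurable subsets of a bounded window
suffices. By inclusion-exclusion it yields convergence of the joint occupancy of finitely many small
cells, and the event that some pair of points has cost below `t` is sandwiched between two such
occupancy events (`eventually_levy_of_tendsto_void`). The localisation lemmas
`exists_forall_scaled_diam_lt_iff` and `exists_forall_minCost_lt_iff` express the rescaled diameter
and the limiting minimum as such pair events. The resulting sandwich of distribution functions gives
convergence in distribution. -/

namespace PlanarDiameter

/-! ### Convergence in distribution from void probabilities -/

/-- A sandwich of distribution functions as in the definition of the Lévy metric implies
convergence in distribution. -/
theorem tendstoInDistribution_of_levy {Ω : ℕ → Type*} [∀ n, MeasurableSpace (Ω n)]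
    {μ : ∀ n, Measure (Ω n)} [∀ n, IsProbabilityMeasure (μ n)]
    {Ω' : Type*} [MeasurableSpace Ω'] {μ' : Measure Ω'} [IsProbabilityMeasure μ']
    {X : ∀ n, Ω n → ℝ} {Y : Ω' → ℝ} (hX : ∀ n, AEMeasurable (X n) (μ n))
    (hY : AEMeasurable Y μ')
    (h : ∀ t : ℝ, ∀ η > 0, ∀ᶠ n in atTop,
      (μ n).real {ω | X n ω < t} ≤ μ'.real {ω | Y ω < t + η} + η ∧
      μ'.real {ω | Y ω < t - η} - η ≤ (μ n).real {ω | X n ω < t}) :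
    TendstoInDistribution X atTop Y μ μ' := by
  refine ⟨hX, hY, ?_⟩
  set H : ℝ → ℝ := fun t => μ'.real {ω | Y ω < t} with hH
  have hmono : Monotone H := fun s t hst =>
    measureReal_mono (fun ω (hω : Y ω < s) => lt_of_lt_of_le hω hst)
  have hconv : ∀ t, ContinuousAt H t →
      Tendsto (fun n => (μ n).real {ω | X n ω < t}) atTop (𝓝 (H t)) := by
    intro t ht
    rw [Metric.tendsto_nhds]
    intro ε hε
    obtain ⟨δ, hδ, hδ'⟩ := Metric.continuousAt_iff.1 ht (ε / 2) (by positivity)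
    -- The shift by `η` has to stay inside the continuity window `δ`, and the additive error `η` has
    -- to fit into the remaining `ε / 2`.
    set η := min (δ / 2) (ε / 4) with hη
    have hη0 : 0 < η := by positivity
    have hη1 : η < δ := lt_of_le_of_lt (min_le_left _ _) (by linarith)
    have hη2 : η < ε / 2 := lt_of_le_of_lt (min_le_right _ _) (by linarith)
    have h1 := hδ' (x := t + η) (by rw [Real.dist_eq]; simpa [abs_of_pos hη0] using hη1)
    have h2 := hδ' (x := t - η) (by rw [Real.dist_eq]; simpa [abs_of_pos hη0] using hη1)
    rw [Real.dist_eq, abs_lt] at h1 h2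
    filter_upwards [h t η hη0] with n hn
    rw [Real.dist_eq, abs_lt]
    simp only [hH] at h1 h2 ⊢
    constructor <;> linarith [hn.1, hn.2]
  have hIco : ∀ (ν : Measure ℝ) [IsProbabilityMeasure ν] (s t : ℝ), s < t →
      ν.real (Ico s t) = ν.real (Iio t) - ν.real (Iio s) := by
    intro ν _ s t hst
    rw [← measureReal_sdiff (Iio_subset_Iio hst.le) measurableSet_Iio]
    congr 1
    ext x
    simp
  -- A monotone function has countably many discontinuities, so `D` is dense. Half-open intervals
  -- with endpoints in `D` form a π-system containing arbitrarily small neighbourhoods of every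
  -- point, and convergence on such a system implies weak convergence.
  set D : Set ℝ := {t | ContinuousAt H t}
  have hD : Dense D := by
    have := hmono.countable_not_continuousAt.dense_compl ℝ
    convert! this using 1
    ext t; simp [D]
  refine (isPiSystem_Ico_mem D D).tendsto_probabilityMeasure_of_tendsto_of_mem ?_ ?_ ?_
  · rintro s ⟨l, -, u, -, -, rfl⟩
    exact measurableSet_Ico
  · intro u hu x hx
    obtain ⟨ε, hε, hεu⟩ := Metric.isOpen_iff.1 hu x hx
    obtain ⟨l, hlD, hl1, hl2⟩ := hD.exists_between (show x - ε < x by linarith)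
    obtain ⟨r, hrD, hr1, hr2⟩ := hD.exists_between (show x < x + ε by linarith)
    refine ⟨Ico l r, ⟨l, hlD, r, hrD, hl2.trans hr1, rfl⟩, Ico_mem_nhds hl2 hr1, fun y hy => hεu ?_⟩
    rw [Metric.mem_ball, Real.dist_eq, abs_lt]
    constructor <;> linarith [hy.1, hy.2]
  · rintro s ⟨l, hl, u, hu, hlu, rfl⟩
    rw [← NNReal.tendsto_coe]
    have e1 : ∀ n t, ((μ n).map (X n)).real (Iio t) = (μ n).real {ω | X n ω < t} := fun n t =>
      map_measureReal_apply_of_aemeasurable (hX n) measurableSet_Iio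
    have e2 : ∀ t, (μ'.map Y).real (Iio t) = μ'.real {ω | Y ω < t} := fun t =>
      map_measureReal_apply_of_aemeasurable hY measurableSet_Iio
    have : ∀ n, IsProbabilityMeasure ((μ n).map (X n)) := fun n =>
      Measure.isProbabilityMeasure_map (hX n)
    have : IsProbabilityMeasure (μ'.map Y) := Measure.isProbabilityMeasure_map hY
    have key : Tendsto (fun n => ((μ n).map (X n)).real (Ico l u)) atTop
        (𝓝 ((μ'.map Y).real (Ico l u))) := by
      simp_rw [hIco _ l u hlu, e1, e2]
      exact (hconv u hu).sub (hconv l hl)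
    exact key

theorem measureReal_inter_compl_insert {ι Ω₀ : Type*} [DecidableEq ι] [MeasurableSpace Ω₀]
    (μ₀ : Measure Ω₀) [IsProbabilityMeasure μ₀] {A₀ : ι → Set Ω₀}
    (h₀ : ∀ i, NullMeasurableSet (A₀ i) μ₀) (J K : Finset ι) (k : ι) :
    μ₀.real ((⋂ i ∈ J, A₀ i) ∩ ⋂ i ∈ insert k K, (A₀ i)ᶜ) =
      μ₀.real ((⋂ i ∈ J, A₀ i) ∩ ⋂ i ∈ K, (A₀ i)ᶜ) -
        μ₀.real ((⋂ i ∈ insert k J, A₀ i) ∩ ⋂ i ∈ K, (A₀ i)ᶜ) := by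
  rw [← measureReal_inter_add_sdiff₀ (s := (⋂ i ∈ J, A₀ i) ∩ ⋂ i ∈ K, (A₀ i)ᶜ) (h₀ k),
    Finset.set_biInter_insert, Finset.set_biInter_insert]
  have e1 : ((⋂ i ∈ J, A₀ i) ∩ ⋂ i ∈ K, (A₀ i)ᶜ) ∩ A₀ k =
      A₀ k ∩ (⋂ i ∈ J, A₀ i) ∩ ⋂ i ∈ K, (A₀ i)ᶜ := by
    rw [inter_comm, ← inter_assoc]
  have e2 : ((⋂ i ∈ J, A₀ i) ∩ ⋂ i ∈ K, (A₀ i)ᶜ) \ A₀ k =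
      (⋂ i ∈ J, A₀ i) ∩ ((A₀ k)ᶜ ∩ ⋂ i ∈ K, (A₀ i)ᶜ) := by
    rw [Set.sdiff_eq, inter_assoc, inter_comm (A₀ k)ᶜ]
  rw [e1, e2]; ring

/-- Inclusion-exclusion, one complement at a time: each complemented event is traded for a
difference of two probabilities with one complement fewer, and limits pass through differences. -/
theorem tendsto_measureReal_inter_compl {ι : Type*} [DecidableEq ι]
    {Ω : ℕ → Type*} [∀ n, MeasurableSpace (Ω n)]
    {μ : ∀ n, Measure (Ω n)} [∀ n, IsProbabilityMeasure (μ n)]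
    {Ω' : Type*} [MeasurableSpace Ω'] {μ' : Measure Ω'} [IsProbabilityMeasure μ']
    {A : ∀ n, ι → Set (Ω n)} {A' : ι → Set Ω'}
    (hA : ∀ n i, NullMeasurableSet (A n i) (μ n)) (hA' : ∀ i, NullMeasurableSet (A' i) μ')
    (h : ∀ J : Finset ι, Tendsto (fun n => (μ n).real (⋂ i ∈ J, A n i)) atTop
      (𝓝 (μ'.real (⋂ i ∈ J, A' i)))) (K : Finset ι) :
    ∀ J : Finset ι, Tendsto (fun n => (μ n).real ((⋂ i ∈ J, A n i) ∩ ⋂ i ∈ K, (A n i)ᶜ)) atTop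
      (𝓝 (μ'.real ((⋂ i ∈ J, A' i) ∩ ⋂ i ∈ K, (A' i)ᶜ))) := by
  induction K using Finset.induction_on with
  | empty => intro J; simpa using h J
  | insert k K _ ih =>
    intro J
    simp_rw [fun n => measureReal_inter_compl_insert (μ n) (hA n) J K k,
      measureReal_inter_compl_insert μ' hA' J K k]
    exact (ih J).sub (ih _)

open Classical in
theorem measureReal_occupancy_eq_sum {ι Ω₀ : Type*} [Fintype ι] [MeasurableSpace Ω₀]
    (μ₀ : Measure Ω₀) [IsProbabilityMeasure μ₀] {A₀ : ι → Set Ω₀}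
    (h₀ : ∀ i, NullMeasurableSet (A₀ i) μ₀) (𝒮 : Set (Set ι)) :
    μ₀.real {ω | {i | ω ∉ A₀ i} ∈ 𝒮} = ∑ K ∈ Finset.univ.filter (fun K : Finset ι => ↑K ∈ 𝒮),
      μ₀.real ((⋂ i ∈ Kᶜ, A₀ i) ∩ ⋂ i ∈ K, (A₀ i)ᶜ) := by
  have hset : ∀ K : Finset ι, (⋂ i ∈ Kᶜ, A₀ i) ∩ ⋂ i ∈ K, (A₀ i)ᶜ =
      {ω | {i | ω ∉ A₀ i} = (K : Set ι)} := by
    intro K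
    ext ω
    simp only [Finset.mem_compl, mem_inter_iff, mem_iInter, mem_compl_iff, mem_ofPred_eq,
      Set.ext_iff, Finset.mem_coe]
    constructor
    · rintro ⟨h1, h2⟩ i
      exact ⟨fun hi => by_contra fun hK => hi (h1 i hK), h2 i⟩
    · intro h1
      exact ⟨fun i hi => by_contra fun h2 => hi ((h1 i).1 h2), fun i hi => (h1 i).2 hi⟩
  rw [← measureReal_biUnion_finset₀]
  · congr 1
    ext ω
    simp only [hset, mem_ofPred_eq, Finset.mem_filter, Finset.mem_univ, true_and, mem_iUnion,
      exists_prop]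
    constructor
    · intro hω
      exact ⟨{i | ω ∉ A₀ i}.toFinset, by simpa using hω, by simp⟩
    · rintro ⟨K, hK, hK'⟩
      rwa [hK']
  · intro K _ L _ hKL
    refine Disjoint.aedisjoint ?_
    rw [Set.disjoint_left]
    simp only [hset, mem_ofPred_eq]
    intro ω h1 h2
    exact hKL (Finset.coe_injective (h1.symm.trans h2))
  · intro K _
    exact (Finset.nullMeasurableSet_biInter _ fun i _ => h₀ i).inter
      (Finset.nullMeasurableSet_biInter _ fun i _ => (h₀ i).compl)

/-- With `A n i` the event that cell `i` is empty, every event about the pattern of occupied cells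
is a finite disjoint union of exact patterns, each handled by inclusion-exclusion. -/
theorem tendsto_measureReal_occupancy {ι : Type*} [Finite ι]
    {Ω : ℕ → Type*} [∀ n, MeasurableSpace (Ω n)]
    {μ : ∀ n, Measure (Ω n)} [∀ n, IsProbabilityMeasure (μ n)]
    {Ω' : Type*} [MeasurableSpace Ω'] {μ' : Measure Ω'} [IsProbabilityMeasure μ']
    {A : ∀ n, ι → Set (Ω n)} {A' : ι → Set Ω'}
    (hA : ∀ n i, NullMeasurableSet (A n i) (μ n)) (hA' : ∀ i, NullMeasurableSet (A' i) μ')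
    (h : ∀ J : Finset ι, Tendsto (fun n => (μ n).real (⋂ i ∈ J, A n i)) atTop
      (𝓝 (μ'.real (⋂ i ∈ J, A' i)))) (𝒮 : Set (Set ι)) :
    Tendsto (fun n => (μ n).real {ω | {i | ω ∉ A n i} ∈ 𝒮}) atTop
      (𝓝 (μ'.real {ω | {i | ω ∉ A' i} ∈ 𝒮})) := by
  classical
  have := Fintype.ofFinite ι
  simp_rw [fun n => measureReal_occupancy_eq_sum (μ n) (hA n) 𝒮,
    measureReal_occupancy_eq_sum μ' hA' 𝒮]
  exact tendsto_finsetSum _ fun K _ => tendsto_measureReal_inter_compl hA hA' h K _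

/-- If the void probabilities of random sets `N n` converge to those of `N'` and the cost functions
converge uniformly, then the probabilities that there is a pair of points of low cost are
asymptotically sandwiched. -/
theorem eventually_levy_of_tendsto_void {X : Type*} [PseudoMetricSpace X] [MeasurableSpace X]
    [OpensMeasurableSpace X] {Ω : ℕ → Type*} [∀ n, MeasurableSpace (Ω n)]
    {μ : ∀ n, Measure (Ω n)} [∀ n, IsProbabilityMeasure (μ n)]
    {Ω' : Type*} [MeasurableSpace Ω'] {μ' : Measure Ω'} [IsProbabilityMeasure μ']
    {N : ∀ n, Ω n → Set X} {N' : Ω' → Set X} {K₁ K₂ : Set X}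
    (hK₁ : TotallyBounded K₁) (hK₂ : TotallyBounded K₂)
    (hm₁ : MeasurableSet K₁) (hm₂ : MeasurableSet K₂)
    (hN : ∀ n C, MeasurableSet C → C ⊆ K₁ ∪ K₂ →
      NullMeasurableSet {ω | Disjoint (N n ω) C} (μ n))
    (hN' : ∀ C, MeasurableSet C → C ⊆ K₁ ∪ K₂ →
      NullMeasurableSet {ω | Disjoint (N' ω) C} μ')
    (hvoid : ∀ C, MeasurableSet C → C ⊆ K₁ ∪ K₂ →
      Tendsto (fun n => (μ n).real {ω | Disjoint (N n ω) C}) atTop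
        (𝓝 (μ'.real {ω | Disjoint (N' ω) C})))
    {cost : ℕ → X → X → ℝ} {cost' : X → X → ℝ}
    (hc : UniformContinuousOn (fun p : X × X => cost' p.1 p.2) (K₁ ×ˢ K₂))
    (hconv : ∀ η > 0, ∀ᶠ n in atTop, ∀ x ∈ K₁, ∀ y ∈ K₂, |cost n x y - cost' x y| < η)
    (t : ℝ) {η : ℝ} (hη : 0 < η) :
    ∀ᶠ n in atTop,
      (μ n).real {ω | ∃ x ∈ N n ω ∩ K₁, ∃ y ∈ N n ω ∩ K₂, cost n x y < t} ≤
        μ'.real {ω | ∃ x ∈ N' ω ∩ K₁, ∃ y ∈ N' ω ∩ K₂, cost' x y < t + η} + η ∧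
      μ'.real {ω | ∃ x ∈ N' ω ∩ K₁, ∃ y ∈ N' ω ∩ K₂, cost' x y < t - η} - η ≤
        (μ n).real {ω | ∃ x ∈ N n ω ∩ K₁, ∃ y ∈ N n ω ∩ K₂, cost n x y < t} := by
  obtain ⟨δ, hδ, hδ'⟩ := Metric.uniformContinuousOn_iff.1 hc (η / 2) (by positivity)
  obtain ⟨s₁, hs₁, hcov₁⟩ := Metric.totallyBounded_iff.1 hK₁ (δ / 2) (by positivity)
  obtain ⟨s₂, hs₂, hcov₂⟩ := Metric.totallyBounded_iff.1 hK₂ (δ / 2) (by positivity)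
  have := hs₁.to_subtype
  have := hs₂.to_subtype
  -- Finitely many cells, so small that the limit cost varies by less than `η / 2` on a product of
  -- two cells. Cutting the balls with `K₁` and `K₂` keeps unions of cells inside the set where void
  -- probabilities are known to converge. The cells may overlap.
  set C : s₁ ⊕ s₂ → Set X := Sum.elim (fun x => Metric.ball x.1 (δ / 2) ∩ K₁)
    (fun x => Metric.ball x.1 (δ / 2) ∩ K₂) with hCdef
  have hCm : ∀ i, MeasurableSet (C i) := by
    rintro (i | i)
    · exact Metric.isOpen_ball.measurableSet.inter hm₁
    · exact Metric.isOpen_ball.measurableSet.inter hm₂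
  have hCs : ∀ i, C i ⊆ K₁ ∪ K₂ := by
    rintro (i | i)
    · exact fun x hx => Or.inl hx.2
    · exact fun x hx => Or.inr hx.2
  have hex₁ : ∀ x ∈ K₁, ∃ i, x ∈ C (Sum.inl i) := by
    intro x hx
    obtain ⟨z, hz, hz'⟩ := mem_iUnion₂.1 (hcov₁ hx)
    exact ⟨⟨z, hz⟩, hz', hx⟩
  have hex₂ : ∀ x ∈ K₂, ∃ i, x ∈ C (Sum.inr i) := by
    intro x hx
    obtain ⟨z, hz, hz'⟩ := mem_iUnion₂.1 (hcov₂ hx)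
    exact ⟨⟨z, hz⟩, hz', hx⟩
  have hosc : ∀ i j x x' y y', x ∈ C (Sum.inl i) → x' ∈ C (Sum.inl i) → y ∈ C (Sum.inr j) →
      y' ∈ C (Sum.inr j) → cost' x' y' < cost' x y + η / 2 := by
    intro i j x x' y y' hx hx' hy hy'
    have := hδ' (x', y') ⟨hx'.2, hy'.2⟩ (x, y) ⟨hx.2, hy.2⟩ (by
      rw [Prod.dist_eq, max_lt_iff]
      have h1 := Metric.mem_ball.1 hx.1
      have h2 := Metric.mem_ball.1 hx'.1
      have h3 := Metric.mem_ball.1 hy.1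
      have h4 := Metric.mem_ball.1 hy'.1
      constructor
      · linarith [dist_triangle_right x' x i.1]
      · linarith [dist_triangle_right y' y j.1])
    rw [Real.dist_eq, abs_lt] at this
    linarith [this.2]
  -- The occupancy patterns in which an occupied pair of cells contains somewhere a pair of cost
  -- below `r`; the cheap pair itself need not be occupied.
  set 𝒮 : ℝ → Set (Set (s₁ ⊕ s₂)) := fun r => {S | ∃ i j, Sum.inl i ∈ S ∧ Sum.inr j ∈ S ∧
    ∃ x ∈ C (Sum.inl i), ∃ y ∈ C (Sum.inr j), cost' x y < r} with hSdef
  have hlim : ∀ r, Tendsto (fun n => (μ n).real {ω | {i | ¬ Disjoint (N n ω) (C i)} ∈ 𝒮 r})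
      atTop (𝓝 (μ'.real {ω | {i | ¬ Disjoint (N' ω) (C i)} ∈ 𝒮 r})) := by
    intro r
    refine tendsto_measureReal_occupancy (A := fun n i => {ω | Disjoint (N n ω) (C i)})
      (A' := fun i => {ω | Disjoint (N' ω) (C i)})
      (fun n i => hN n _ (hCm i) (hCs i)) (fun i => hN' _ (hCm i) (hCs i)) (fun J => ?_) _
    have := hvoid (⋃ i ∈ J, C i) (Finset.measurableSet_biUnion _ fun i _ => hCm i)
      (iUnion₂_subset fun i _ => hCs i)
    simpa only [disjoint_iUnion_right, ofPred_forall] using this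
  have up : ∀ (M : Set X) (f : X → X → ℝ) (r r' : ℝ),
      (∀ x ∈ K₁, ∀ y ∈ K₂, f x y < r → cost' x y < r') →
      (∃ x ∈ M ∩ K₁, ∃ y ∈ M ∩ K₂, f x y < r) → {i | ¬ Disjoint M (C i)} ∈ 𝒮 r' := by
    rintro M f r r' hf ⟨x, hx, y, hy, hxy⟩
    obtain ⟨i, hi⟩ := hex₁ x hx.2
    obtain ⟨j, hj⟩ := hex₂ y hy.2
    exact ⟨i, j, not_disjoint_iff.2 ⟨x, hx.1, hi⟩, not_disjoint_iff.2 ⟨y, hy.1, hj⟩, x, hi, y, hj,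
      hf x hx.2 y hy.2 hxy⟩
  have down : ∀ (M : Set X) (f : X → X → ℝ) (r r' : ℝ),
      (∀ x ∈ K₁, ∀ y ∈ K₂, cost' x y < r + η / 2 → f x y < r') →
      {i | ¬ Disjoint M (C i)} ∈ 𝒮 r → ∃ x ∈ M ∩ K₁, ∃ y ∈ M ∩ K₂, f x y < r' := by
    rintro M f r r' hf ⟨i, j, hi, hj, x, hx, y, hy, hxy⟩
    obtain ⟨x', hx'M, hx'⟩ := not_disjoint_iff.1 hi
    obtain ⟨y', hy'M, hy'⟩ := not_disjoint_iff.1 hj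
    exact ⟨x', ⟨hx'M, hx'.2⟩, y', ⟨hy'M, hy'.2⟩, hf x' hx'.2 y' hy'.2
      (by linarith [hosc i j x x' y y' hx hx' hy hy'])⟩
  -- Passing from `cost n` to `cost'` costs `η / 2`, and so does replacing the cheap pair in the
  -- cells by occupied points. For the upper bound the pattern threshold is `t + η / 2`; for the
  -- lower bound it is `t - η`, and both losses occur on the way back to `t`.
  filter_upwards [hconv (η / 2) (by positivity),
    (Metric.tendsto_nhds.1 (hlim (t + η / 2)) η hη),
    (Metric.tendsto_nhds.1 (hlim (t - η)) η hη)] with n hn h1 h2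
  rw [Real.dist_eq, abs_lt] at h1 h2
  constructor
  · have i1 : (μ n).real {ω | ∃ x ∈ N n ω ∩ K₁, ∃ y ∈ N n ω ∩ K₂, cost n x y < t} ≤
        (μ n).real {ω | {i | ¬ Disjoint (N n ω) (C i)} ∈ 𝒮 (t + η / 2)} :=
      measureReal_mono fun ω => up (N n ω) (cost n) t (t + η / 2) fun x hx y hy hxy => by
        have := abs_lt.1 (hn x hx y hy); linarith [this.1]
    have i2 : μ'.real {ω | {i | ¬ Disjoint (N' ω) (C i)} ∈ 𝒮 (t + η / 2)} ≤
        μ'.real {ω | ∃ x ∈ N' ω ∩ K₁, ∃ y ∈ N' ω ∩ K₂, cost' x y < t + η} :=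
      measureReal_mono fun ω => down (N' ω) cost' (t + η / 2) (t + η)
        fun x hx y hy hxy => by linarith
    linarith [h1.2]
  · have i1 : μ'.real {ω | ∃ x ∈ N' ω ∩ K₁, ∃ y ∈ N' ω ∩ K₂, cost' x y < t - η} ≤
        μ'.real {ω | {i | ¬ Disjoint (N' ω) (C i)} ∈ 𝒮 (t - η)} :=
      measureReal_mono fun ω => up (N' ω) cost' (t - η) (t - η) fun x hx y hy hxy => hxy
    have i2 : (μ n).real {ω | {i | ¬ Disjoint (N n ω) (C i)} ∈ 𝒮 (t - η)} ≤
        (μ n).real {ω | ∃ x ∈ N n ω ∩ K₁, ∃ y ∈ N n ω ∩ K₂, cost n x y < t} :=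
      measureReal_mono fun ω => down (N n ω) (cost n) (t - η) t
        fun x hx y hy hxy => by have := abs_lt.1 (hn x hx y hy); linarith [this.2]
    linarith [h2.1]

/-! ### Void probabilities of a marked renewal process -/

/-- Prepend a first entry to a sequence. -/
def seqCons {X : Type*} (p : X × (ℕ → X)) : ℕ → X := fun n => Nat.casesOn n p.1 p.2

theorem measurable_seqCons {X : Type*} [MeasurableSpace X] :
    Measurable (seqCons : X × (ℕ → X) → ℕ → X) := by
  refine measurable_pi_iff.2 fun n => ?_
  cases n with
  | zero => exact measurable_fst
  | succ n => exact (measurable_pi_apply n).comp measurable_snd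

/-- An i.i.d. sequence consists of its first entry and an independent i.i.d. sequence. -/
theorem map_seqCons_infinitePi {X : Type*} [MeasurableSpace X] (ρ : Measure X)
    [IsProbabilityMeasure ρ] :
    (ρ.prod (Measure.infinitePi fun _ : ℕ => ρ)).map seqCons =
      Measure.infinitePi fun _ : ℕ => ρ := by
  classical
  refine Measure.eq_infinitePi _ fun s t ht => ?_
  obtain ⟨N, hN⟩ : ∃ N, s ⊆ Finset.range (N + 1) :=
    ⟨s.sup id, fun i hi => Finset.mem_range.2 (Nat.lt_succ_of_le (Finset.le_sup (f := id) hi))⟩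
  -- Padding with `univ` turns the index set into an initial segment without changing the product,
  -- so that the entry of index `0` can be split off and the rest shifted.
  set t' : ℕ → Set X := fun i => if i ∈ s then t i else univ with ht'
  have htm : ∀ i, MeasurableSet (t' i) := fun i => by
    simp only [ht']; split_ifs
    exacts [ht i, .univ]
  have hpi : (s : Set ℕ).pi t = ((Finset.range (N + 1) : Finset ℕ) : Set ℕ).pi t' := by
    ext x
    simp only [Set.mem_pi, Finset.mem_coe, ht']
    constructor
    · intro h i _
      split_ifs with hi
      exacts [h i hi, trivial]
    · intro h i hi
      have := h i (hN hi)
      rwa [if_pos hi] at this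
  have hprod : ∏ i ∈ s, ρ (t i) = ∏ i ∈ Finset.range (N + 1), ρ (t' i) := by
    rw [← Finset.prod_subset hN]
    · refine Finset.prod_congr rfl fun i hi => ?_
      simp only [ht', if_pos hi]
    · intro i _ hi
      simp only [ht', if_neg hi, measure_univ]
  have hpre : (seqCons : X × (ℕ → X) → ℕ → X) ⁻¹'
      ((Finset.range (N + 1) : Finset ℕ) : Set ℕ).pi t' =
      t' 0 ×ˢ ((Finset.range N : Finset ℕ) : Set ℕ).pi (fun i => t' (i + 1)) := by
    ext ⟨x, y⟩
    simp only [mem_preimage, Set.mem_pi, Finset.mem_coe, Finset.mem_range, mem_prod]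
    constructor
    · intro h
      exact ⟨h 0 (by omega), fun i hi => h (i + 1) (by omega)⟩
    · rintro ⟨h0, h1⟩ (_ | i) hi
      · exact h0
      · exact h1 i (by omega)
  rw [hpi, hprod, Measure.map_apply measurable_seqCons
    (.pi (Finset.countable_toSet _) fun i _ => htm i), hpre, Measure.prod_prod,
    Measure.infinitePi_pi _ (fun i _ => htm _), Finset.prod_range_succ', mul_comm]

instance isProbabilityMeasure_expMeasure_one : IsProbabilityMeasure (expMeasure 1) :=
  isProbabilityMeasure_expMeasure one_pos

instance isProbabilityMeasure_restrict_unitInterval :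
    IsProbabilityMeasure ((volume : Measure ℝ).restrict (Icc 0 1)) :=
  ⟨by simp⟩

/-- The law of an independent pair of a unit exponential and a uniform random variable. -/
noncomputable abbrev expUnif : Measure (ℝ × ℝ) :=
  (expMeasure 1).prod ((volume : Measure ℝ).restrict (Icc 0 1))

theorem lintegral_expMeasure_one {φ : ℝ → ℝ≥0∞} (hφ : Measurable φ) :
    ∫⁻ y, φ y ∂(expMeasure 1) = ∫⁻ y in Ioi 0, ENNReal.ofReal (Real.exp (-y)) * φ y := by
  have h1 : expMeasure 1 = volume.withDensity (exponentialPDF 1) := rfl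
  have hm : Measurable (exponentialPDF 1) :=
    ENNReal.measurable_ofReal.comp (measurable_exponentialPDFReal 1)
  rw [h1, lintegral_withDensity_eq_lintegral_mul _ hm hφ, ← setLIntegral_univ,
    ← lintegral_add_compl (μ := volume.restrict univ) _ (measurableSet_Ici (a := (0 : ℝ)))]
  rw [Measure.restrict_restrict measurableSet_Ici, inter_univ,
    Measure.restrict_restrict measurableSet_Ici.compl, inter_univ]
  have e1 : ∫⁻ y in (Ici (0 : ℝ))ᶜ, (exponentialPDF 1 * φ) y = 0 := by
    rw [setLIntegral_congr_fun (g := fun _ => 0) measurableSet_Ici.compl]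
    · simp
    · intro y hy
      simp only [compl_Ici, mem_Iio] at hy
      simp [exponentialPDF_of_neg hy]
  rw [e1, add_zero, restrict_Ioi_eq_restrict_Ici]
  refine setLIntegral_congr_fun measurableSet_Ici fun y hy => ?_
  simp [exponentialPDF_of_nonneg hy]

theorem ae_expMeasure_pos : ∀ᵐ y ∂(expMeasure 1), 0 < y := by
  rw [ae_iff]
  have := lintegral_expMeasure_one (φ := indicator {y | ¬ 0 < y} 1)
    (measurable_one.indicator (by measurability))
  rw [lintegral_indicator_one (by measurability)] at this
  rw [this, setLIntegral_congr_fun (g := fun _ => 0) measurableSet_Ioi]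
  · simp
  · intro y hy
    simp [mem_Ioi.1 hy]

/-- Partial sums of the first coordinates, paired with the second coordinates. -/
noncomputable def renewalPoint (s : ℝ) (yu : ℕ → ℝ × ℝ) (m : ℕ) : ℝ × ℝ :=
  (s + ∑ j ∈ Finset.range (m + 1), (yu j).1, (yu m).2)

theorem measurable_renewalPoint (m : ℕ) :
    Measurable fun p : ℝ × (ℕ → ℝ × ℝ) => renewalPoint p.1 p.2 m := by
  unfold renewalPoint
  fun_prop

theorem renewalPoint_seqCons_zero (s : ℝ) (p : (ℝ × ℝ) × (ℕ → ℝ × ℝ)) :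
    renewalPoint s (seqCons p) 0 = (s + p.1.1, p.1.2) := by
  simp [renewalPoint, seqCons]

theorem renewalPoint_seqCons_succ (s : ℝ) (p : (ℝ × ℝ) × (ℕ → ℝ × ℝ)) (m : ℕ) :
    renewalPoint s (seqCons p) (m + 1) = renewalPoint (s + p.1.1) p.2 m := by
  simp only [renewalPoint, Finset.sum_range_succ' _ (m + 1)]
  congr 1
  change s + (∑ x ∈ Finset.range (m + 1), (p.2 x).1 + p.1.1) = _
  ring

/-- The event that no renewal point started at `s` lies in `B`. -/
def voidEvent (B : Set (ℝ × ℝ)) (s : ℝ) : Set (ℕ → ℝ × ℝ) := {yu | ∀ m, renewalPoint s yu m ∉ B}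

theorem measurableSet_voidEvent_prod {B : Set (ℝ × ℝ)} (hB : MeasurableSet B) :
    MeasurableSet {p : ℝ × (ℕ → ℝ × ℝ) | p.2 ∈ voidEvent B p.1} := by
  have : {p : ℝ × (ℕ → ℝ × ℝ) | p.2 ∈ voidEvent B p.1} =
      ⋂ m, (fun p : ℝ × (ℕ → ℝ × ℝ) => renewalPoint p.1 p.2 m) ⁻¹' Bᶜ := by
    ext p; simp [voidEvent]
  rw [this]
  exact MeasurableSet.iInter fun m => measurable_renewalPoint m hB.compl

theorem measurableSet_voidEvent {B : Set (ℝ × ℝ)} (hB : MeasurableSet B) (s : ℝ) :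
    MeasurableSet (voidEvent B s) :=
  measurable_prodMk_left (x := s) (measurableSet_voidEvent_prod hB)

theorem measurable_measure_voidEvent {B : Set (ℝ × ℝ)} (hB : MeasurableSet B)
    (ν : Measure (ℕ → ℝ × ℝ)) [SFinite ν] : Measurable fun s => ν (voidEvent B s) :=
  measurable_measure_prodMk_left (measurableSet_voidEvent_prod hB)

/-- The uniform measure of the part of a slice that is not covered by `B`. -/
noncomputable def sliceCompl (B : Set (ℝ × ℝ)) (x : ℝ) : ℝ≥0∞ :=
  (volume.restrict (Icc (0 : ℝ) 1)) {u | (x, u) ∉ B}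

theorem measurable_sliceCompl {B : Set (ℝ × ℝ)} (hB : MeasurableSet B) :
    Measurable (sliceCompl B) :=
  measurable_measure_prodMk_left hB.compl

theorem sliceCompl_le_one (B : Set (ℝ × ℝ)) (x : ℝ) : sliceCompl B x ≤ 1 := prob_le_one

/-- Condition on the first waiting time `y` and mark: that point has to miss `B`, and afterwards the
process starts afresh from `s + y`. -/
theorem measure_voidEvent_eq_lintegral {B : Set (ℝ × ℝ)} (hB : MeasurableSet B) (s : ℝ) :
    Measure.infinitePi (fun _ : ℕ => expUnif) (voidEvent B s) =
      ∫⁻ y in Ioi 0, ENNReal.ofReal (Real.exp (-y)) * (sliceCompl B (s + y) *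
        Measure.infinitePi (fun _ : ℕ => expUnif) (voidEvent B (s + y))) := by
  set ν := Measure.infinitePi (fun _ : ℕ => expUnif) with hν
  have hVm := measurable_measure_voidEvent hB ν
  conv_lhs => rw [hν, ← map_seqCons_infinitePi]
  rw [Measure.map_apply measurable_seqCons (measurableSet_voidEvent hB s),
    Measure.prod_apply (measurable_seqCons (measurableSet_voidEvent hB s))]
  have hsl : ∀ p : ℝ × ℝ, ν (Prod.mk p ⁻¹' (seqCons ⁻¹' voidEvent B s)) =
      indicator {q : ℝ × ℝ | (s + q.1, q.2) ∉ B} (fun q => ν (voidEvent B (s + q.1))) p := by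
    intro p
    by_cases hp : (s + p.1, p.2) ∈ B
    · rw [indicator_of_notMem (by simpa using hp)]
      convert! measure_empty (μ := ν)
      ext yu
      simp only [mem_preimage, voidEvent, mem_ofPred_eq, mem_empty_iff_false, iff_false]
      intro h
      apply h 0
      rwa [renewalPoint_seqCons_zero]
    · rw [indicator_of_mem (by simpa using hp)]
      congr 1
      ext yu
      simp only [mem_preimage, voidEvent, mem_ofPred_eq]
      constructor
      · intro h m
        have := h (m + 1)
        rwa [renewalPoint_seqCons_succ] at this
      · rintro h (_ | m)
        · rwa [renewalPoint_seqCons_zero]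
        · rw [renewalPoint_seqCons_succ]
          exact h m
  have hset : MeasurableSet {q : ℝ × ℝ | (s + q.1, q.2) ∉ B} :=
    ((measurable_const.add measurable_fst).prodMk measurable_snd) hB.compl
  rw [← hν]
  simp_rw [hsl]
  have hind : Measurable (indicator {q : ℝ × ℝ | (s + q.1, q.2) ∉ B}
      (fun q => ν (voidEvent B (s + q.1)))) :=
    Measurable.indicator (hVm.comp (measurable_const.add measurable_fst)) hset
  rw [lintegral_prod _ hind.aemeasurable]
  have hin : ∀ y : ℝ, ∫⁻ u in Icc (0 : ℝ) 1,
      indicator {q : ℝ × ℝ | (s + q.1, q.2) ∉ B} (fun q => ν (voidEvent B (s + q.1))) (y, u) =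
      sliceCompl B (s + y) * ν (voidEvent B (s + y)) := by
    intro y
    have hslice : MeasurableSet {u : ℝ | (s + y, u) ∉ B} :=
      (measurable_prodMk_left (x := s + y)) hB.compl
    have : ∀ u : ℝ, indicator {q : ℝ × ℝ | (s + q.1, q.2) ∉ B}
        (fun q => ν (voidEvent B (s + q.1))) (y, u) =
        indicator {u : ℝ | (s + y, u) ∉ B} (fun _ => ν (voidEvent B (s + y))) u := by
      intro u
      by_cases h : (s + y, u) ∈ B <;> simp [indicator, h]
    simp_rw [this]
    rw [lintegral_indicator hslice, setLIntegral_const, mul_comm]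
    rfl
  simp_rw [hin]
  exact lintegral_expMeasure_one (((measurable_sliceCompl hB).comp (measurable_const_add s)).mul
    (hVm.comp (measurable_const_add s)))

theorem ae_infinitePi_pos_mem :
    ∀ᵐ yu ∂(Measure.infinitePi fun _ : ℕ => expUnif), ∀ j, 0 < (yu j).1 ∧ (yu j).2 ∈ Icc 0 1 := by
  rw [ae_all_iff]
  intro j
  have h1 : ∀ᵐ p ∂expUnif, 0 < p.1 :=
    Measure.quasiMeasurePreserving_fst.ae ae_expMeasure_pos
  have h2 : ∀ᵐ p ∂expUnif, p.2 ∈ Icc (0 : ℝ) 1 :=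
    Measure.quasiMeasurePreserving_snd.ae (ae_restrict_mem measurableSet_Icc)
  exact (measurePreserving_eval_infinitePi (fun _ : ℕ => expUnif) j).quasiMeasurePreserving.ae
    (h1.and h2)

theorem measure_voidEvent_eq_one {B : Set (ℝ × ℝ)} {T s : ℝ}
    (hT : ∀ p ∈ B, p.1 < T) (hs : T ≤ s) :
    Measure.infinitePi (fun _ : ℕ => expUnif) (voidEvent B s) = 1 := by
  have : ∀ᵐ yu ∂(Measure.infinitePi fun _ : ℕ => expUnif), yu ∈ voidEvent B s := by
    filter_upwards [ae_infinitePi_pos_mem] with yu hyu m hm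
    have h1 := hT _ hm
    have h2 : 0 ≤ ∑ j ∈ Finset.range (m + 1), (yu j).1 := Finset.sum_nonneg fun j _ =>
      (hyu j).1.le
    simp only [renewalPoint] at h1
    linarith
  exact (measure_congr (eventuallyEq_univ.2 this)).trans measure_univ

theorem intervalIntegrable_of_mem_unitInterval {φ : ℝ → ℝ} (hφ : Measurable φ)
    (h : ∀ x, φ x ∈ Icc (0 : ℝ) 1) (a b : ℝ) : IntervalIntegrable φ volume a b := by
  refine (intervalIntegrable_const (c := (1 : ℝ))).mono_fun hφ.aestronglyMeasurable
    (Eventually.of_forall fun x => ?_)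
  simpa [abs_of_nonneg (h x).1] using (h x).2

theorem locallyIntegrable_of_mem_unitInterval {φ : ℝ → ℝ} (hφ : Measurable φ)
    (h : ∀ x, φ x ∈ Icc (0 : ℝ) 1) : LocallyIntegrable φ volume := by
  refine (locallyIntegrable_const (1 : ℝ)).mono hφ.aestronglyMeasurable
    (Eventually.of_forall fun x => ?_)
  rw [Real.norm_of_nonneg (h x).1, norm_one]
  exact (h x).2

/-- The unique bounded solution of the renewal equation for exponential waiting times. -/
theorem eq_exp_of_renewal_equation {c G : ℝ → ℝ} {T : ℝ} (hT : 0 ≤ T) (hc : Measurable c)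
    (hc01 : ∀ x, c x ∈ Icc (0 : ℝ) 1) (hG : LocallyIntegrable (fun x => c x * G x) volume)
    (h : ∀ s ∈ Icc 0 T, G s = Real.exp (-T) + ∫ x in s..T, c x * G x) :
    G 0 = Real.exp (-∫ x in 0..T, (1 - c x)) := by
  have hGi : ∀ a b, IntervalIntegrable (fun x => c x * G x) volume a b := fun a b =>
    intervalIntegrable_iff.mpr
      ((hG.integrableOn_isCompact isCompact_uIcc).mono_set uIoc_subset_uIcc)
  have hci := intervalIntegrable_of_mem_unitInterval hc hc01
  -- `Γ` agrees with `G` on `[0, T]` and, being an integral, is absolutely continuous. Almost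
  -- everywhere on `[0, T]`, `Γ' = -c Γ` and `K' = c`, so `Γ * exp K` is constant there. As `c` is
  -- only measurable, absolute continuity replaces differentiability everywhere.
  set Γ : ℝ → ℝ := fun s => Real.exp (-T) - ∫ x in T..s, c x * G x with hΓ
  set K : ℝ → ℝ := fun s => ∫ x in 0..s, c x with hK
  have hGΓ : ∀ s ∈ Icc 0 T, Γ s = G s := fun s hs => by
    rw [h s hs, hΓ, intervalIntegral.integral_symm T s]; ring
  have hKd : ∀ᵐ x, HasDerivAt K (c x) x := by
    filter_upwards [LocallyIntegrable.ae_hasDerivAt_integral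
      (locallyIntegrable_of_mem_unitInterval hc hc01)]
      with x hx using hx 0
  have hΓd : ∀ᵐ x, HasDerivAt Γ (-(c x * G x)) x := by
    filter_upwards [LocallyIntegrable.ae_hasDerivAt_integral hG] with x hx
    simpa using (hx T).const_sub (Real.exp (-T))
  have hΓac : AbsolutelyContinuousOnInterval Γ 0 T := by
    have h1 := (hGi 0 T).absolutelyContinuousOnInterval_intervalIntegral (c := T) (by simp)
    have h2 : AbsolutelyContinuousOnInterval (fun _ : ℝ => Real.exp (-T)) 0 T :=
      ((LipschitzWith.const _).lipschitzOnWith (s := uIcc 0 T)).absolutelyContinuousOnInterval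
    exact h2.fun_sub h1
  have hKle : ∀ s ∈ Icc 0 T, K s ≤ T := fun s hs => by
    calc K s ≤ ∫ x in 0..s, (1 : ℝ) :=
          intervalIntegral.integral_mono_on hs.1 (hci _ _) intervalIntegrable_const
            fun x _ => (hc01 x).2
      _ ≤ T := by simpa using hs.2
  have hKlip : LipschitzWith 1 K := by
    refine LipschitzWith.of_dist_le_mul fun x y => ?_
    rw [Real.dist_eq, hK, intervalIntegral.integral_interval_sub_left (hci _ _) (hci _ _),
      ← Real.norm_eq_abs]
    refine (intervalIntegral.norm_integral_le_of_norm_le_const (C := 1) fun z _ => ?_).trans ?_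
    · rw [Real.norm_of_nonneg (hc01 z).1]; exact (hc01 z).2
    · rw [Real.dist_eq]; simp
  -- `exp` is Lipschitz only on half-lines bounded above, which is why the bound `K ≤ T` is needed.
  have hexp : LipschitzOnWith (Real.exp T).toNNReal Real.exp (Iic T) := by
    refine Convex.lipschitzOnWith_of_nnnorm_deriv_le (fun x _ => Real.differentiableAt_exp)
      (fun x hx => ?_) (convex_Iic T)
    rw [Real.deriv_exp, ← NNReal.coe_le_coe, coe_nnnorm, Real.norm_of_nonneg (Real.exp_pos _).le,
      Real.coe_toNNReal _ (Real.exp_pos _).le]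
    exact Real.exp_le_exp.2 hx
  have hEac : AbsolutelyContinuousOnInterval (fun s => Real.exp (K s)) 0 T := by
    refine LipschitzOnWith.absolutelyContinuousOnInterval
      (hexp.comp (hKlip.lipschitzOnWith (s := uIcc 0 T)) ?_)
    intro s hs
    rw [uIcc_of_le hT] at hs
    exact hKle s hs
  obtain ⟨C, hC⟩ := (hΓac.mul hEac).const_of_ae_hasDerivAt_zero (by
    filter_upwards [hKd, hΓd] with x hx1 hx2 hx
    rw [uIcc_of_le hT] at hx
    have := hx2.mul hx1.exp
    convert! this using 1
    rw [hGΓ x hx]; ring)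
  have h0 := hC 0 (by simp)
  have h1 := hC T (by simp)
  rw [Pi.mul_apply] at h0 h1
  have e0 : K 0 = 0 := by simp [hK]
  have e1 : Γ T = Real.exp (-T) := by simp [hΓ]
  rw [e0, Real.exp_zero, mul_one, hGΓ 0 ⟨le_rfl, hT⟩] at h0
  rw [e1] at h1
  rw [h0, ← h1, ← Real.exp_add, intervalIntegral.integral_sub intervalIntegrable_const (hci _ _)]
  simp [hK, add_comm, sub_eq_add_neg]

/-- The renewal points with exponential waiting times and uniform marks have the void
probabilities of a homogeneous Poisson process. -/
theorem measure_voidEvent {B : Set (ℝ × ℝ)} (hB : MeasurableSet B) {T : ℝ} (hT : 0 ≤ T)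
    (hBT : ∀ p ∈ B, p.1 < T) :
    (Measure.infinitePi (fun _ : ℕ => expUnif)).real (voidEvent B 0) =
      Real.exp (-volume.real (B ∩ Ioi 0 ×ˢ Icc 0 1)) := by
  set ν := Measure.infinitePi (fun _ : ℕ => expUnif) with hν
  set v : ℝ → ℝ := fun s => ν.real (voidEvent B s) with hv
  set c : ℝ → ℝ := fun s => (sliceCompl B s).toReal with hc
  have hvm : Measurable v := (measurable_measure_voidEvent hB ν).ennreal_toReal
  have hcm : Measurable c := (measurable_sliceCompl hB).ennreal_toReal
  have hc01 : ∀ x, c x ∈ Icc (0 : ℝ) 1 := fun x =>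
    ⟨ENNReal.toReal_nonneg, ENNReal.toReal_le_of_le_ofReal zero_le_one
      (by simpa using sliceCompl_le_one B x)⟩
  have hv01 : ∀ x, v x ∈ Icc (0 : ℝ) 1 := fun x => ⟨measureReal_nonneg, measureReal_le_one⟩
  have hvT : ∀ s, T ≤ s → v s = 1 := fun s hs => by
    simp only [hv, measureReal_def, hν, measure_voidEvent_eq_one hBT hs, ENNReal.toReal_one]
  have hcT : ∀ s, T ≤ s → c s = 1 := fun s hs => by
    have : {u : ℝ | (s, u) ∉ B} = univ := by
      ext u
      simpa using fun h => not_lt.2 hs (hBT _ h)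
    simp [hc, sliceCompl, this]
  -- The factor `exp (-x)` absorbs the exponential density, so the renewal equation becomes `G s = ∫
  -- x in Ioi s, c x * G x`. Beyond `T` both `c` and `v` are `1`, and the tail contributes `exp
  -- (-T)`.
  set G : ℝ → ℝ := fun x => Real.exp (-x) * v x with hG
  have hcG : Measurable fun x => c x * G x := by
    exact hcm.mul ((by fun_prop : Measurable fun x : ℝ => Real.exp (-x)).mul hvm)
  have hcGle : ∀ x, ‖c x * G x‖ ≤ ‖Real.exp (-x)‖ := fun x => by
    rw [norm_mul, norm_mul, Real.norm_of_nonneg (hc01 x).1, Real.norm_of_nonneg (hv01 x).1]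
    calc c x * (‖Real.exp (-x)‖ * v x) ≤ 1 * (‖Real.exp (-x)‖ * 1) :=
          mul_le_mul (hc01 x).2 (mul_le_mul_of_nonneg_left (hv01 x).2 (norm_nonneg _))
            (mul_nonneg (norm_nonneg _) (hv01 x).1) zero_le_one
      _ = _ := by ring
  have hloc : LocallyIntegrable (fun x => c x * G x) volume :=
    (Continuous.locallyIntegrable (by fun_prop : Continuous fun x : ℝ => Real.exp (-x))).mono
      hcG.aestronglyMeasurable (Eventually.of_forall hcGle)
  have hint : ∀ s, IntegrableOn (fun x => c x * G x) (Ioi s) volume := fun s =>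
    Integrable.mono (integrableOn_exp_neg_Ioi s) hcG.aestronglyMeasurable
      (Eventually.of_forall hcGle)
  have hrec : ∀ s, G s = ∫ x in Ioi s, c x * G x := by
    intro s
    have h1 := measure_voidEvent_eq_lintegral hB s
    rw [← hν] at h1
    have h2 : ∫⁻ y in Ioi 0, ENNReal.ofReal (Real.exp (-y)) * (sliceCompl B (s + y) *
        ν (voidEvent B (s + y))) =
        ∫⁻ x in Ioi s, ENNReal.ofReal (Real.exp s * (c x * G x)) := by
      have hmp := measurePreserving_add_left (volume : Measure ℝ) s
      have hm : Measurable fun x => ENNReal.ofReal (Real.exp s * (c x * G x)) :=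
        (hcG.const_mul _).ennreal_ofReal
      rw [← hmp.setLIntegral_comp_preimage measurableSet_Ioi hm]
      simp only [preimage_const_add_Ioi, sub_self]
      refine lintegral_congr fun y => ?_
      have : Real.exp s * (c (s + y) * G (s + y)) =
          Real.exp (-y) * (c (s + y) * v (s + y)) := by
        simp only [hG]
        have : Real.exp (-y) = Real.exp s * Real.exp (-(s + y)) := by
          rw [← Real.exp_add]; congr 1; ring
        rw [this]; ring
      rw [this, ENNReal.ofReal_mul (Real.exp_pos _).le, ENNReal.ofReal_mul (hc01 _).1]
      congr 2
      · exact (ENNReal.ofReal_toReal (ne_top_of_le_ne_top ENNReal.one_ne_top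
          (sliceCompl_le_one B _))).symm
      · exact (ofReal_measureReal (measure_ne_top _ _)).symm
    rw [h2, ← ofReal_integral_eq_lintegral_ofReal ((hint s).const_mul _)
      (Eventually.of_forall fun x => mul_nonneg (Real.exp_pos _).le
        (mul_nonneg (hc01 x).1 (mul_nonneg (Real.exp_pos _).le (hv01 x).1)))] at h1
    have h3 : v s = ∫ x in Ioi s, Real.exp s * (c x * G x) := by
      simp only [hv, measureReal_def, h1]
      refine ENNReal.toReal_ofReal (integral_nonneg fun x => mul_nonneg (Real.exp_pos _).le
        (mul_nonneg (hc01 x).1 (mul_nonneg (Real.exp_pos _).le (hv01 x).1)))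
    rw [integral_const_mul] at h3
    simp only [hG] at h3 ⊢
    rw [h3, ← mul_assoc, ← Real.exp_add]
    simp
  have hmain := eq_exp_of_renewal_equation hT hcm hc01 hloc (fun s hs => by
    rw [hrec s, ← intervalIntegral.integral_interval_add_Ioi (hint s) (hint T), add_comm]
    congr 1
    rw [← integral_exp_neg_Ioi]
    refine setIntegral_congr_fun measurableSet_Ioi fun x hx => ?_
    simp [hG, hcT x (le_of_lt hx), hvT x (le_of_lt hx)])
  have hG0 : G 0 = v 0 := by simp [hG]
  change v 0 = _
  rw [← hG0, hmain]
  congr 2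
  -- Fubini: `1 - c x` is the length of the slice of `B` at `x` within the unit interval of marks.
  have hvol : volume (B ∩ Ioi 0 ×ˢ Icc 0 1) = ENNReal.ofReal (∫ x in 0..T, (1 - c x)) := by
    rw [intervalIntegral.integral_of_le hT, ofReal_integral_eq_lintegral_ofReal
      ((intervalIntegrable_iff_integrableOn_Ioc_of_le hT).1
        (intervalIntegrable_const.sub (intervalIntegrable_of_mem_unitInterval hcm hc01 0 T)))
      (Eventually.of_forall fun x => sub_nonneg.2 (hc01 x).2), Measure.volume_eq_prod,
      Measure.prod_apply (hB.inter (measurableSet_Ioi.prod measurableSet_Icc)),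
      ← lintegral_indicator measurableSet_Ioc]
    refine lintegral_congr fun x => ?_
    by_cases hx : x ∈ Ioc 0 T
    · rw [indicator_of_mem hx]
      have e1 : Prod.mk x ⁻¹' (B ∩ Ioi 0 ×ˢ Icc 0 1) = {u | (x, u) ∉ B}ᶜ ∩ Icc (0 : ℝ) 1 := by
        ext u
        simp [hx.1]
      have hm : MeasurableSet {u : ℝ | (x, u) ∉ B} := (measurable_prodMk_left (x := x)) hB.compl
      rw [e1, ← Measure.restrict_apply hm.compl, prob_compl_eq_one_sub hm,
        ENNReal.ofReal_sub _ (hc01 x).1, ENNReal.ofReal_one]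
      congr 1
      exact (ENNReal.ofReal_toReal (ne_top_of_le_ne_top ENNReal.one_ne_top
          (sliceCompl_le_one B _))).symm
    · rw [indicator_of_notMem hx]
      convert! measure_empty (μ := (volume : Measure ℝ))
      ext u
      simp only [mem_preimage, mem_inter_iff, mem_prod, mem_Ioi, mem_Icc, mem_empty_iff_false,
        iff_false]
      rintro ⟨h1, h2, -⟩
      exact hx ⟨h2, (hBT _ h1).le⟩
  rw [measureReal_def, hvol, ENNReal.toReal_ofReal]
  exact intervalIntegral.integral_nonneg hT fun x _ => sub_nonneg.2 (hc01 x).2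

/-- The partial sums of unit exponential variables are almost surely unbounded. -/
theorem ae_exists_lt_renewal :
    ∀ᵐ yu ∂(Measure.infinitePi fun _ : ℕ => expUnif), ∀ T : ℝ, ∃ m,
      T < ∑ j ∈ Finset.range (m + 1), (yu j).1 := by
  have key : ∀ k : ℕ, ∀ᵐ yu ∂(Measure.infinitePi fun _ : ℕ => expUnif), ∃ m,
      (k : ℝ) < ∑ j ∈ Finset.range (m + 1), (yu j).1 := by
    intro k
    rw [ae_iff, ← measureReal_eq_zero_iff]
    refine le_antisymm ?_ measureReal_nonneg
    refine ge_of_tendsto' (x := atTop) (f := fun j : ℕ => Real.exp (-(j : ℝ))) ?_ fun j => ?_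
    · exact Real.tendsto_exp_neg_atTop_nhds_zero.comp tendsto_natCast_atTop_atTop
    -- Partial sums bounded by `k` leave the strip between `k` and `k + j` empty, an event of
    -- probability `exp (-j)` for every `j`.
    · have h1 := measure_voidEvent (B := Ioo (k : ℝ) (k + j) ×ˢ univ)
        (measurableSet_Ioo.prod .univ) (T := k + j) (by positivity) (fun p hp => hp.1.2)
      have h2 : Ioo (k : ℝ) (k + j) ×ˢ univ ∩ Ioi 0 ×ˢ Icc (0 : ℝ) 1 =
          Ioo (k : ℝ) (k + j) ×ˢ Icc 0 1 := by
        rw [prod_inter_prod, univ_inter, inter_eq_left.2]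
        exact fun x hx => lt_of_le_of_lt (Nat.cast_nonneg k) hx.1
      have h3 : volume.real (Ioo (k : ℝ) (k + j) ×ˢ Icc (0 : ℝ) 1) = j := by
        rw [measureReal_def, Measure.volume_eq_prod, Measure.prod_prod]
        simp
      rw [h2, h3] at h1
      rw [← h1]
      refine measureReal_mono fun yu hyu m hm => ?_
      simp only [not_exists, not_lt, mem_ofPred_eq] at hyu
      have := hm.1.1
      simp only [renewalPoint, zero_add] at this
      exact not_lt.2 (hyu m) this
  filter_upwards [ae_all_iff.2 key] with yu hyu T
  obtain ⟨k, hk⟩ := exists_nat_gt T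
  obtain ⟨m, hm⟩ := hyu k
  exact ⟨m, hk.trans hm⟩

/-! ### From arrival times and marks to the parabolic region -/

theorem det_prod_smul_fst_snd (A B C D : ℝ) :
    ((A • ContinuousLinearMap.fst ℝ ℝ ℝ + B • ContinuousLinearMap.snd ℝ ℝ ℝ).prod
      (C • ContinuousLinearMap.fst ℝ ℝ ℝ + D • ContinuousLinearMap.snd ℝ ℝ ℝ)).det =
      A * D - B * C := by
  rw [ContinuousLinearMap.det, ← LinearMap.det_toMatrix (Module.Basis.finTwoProd ℝ),
    Matrix.det_fin_two]
  simp [LinearMap.toMatrix_apply]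

/-- Position of a limit point in terms of its arrival time and its mark. -/
noncomputable def arrivalMap (a σ β : ℝ) (p : ℝ × ℝ) : ℝ × ℝ :=
  (σ * (p.1 ^ (1 / 3 : ℝ)) ^ 2 + (p.2 * (β * p.1 ^ (1 / 3 : ℝ))) ^ 2 / (2 * a),
    p.2 * (β * p.1 ^ (1 / 3 : ℝ)))

theorem measurable_arrivalMap (a σ β : ℝ) : Measurable (arrivalMap a σ β) := by
  unfold arrivalMap
  fun_prop

/-- With `ρ = s^(1/3)`, adding `v² / (2a)` is a shear and does not affect the determinant. What
remains is `2σρρ' * βρ`, and `ρ²ρ' = 1/3` is constant. The exponents `2/3` and `1/3` are those that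
carry a homogeneous process to a homogeneous one. -/
theorem hasFDerivAt_arrivalMap {a σ β : ℝ} (ha : 0 < a) {p : ℝ × ℝ} (hp : 0 < p.1) :
    ∃ L : ℝ × ℝ →L[ℝ] ℝ × ℝ, HasFDerivAt (arrivalMap a σ β) L p ∧ L.det = 2 / 3 * σ * β := by
  set ρ : ℝ := p.1 ^ (1 / 3 : ℝ) with hρ
  set ρ' : ℝ := (1 / 3 : ℝ) * p.1 ^ ((1 / 3 : ℝ) - 1) with hρ'
  have hρρ : ρ ^ 2 * ρ' = 1 / 3 := by
    have h1 : ρ ^ 2 = p.1 ^ (2 / 3 : ℝ) := by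
      rw [hρ, ← Real.rpow_natCast, ← Real.rpow_mul hp.le]; norm_num
    have h2 : p.1 ^ (2 / 3 : ℝ) * p.1 ^ ((1 / 3 : ℝ) - 1) = 1 := by
      rw [← Real.rpow_add hp]; norm_num
    rw [h1, hρ']; linear_combination (1 / 3 : ℝ) * h2
  have hd : HasFDerivAt (fun p : ℝ × ℝ => p.1 ^ (1 / 3 : ℝ))
      (ρ' • ContinuousLinearMap.fst ℝ ℝ ℝ) p :=
    (Real.hasDerivAt_rpow_const (x := p.1) (p := 1 / 3) (Or.inl hp.ne')).comp_hasFDerivAt p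
      hasFDerivAt_fst
  have hv : HasFDerivAt (fun p : ℝ × ℝ => p.2 * (β * p.1 ^ (1 / 3 : ℝ)))
      ((p.2 * β * ρ') • ContinuousLinearMap.fst ℝ ℝ ℝ +
        (β * ρ) • ContinuousLinearMap.snd ℝ ℝ ℝ) p := by
    refine (hasFDerivAt_snd.mul (hd.const_mul β)).congr_fderiv ?_
    ext <;> simp [hρ] <;> ring
  have hu : HasFDerivAt (fun p : ℝ × ℝ => σ * (p.1 ^ (1 / 3 : ℝ)) ^ 2 +
      (p.2 * (β * p.1 ^ (1 / 3 : ℝ))) ^ 2 / (2 * a))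
      ((2 * σ * ρ * ρ' + p.2 * β * ρ * (p.2 * β * ρ') / a) • ContinuousLinearMap.fst ℝ ℝ ℝ +
        (p.2 * β * ρ * (β * ρ) / a) • ContinuousLinearMap.snd ℝ ℝ ℝ) p := by
    have := ((hd.pow 2).const_mul σ).add ((hv.pow 2).mul_const (2 * a)⁻¹)
    refine HasFDerivAt.congr_fderiv this ?_
    ext <;> simp [hρ] <;> field_simp
  refine ⟨_, hu.prodMk hv, ?_⟩
  rw [det_prod_smul_fst_snd]
  field_simp
  linear_combination (2 * σ * β * 3 * a) * hρρ

/-- The region that carries the limit points. -/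
def arrivalRegion (a κ : ℝ) : Set (ℝ × ℝ) := {x | 0 < x.2 ∧ x.2 ^ 2 < κ * (x.1 - x.2 ^ 2 / (2 * a))}

/-- The quantity `u - v² / (2a)` recovers `σ s^(2/3)`, hence `s`, and then `v` recovers the mark
`U`. Given `β² = κσ`, the condition `U < 1` is the inequality defining the region. -/
theorem bijOn_arrivalMap {a σ β κ : ℝ} (hσ : 0 < σ) (hβ : 0 < β) (hκ : 0 < κ)
    (h : β ^ 2 = κ * σ) :
    BijOn (arrivalMap a σ β) (Ioi 0 ×ˢ Ioo 0 1) (arrivalRegion a κ) := by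
  refine ⟨?_, ?_, ?_⟩
  · rintro ⟨s, U⟩ ⟨hs, hU0, hU1⟩
    simp only [mem_Ioi] at hs hU0 hU1
    have hρ : 0 < s ^ (1 / 3 : ℝ) := Real.rpow_pos_of_pos hs _
    refine ⟨mul_pos hU0 (mul_pos hβ hρ), ?_⟩
    simp only [arrivalMap, add_sub_cancel_right]
    have : U ^ 2 < 1 := by nlinarith
    calc (U * (β * s ^ (1 / 3 : ℝ))) ^ 2 = U ^ 2 * (κ * σ * (s ^ (1 / 3 : ℝ)) ^ 2) := by
          rw [← h]; ring
      _ < 1 * (κ * σ * (s ^ (1 / 3 : ℝ)) ^ 2) := by gcongr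
      _ = _ := by ring
  · rintro ⟨s, U⟩ ⟨hs, hU0, hU1⟩ ⟨s', U'⟩ ⟨hs', hU0', hU1'⟩ heq
    simp only [mem_Ioi] at hs hU0 hU1 hs' hU0' hU1'
    simp only [arrivalMap, Prod.mk.injEq] at heq
    obtain ⟨h1, h2⟩ := heq
    have hρ : 0 < s ^ (1 / 3 : ℝ) := Real.rpow_pos_of_pos hs _
    have hρ' : 0 < s' ^ (1 / 3 : ℝ) := Real.rpow_pos_of_pos hs' _
    rw [h2, add_left_inj] at h1
    have h3 := mul_left_cancel₀ hσ.ne' h1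
    have h4 : s ^ (1 / 3 : ℝ) = s' ^ (1 / 3 : ℝ) := (pow_left_inj₀ hρ.le hρ'.le two_ne_zero).1 h3
    have h5 : s = s' := (Real.rpow_left_inj hs.le hs'.le (by norm_num)).1 h4
    rw [h4] at h2
    have h6 := mul_right_cancel₀ (mul_pos hβ hρ').ne' h2
    rw [h5, h6]
  · rintro ⟨u, v⟩ ⟨hv, huv⟩
    simp only at hv huv
    set r := u - v ^ 2 / (2 * a) with hr
    have hr0 : 0 < r := by
      by_contra hcon
      have : κ * r ≤ 0 := mul_nonpos_of_nonneg_of_nonpos hκ.le (not_lt.1 hcon)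
      nlinarith
    have hρ0 : 0 < √(r / σ) := Real.sqrt_pos.2 (div_pos hr0 hσ)
    have hρ3 : (√(r / σ) ^ 3) ^ (1 / 3 : ℝ) = √(r / σ) := by
      rw [← Real.rpow_natCast, ← Real.rpow_mul hρ0.le]; norm_num
    have hρ2 : √(r / σ) ^ 2 = r / σ := Real.sq_sqrt (div_pos hr0 hσ).le
    -- The cube root `ρ` of the arrival time must satisfy `σρ² = r`, and the mark is then `v /
    -- (βρ)`.
    refine ⟨(√(r / σ) ^ 3, v / (β * √(r / σ))), ⟨?_, ?_, ?_⟩, ?_⟩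
    · exact pow_pos hρ0 3
    · positivity
    · rw [div_lt_one (by positivity)]
      refine lt_of_pow_lt_pow_left₀ 2 (by positivity) ?_
      rw [mul_pow, hρ2, h]
      have : κ * σ * (r / σ) = κ * r := by field_simp
      rw [this]; exact huv
    · simp only [arrivalMap, hρ3, hρ2]
      have e1 : v / (β * √(r / σ)) * (β * √(r / σ)) = v := by field_simp
      have e2 : σ * (r / σ) = r := by field_simp
      rw [e1, e2, hr]
      simp

theorem volume_preimage_arrivalMap {a σ β κ : ℝ} (ha : 0 < a) (hσ : 0 < σ) (hβ : 0 < β)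
    (hκ : 0 < κ) (h : β ^ 2 = κ * σ) {C : Set (ℝ × ℝ)} (hC : MeasurableSet C) :
    volume.real (arrivalMap a σ β ⁻¹' C ∩ Ioi 0 ×ˢ Icc 0 1) =
      (2 / 3 * σ * β)⁻¹ * volume.real (C ∩ arrivalRegion a κ) := by
  set D : Set (ℝ × ℝ) := Ioi 0 ×ˢ Ioo 0 1
  have hbij := bijOn_arrivalMap (a := a) hσ hβ hκ h
  have hDm : MeasurableSet D := measurableSet_Ioi.prod measurableSet_Ioo
  have hBm : MeasurableSet (arrivalMap a σ β ⁻¹' C ∩ D) :=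
    (measurable_arrivalMap a σ β hC).inter hDm
  have himg : arrivalMap a σ β '' (arrivalMap a σ β ⁻¹' C ∩ D) = C ∩ arrivalRegion a κ := by
    rw [image_preimage_inter, hbij.image_eq]
  choose! L hL hdet using fun (p : ℝ × ℝ) (hp : p ∈ D) =>
    hasFDerivAt_arrivalMap (σ := σ) (β := β) ha (p := p) hp.1
  have hvol := lintegral_abs_det_fderiv_eq_addHaar_image volume hBm
    (fun p hp => (hL p hp.2).hasFDerivWithinAt) (hbij.injOn.mono inter_subset_right)
  rw [himg, setLIntegral_congr_fun (g := fun _ => ENNReal.ofReal (2 / 3 * σ * β)) hBm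
    (fun p hp => by rw [hdet p hp.2, abs_of_pos (by positivity)]), setLIntegral_const] at hvol
  have hae : (arrivalMap a σ β ⁻¹' C ∩ Ioi 0 ×ˢ Icc 0 1 : Set (ℝ × ℝ)) =ᵐ[volume]
      (arrivalMap a σ β ⁻¹' C ∩ D : Set (ℝ × ℝ)) :=
    (ae_eq_refl _).inter (Measure.set_prod_ae_eq (ae_eq_refl _) Ioo_ae_eq_Icc.symm)
  rw [measureReal_congr hae, measureReal_def, measureReal_def, ← hvol, ENNReal.toReal_mul,
    ENNReal.toReal_ofReal (by positivity)]
  field_simp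

/-! ### Parabolic blow-up of a density at a pole -/

theorem volume_graph_eq_zero {g : ℝ → ℝ} (hg : Measurable g) :
    volume {z : ℝ × ℝ | z.2 = g z.1} = 0 := by
  have hm : MeasurableSet {z : ℝ × ℝ | z.2 = g z.1} :=
    measurableSet_eq_fun measurable_snd (hg.comp measurable_fst)
  rw [Measure.volume_eq_prod, Measure.measure_prod_null hm]
  refine Eventually.of_forall fun x => ?_
  have : Prod.mk x ⁻¹' {z : ℝ × ℝ | z.2 = g z.1} = {g x} := by
    ext y; simp
  simp [this]

theorem volume_vertical_eq_zero (b : ℝ) : volume {z : ℝ × ℝ | z.1 = b} = 0 := by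
  have : {z : ℝ × ℝ | z.1 = b} = {b} ×ˢ univ := by ext; simp
  rw [this, Measure.volume_eq_prod, Measure.prod_prod]
  simp

/-- The limiting region in the rescaled coordinates. -/
def parabolaRegion (a q : ℝ) : Set (ℝ × ℝ) :=
  {x | 0 < x.1 ∧ 0 < x.2 ∧ x.2 < q * (√(2 * a * x.1) / 2)}

/-- The inverse of the parabolic rescaling at the pole `(a, 0)`. -/
noncomputable def unscale (a k : ℝ) (x : ℝ × ℝ) : ℝ × ℝ := (a - x.1 / k ^ 2, x.2 / k)

/-- The substitution `z = unscale a k x` has Jacobian `k⁻³`; this moves all dependence on `k` from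
the domain of integration into the integrand. -/
theorem pow_mul_setIntegral_eq (F : ℝ × ℝ → ℝ) (a : ℝ) {k : ℝ} (hk : 0 < k)
    {A C : Set (ℝ × ℝ)} (hA : MeasurableSet A) (hC : MeasurableSet C) :
    k ^ 3 * ∫ z in A ∩ {z | (k ^ 2 * (a - z.1), k * z.2) ∈ C}, F z =
      ∫ x in C, A.indicator F (unscale a k x) := by
  have hmu : Measurable (unscale a k) := by unfold unscale; fun_prop
  have himg : unscale a k '' (C ∩ unscale a k ⁻¹' A) =
      A ∩ {z | (k ^ 2 * (a - z.1), k * z.2) ∈ C} := by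
    ext z
    constructor
    · rintro ⟨x, ⟨hxC, hxA⟩, rfl⟩
      refine ⟨hxA, ?_⟩
      simp only [unscale, mem_ofPred_eq]
      convert! hxC using 1
      ext <;> field_simp <;> simp
    · rintro ⟨hzA, hzC⟩
      refine ⟨_, ⟨hzC, ?_⟩, ?_⟩
      · simp only [mem_preimage, unscale]
        convert! hzA using 1
        ext <;> field_simp <;> simp
      · simp only [unscale]
        ext <;> field_simp <;> simp
  have hinj : Function.Injective (unscale a k) := by
    intro x y h
    simp only [unscale, Prod.mk.injEq] at h
    obtain ⟨h1, h2⟩ := h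
    have e1 : x.1 = y.1 := by
      have : x.1 / k ^ 2 = y.1 / k ^ 2 := by linarith
      field_simp at this; exact this
    have e2 : x.2 = y.2 := by field_simp at h2; exact h2
    exact Prod.ext e1 e2
  have hd : ∀ x, HasFDerivAt (unscale a k)
      (((-(1 / k ^ 2)) • ContinuousLinearMap.fst ℝ ℝ ℝ + (0 : ℝ) • ContinuousLinearMap.snd ℝ ℝ ℝ).prod
      ((0 : ℝ) • ContinuousLinearMap.fst ℝ ℝ ℝ + (1 / k) • ContinuousLinearMap.snd ℝ ℝ ℝ)) x := by
    intro x
    refine HasFDerivAt.prodMk ?_ ?_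
    · refine (((hasFDerivAt_fst (p := x)).mul_const (k ^ 2)⁻¹).const_sub a).congr_fderiv ?_
      ext <;> simp
    · refine ((hasFDerivAt_snd (p := x)).mul_const k⁻¹).congr_fderiv ?_
      ext <;> simp
  rw [← himg, integral_image_eq_integral_abs_det_fderiv_smul volume (hC.inter (hmu hA))
    (fun x _ => (hd x).hasFDerivWithinAt) hinj.injOn, det_prod_smul_fst_snd]
  have hdet : |-(1 / k ^ 2) * (1 / k) - 0 * 0| = (k ^ 3)⁻¹ := by
    rw [show -(1 / k ^ 2) * (1 / k) - 0 * 0 = -(k ^ 3)⁻¹ by field_simp; simp, abs_neg,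
      abs_of_pos (by positivity)]
  simp only [hdet, smul_eq_mul]
  rw [integral_const_mul, mul_inv_cancel_left₀ (by positivity),
    ← setIntegral_indicator (hmu hA)]
  rfl

/-- For the ellipse itself, `k * ellipseFun a (a - u / k²) = √(2au - u² / k²) / 2`, so vertical
scale `k` matches horizontal scale `k²`. -/
theorem tendsto_mul_boundary {a q : ℝ} (ha : 0 < a) {G : ℝ → ℝ}
    (hG : Tendsto (fun x => G x / ellipseFun a x) (𝓝[<] a) (𝓝 q)) {u : ℝ} (hu : 0 < u) :
    Tendsto (fun k : ℝ => k * G (a - u / k ^ 2)) atTop (𝓝 (q * (√(2 * a * u) / 2))) := by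
  have h0 : Tendsto (fun k : ℝ => u / k ^ 2) atTop (𝓝 0) :=
    tendsto_const_nhds.div_atTop (tendsto_pow_atTop two_ne_zero)
  have h1 : Tendsto (fun k : ℝ => a - u / k ^ 2) atTop (𝓝[<] a) := by
    refine tendsto_nhdsWithin_iff.2 ⟨by simpa using tendsto_const_nhds.sub h0, ?_⟩
    filter_upwards [eventually_gt_atTop 0] with k hk
    have : 0 < u / k ^ 2 := by positivity
    simpa using this
  have h2 : Tendsto (fun k : ℝ => √(2 * a * u - u * (u / k ^ 2)) / 2) atTop
      (𝓝 (√(2 * a * u) / 2)) := by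
    have : Tendsto (fun k : ℝ => 2 * a * u - u * (u / k ^ 2)) atTop (𝓝 (2 * a * u - u * 0)) :=
      tendsto_const_nhds.sub (h0.const_mul u)
    rw [mul_zero, sub_zero] at this
    exact this.sqrt.div_const 2
  refine ((hG.comp h1).mul h2).congr' ?_
  have h3 : ∀ᶠ k : ℝ in atTop, u / k ^ 2 < 2 * a := h0.eventually_lt_const (by positivity)
  filter_upwards [eventually_gt_atTop 0, h3] with k hk hk3
  have hpos : 0 < u / k ^ 2 := by positivity
  have e1 : √(2 * a * u - u * (u / k ^ 2)) = k * √(a ^ 2 - (a - u / k ^ 2) ^ 2) := by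
    rw [← Real.sqrt_sq hk.le, ← Real.sqrt_mul (by positivity), Real.sqrt_sq hk.le]
    congr 1
    field_simp
    ring
  have e2 : 0 < √(a ^ 2 - (a - u / k ^ 2) ^ 2) := by
    apply Real.sqrt_pos.2
    nlinarith
  simp only [Function.comp, ellipseFun]
  rw [e1]
  generalize √(a ^ 2 - (a - u / k ^ 2) ^ 2) = e at e2
  generalize G (a - u / k ^ 2) = y
  field_simp

/-- The mass of a parabolically rescaled set near a pole, within one quadrant. -/
theorem tendsto_scaled_integral {a q p : ℝ} (ha : 0 < a) {F : ℝ × ℝ → ℝ} (hF : Measurable F)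
    (hF0 : ∀ z, 0 ≤ F z) {G : ℝ → ℝ}
    (hG : Tendsto (fun x => G x / ellipseFun a x) (𝓝[<] a) (𝓝 q))
    (hsupp : ∀ᶠ z : ℝ × ℝ in 𝓝 (a, 0), 0 < z.2 → F z ≠ 0 → z.1 < a ∧ z.2 < G z.1)
    (hlim : Tendsto F (𝓝[{z | z.1 < a ∧ 0 < z.2 ∧ z.2 < G z.1}] (a, 0)) (𝓝 p))
    {C : Set (ℝ × ℝ)} (hC : MeasurableSet C) (hCb : Bornology.IsBounded C) :
    Tendsto (fun k : ℝ => k ^ 3 * ∫ z in {z : ℝ × ℝ | 0 < z.1 ∧ 0 < z.2} ∩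
      {z | (k ^ 2 * (a - z.1), k * z.2) ∈ C}, F z) atTop
      (𝓝 (p * volume.real (C ∩ parabolaRegion a q))) := by
  set A : Set (ℝ × ℝ) := {z : ℝ × ℝ | 0 < z.1 ∧ 0 < z.2} with hAdef
  have hA : MeasurableSet A :=
    (measurableSet_lt measurable_const measurable_fst).inter
      (measurableSet_lt measurable_const measurable_snd)
  have hRm : MeasurableSet (parabolaRegion a q) :=
    (measurableSet_lt measurable_const measurable_fst).inter
      ((measurableSet_lt measurable_const measurable_snd).inter
        (measurableSet_lt measurable_snd (by fun_prop)))
  have hfin : volume C ≠ ∞ := hCb.measure_lt_top.ne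
  have : IsFiniteMeasure (volume.restrict C) := ⟨by simpa using hfin.lt_top⟩
  have hrhs : p * volume.real (C ∩ parabolaRegion a q) =
      ∫ x in C, (parabolaRegion a q).indicator (fun _ => p) x := by
    rw [integral_indicator hRm, setIntegral_const, measureReal_restrict_apply hRm, inter_comm,
      smul_eq_mul, mul_comm]
  rw [hrhs]
  have hcongr : (fun k : ℝ => ∫ x in C, A.indicator F (unscale a k x)) =ᶠ[atTop]
      fun k : ℝ => k ^ 3 * ∫ z in A ∩ {z | (k ^ 2 * (a - z.1), k * z.2) ∈ C}, F z := by
    filter_upwards [eventually_gt_atTop 0] with k hk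
    rw [pow_mul_setIntegral_eq F a hk hA hC]
  refine Tendsto.congr' hcongr ?_
  have hk2 : ∀ c : ℝ, Tendsto (fun k : ℝ => c / k ^ 2) atTop (𝓝 0) := fun c =>
    tendsto_const_nhds.div_atTop (tendsto_pow_atTop two_ne_zero)
  have hk1 : ∀ c : ℝ, Tendsto (fun k : ℝ => c / k) atTop (𝓝 0) := fun c =>
    tendsto_const_nhds.div_atTop tendsto_id
  have hlim' : ∀ᶠ z in 𝓝 ((a, 0) : ℝ × ℝ), z ∈ {z : ℝ × ℝ | z.1 < a ∧ 0 < z.2 ∧ z.2 < G z.1} →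
      F z < p + 1 := by
    have := hlim.eventually_lt_const (show p < p + 1 by linarith)
    exact eventually_nhdsWithin_iff.1 this
  obtain ⟨M, hM⟩ := hCb.exists_norm_le
  -- Since `C` is bounded, its unscaled points are eventually all close to the pole. There the
  -- integrand is either zero or, by `hlim`, below `p + 1`, so a constant dominates.
  refine tendsto_integral_filter_of_dominated_convergence (fun _ => |p + 1|) ?_ ?_ ?_ ?_
  · refine Eventually.of_forall fun k => ?_
    have hmu : Measurable (unscale a k) := by unfold unscale; fun_prop
    exact ((hF.indicator hA).comp hmu).aestronglyMeasurable
  · obtain ⟨δ, hδ, hδ'⟩ := Metric.eventually_nhds_iff.1 (hsupp.and hlim')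
    filter_upwards [eventually_gt_atTop 0, (hk2 M).eventually_lt_const hδ,
      (hk1 M).eventually_lt_const hδ] with k hk h1 h2
    refine (ae_restrict_iff' hC).2 (Eventually.of_forall fun x hx => ?_)
    have hxM := hM x hx
    rw [Prod.norm_def, sup_le_iff] at hxM
    have hnear : dist (unscale a k x) (a, 0) < δ := by
      rw [Prod.dist_eq, max_lt_iff]
      simp only [unscale, Real.dist_eq, sub_zero, sub_sub_cancel_left, abs_neg, abs_div]
      rw [abs_of_pos hk, abs_of_pos (pow_pos hk 2)]
      exact ⟨lt_of_le_of_lt (by gcongr; exact hxM.1) h1, lt_of_le_of_lt (by gcongr; exact hxM.2) h2⟩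
    obtain ⟨hs, hl⟩ := hδ' hnear
    by_cases hxA : unscale a k x ∈ A
    · rw [indicator_of_mem hxA, Real.norm_of_nonneg (hF0 _)]
      by_cases h0 : F (unscale a k x) = 0
      · rw [h0]; exact abs_nonneg _
      · obtain ⟨h3, h4⟩ := hs hxA.2 h0
        exact (hl ⟨h3, hxA.2, h4⟩).le.trans (le_abs_self _)
    · rw [indicator_of_notMem hxA, norm_zero]; exact abs_nonneg _
  · exact integrable_const _
  -- Off the two axes and the bounding parabola, an unscaled point is eventually strictly inside or
  -- strictly outside the region below `G`, so the pointwise limit is `p` or `0`.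
  · have n1 : ∀ᵐ x : ℝ × ℝ, x.1 ≠ 0 := by rw [ae_iff]; simpa using volume_vertical_eq_zero 0
    have n2 : ∀ᵐ x : ℝ × ℝ, x.2 ≠ 0 := by
      rw [ae_iff]; simpa using volume_graph_eq_zero (g := fun _ => 0) measurable_const
    have n3 : ∀ᵐ x : ℝ × ℝ, x.2 ≠ q * (√(2 * a * x.1) / 2) := by
      rw [ae_iff]
      simpa using volume_graph_eq_zero (g := fun x => q * (√(2 * a * x) / 2)) (by fun_prop)
    refine ae_restrict_of_ae ?_
    filter_upwards [n1, n2, n3] with x hx1 hx2 hx3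
    have hto : Tendsto (fun k => unscale a k x) atTop (𝓝 (a, 0)) := by
      refine Tendsto.prodMk_nhds ?_ (hk1 _)
      simpa using tendsto_const_nhds.sub (hk2 x.1)
    have hpos : ∀ᶠ k : ℝ in atTop, 0 < (unscale a k x).1 :=
      (continuous_fst.tendsto _).comp hto |>.eventually_const_lt ha
    have hzero : (∀ᶠ k : ℝ in atTop, unscale a k x ∈ A → F (unscale a k x) = 0) →
        Tendsto (fun k => A.indicator F (unscale a k x)) atTop (𝓝 0) := by
      intro h
      refine tendsto_const_nhds.congr' ?_
      filter_upwards [h] with k hk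
      by_cases hA' : unscale a k x ∈ A
      · rw [indicator_of_mem hA', hk hA']
      · rw [indicator_of_notMem hA']
    rcases lt_or_gt_of_ne hx2 with hx2 | hx2
    · rw [indicator_of_notMem (fun h => (h.2.1.trans hx2).false)]
      refine hzero ?_
      filter_upwards [eventually_gt_atTop 0] with k hk hA'
      have : x.2 / k < 0 := div_neg_of_neg_of_pos hx2 hk
      exact absurd hA'.2 (not_lt.2 this.le)
    rcases lt_or_gt_of_ne hx1 with hx1 | hx1
    · rw [indicator_of_notMem (fun h => (h.1.trans hx1).false)]
      refine hzero ?_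
      filter_upwards [eventually_gt_atTop 0, hto.eventually hsupp] with k hk hs hA'
      by_contra h0
      have h1 := (hs hA'.2 h0).1
      have : x.1 / k ^ 2 < 0 := div_neg_of_neg_of_pos hx1 (by positivity)
      simp only [unscale] at h1
      linarith
    have hGk := tendsto_mul_boundary ha hG hx1
    rcases lt_or_gt_of_ne hx3 with hx3 | hx3
    · rw [indicator_of_mem (show x ∈ parabolaRegion a q from ⟨hx1, hx2, hx3⟩)]
      have hmem : ∀ᶠ k : ℝ in atTop,
          unscale a k x ∈ {z : ℝ × ℝ | z.1 < a ∧ 0 < z.2 ∧ z.2 < G z.1} := by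
        filter_upwards [eventually_gt_atTop 0, hGk.eventually_const_lt hx3] with k hk h1
        have : 0 < x.1 / k ^ 2 := by positivity
        refine ⟨by simpa [unscale] using this, div_pos hx2 hk, ?_⟩
        simp only [unscale]
        rw [div_lt_iff₀ hk, mul_comm]
        exact h1
      have := hlim.comp (tendsto_nhdsWithin_iff.2 ⟨hto, hmem⟩)
      refine this.congr' ?_
      filter_upwards [hmem, hpos] with k hk hk'
      rw [indicator_of_mem (show unscale a k x ∈ A from ⟨hk', hk.2.1⟩)]
      rfl
    · rw [indicator_of_notMem (fun h => (h.2.2.trans hx3).false)]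
      refine hzero ?_
      filter_upwards [eventually_gt_atTop 0, hto.eventually hsupp, hGk.eventually_lt_const hx3]
        with k hk hs h1 hA'
      by_contra h0
      have h2 := (hs hA'.2 h0).2
      simp only [unscale] at h2
      rw [div_lt_iff₀ hk, mul_comm] at h2
      exact (h1.trans h2).false

/-! ### Boundary profiles and the circle of radius `a` -/

/-- The properties shared by the four boundary functions after reflection into the first
quadrant. -/
structure IsProfile (a ν q : ℝ) (G : ℝ → ℝ) : Prop where
  pos : 0 < a
  nu_nonneg : 0 ≤ ν
  nu_lt : ν < a
  q_mem : q ∈ Ioo (0 : ℝ) 2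
  continuousOn : ContinuousOn G (Icc ν a)
  nonneg : ∀ x ∈ Icc ν a, 0 ≤ G x
  end_zero : G a = 0
  decay : Tendsto (fun x => G x / ellipseFun a x) (𝓝[<] a) (𝓝 q)
  crossing : ∀ᶠ h in 𝓝[>] (0 : ℝ), ∃! x, x ∈ Icc ν a ∧ x ^ 2 + G x ^ 2 = (a - h) ^ 2

namespace IsProfile

variable {a ν q : ℝ} {G : ℝ → ℝ}

/-- Choosing `q'` between `q` and `2` gives `G² ≤ (q'² / 4)(a² - x²)` near the pole. Thus `q < 2`
leaves a definite gap between the graph and the circle. -/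
theorem eventually_sq_le (hG : IsProfile a ν q G) :
    ∃ κ ∈ Ioo (0 : ℝ) 1, ∃ x₀ ∈ Ico ν a, ∀ x ∈ Ioo x₀ a, G x ^ 2 ≤ (1 - κ) * (a ^ 2 - x ^ 2) := by
  obtain ⟨q', hq', hq'2⟩ := exists_between hG.q_mem.2
  have hq0 : 0 < q' := hG.q_mem.1.trans hq'
  have h1 := hG.decay.eventually_lt_const hq'
  have h2 : ∀ᶠ x in 𝓝[<] a, x ∈ Ioo ν a := Ioo_mem_nhdsLT hG.nu_lt
  obtain ⟨x₀, hx₀, hx₀'⟩ := (mem_nhdsLT_iff_exists_Ioo_subset' hG.nu_lt).1 (h1.and h2)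
  refine ⟨1 - q' ^ 2 / 4, ⟨by nlinarith, by nlinarith⟩, max x₀ ν, ⟨le_max_right _ _,
    max_lt hx₀ hG.nu_lt⟩, fun x hx => ?_⟩
  obtain ⟨h3, h4⟩ := hx₀' ⟨lt_of_le_of_lt (le_max_left _ _) hx.1, hx.2⟩
  have hxa : 0 < a ^ 2 - x ^ 2 := by nlinarith [h4.1, h4.2, hG.nu_nonneg]
  have hs := Real.sqrt_pos.2 hxa
  have hf : 0 < ellipseFun a x := by unfold ellipseFun; positivity
  rw [div_lt_iff₀ hf] at h3
  have h0 := hG.nonneg x ⟨h4.1.le, h4.2.le⟩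
  calc G x ^ 2 ≤ (q' * ellipseFun a x) ^ 2 := by gcongr
    _ = _ := by
      rw [ellipseFun, mul_pow, div_pow, Real.sq_sqrt hxa.le]; ring

/-- The graph of a profile stays inside the open disc of radius `a`. -/
theorem sq_add_sq_lt (hG : IsProfile a ν q G) {x : ℝ} (hx : x ∈ Ico ν a) :
    x ^ 2 + G x ^ 2 < a ^ 2 := by
  obtain ⟨κ, hκ, x₀, hx₀, hle⟩ := hG.eventually_sq_le
  have hnear : ∀ y ∈ Ioo x₀ a, y ^ 2 + G y ^ 2 < a ^ 2 := fun y hy => by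
    have h1 := hle y hy
    have h2 : 0 < a ^ 2 - y ^ 2 := by nlinarith [hy.1, hy.2, hx₀.1, hG.nu_nonneg]
    nlinarith [hκ.1]
  by_contra hcon
  rw [not_lt] at hcon
  have hxx₀ : x ≤ x₀ := by
    by_contra h
    exact absurd (hnear x ⟨not_le.1 h, hx.2⟩) (not_lt.2 hcon)
  -- At `w` the graph is strictly inside the circle, while at `a` and, by assumption, at `x` the
  -- radius is at least `a`. For small `h` the intermediate value theorem gives a crossing of radius
  -- `a - h` on each side of `w`, contradicting uniqueness.
  set w := (x₀ + a) / 2 with hw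
  have hwm : w ∈ Ioo x₀ a := ⟨by linarith [hx₀.2], by linarith [hx₀.2]⟩
  have hwlt := hnear w hwm
  have hcont : ContinuousOn (fun y => y ^ 2 + G y ^ 2) (Icc ν a) :=
    (continuousOn_pow 2).add (hG.continuousOn.pow 2)
  have hev : ∀ᶠ h in 𝓝[>] (0 : ℝ), w ^ 2 + G w ^ 2 < (a - h) ^ 2 ∧ (a - h) ^ 2 < a ^ 2 := by
    have ht : Tendsto (fun h : ℝ => (a - h) ^ 2) (𝓝[>] 0) (𝓝 (a ^ 2)) := by
      have : Tendsto (fun h : ℝ => (a - h) ^ 2) (𝓝 0) (𝓝 ((a - 0) ^ 2)) :=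
        Continuous.tendsto (by fun_prop) 0
      rw [sub_zero] at this
      exact this.mono_left nhdsWithin_le_nhds
    filter_upwards [ht.eventually_const_lt hwlt, Ioo_mem_nhdsGT hG.pos] with h h1 h2
    exact ⟨h1, by nlinarith [h2.1, h2.2]⟩
  obtain ⟨h, ⟨h1, h2⟩, hcross⟩ := (hev.and hG.crossing).exists
  have hwI : w ∈ Icc ν a := ⟨by linarith [hx₀.1, hwm.1], hwm.2.le⟩
  obtain ⟨y₁, hy₁, hy₁'⟩ := intermediate_value_Icc hwm.2.le
    (hcont.mono (Icc_subset_Icc hwI.1 le_rfl)) (show (a - h) ^ 2 ∈ Icc _ _ from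
      ⟨h1.le, by simpa [hG.end_zero] using h2.le⟩)
  obtain ⟨y₂, hy₂, hy₂'⟩ := intermediate_value_Icc' (hxx₀.trans hwm.1.le)
    (hcont.mono (Icc_subset_Icc hx.1 hwm.2.le)) (show (a - h) ^ 2 ∈ Icc _ _ from
      ⟨h1.le, h2.le.trans hcon⟩)
  have heq := hcross.unique ⟨⟨hwI.1.trans hy₁.1, hy₁.2⟩, hy₁'⟩
    ⟨⟨hx.1.trans hy₂.1, hy₂.2.trans hwm.2.le⟩, hy₂'⟩
  have : y₁ = w := le_antisymm (heq ▸ hy₂.2) hy₁.1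
  rw [this] at hy₁'
  exact h1.ne hy₁'

end IsProfile

/-! ### Reduction of the four quadrants to one -/

/-- The sign of the first coordinate in each quadrant. -/
def hsign : Fin 4 → ℝ := ![1, -1, -1, 1]

/-- The sign of the second coordinate in each quadrant. -/
def vsign : Fin 4 → ℝ := ![1, 1, -1, -1]

theorem hsign_sq (i : Fin 4) : hsign i * hsign i = 1 := by fin_cases i <;> simp [hsign]

theorem vsign_sq (i : Fin 4) : vsign i * vsign i = 1 := by fin_cases i <;> simp [vsign]

theorem abs_hsign (i : Fin 4) : |hsign i| = 1 := by fin_cases i <;> simp [hsign]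

theorem abs_vsign (i : Fin 4) : |vsign i| = 1 := by fin_cases i <;> simp [vsign]

theorem mem_quadrant_iff (i : Fin 4) (z : Plane) :
    z ∈ quadrant i ↔ 0 < hsign i * z 0 ∧ 0 < vsign i * z 1 := by
  fin_cases i <;> simp [quadrant, hsign, vsign]

theorem exists_mem_quadrant {z : Plane} (h0 : z 0 ≠ 0) (h1 : z 1 ≠ 0) : ∃ i, z ∈ quadrant i := by
  rcases lt_or_gt_of_ne h0 with h0 | h0 <;> rcases lt_or_gt_of_ne h1 with h1 | h1
  exacts [⟨2, h0, h1⟩, ⟨1, h0, h1⟩, ⟨3, h0, h1⟩, ⟨0, h0, h1⟩]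

theorem abs_of_mem_quadrant {i : Fin 4} {z : Plane} (hz : z ∈ quadrant i) :
    |z 0| = hsign i * z 0 ∧ |z 1| = vsign i * z 1 := by
  rw [mem_quadrant_iff] at hz
  constructor
  · rw [← abs_of_pos hz.1, abs_mul, abs_hsign, one_mul]
  · rw [← abs_of_pos hz.2, abs_mul, abs_vsign, one_mul]

/-- The boundary function of a quadrant, reflected into the first quadrant. -/
def profile (g : Fin 4 → ℝ → ℝ) (i : Fin 4) (x : ℝ) : ℝ := vsign i * g i (hsign i * x)

theorem norm_sq_plane (z : Plane) : ‖z‖ ^ 2 = z 0 ^ 2 + z 1 ^ 2 := by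
  rw [EuclideanSpace.norm_sq_eq]; simp [Fin.sum_univ_two]

theorem isOpen_quadrant (i : Fin 4) : IsOpen (quadrant i) := by
  have : quadrant i = {z : Plane | 0 < hsign i * z 0} ∩ {z | 0 < vsign i * z 1} := by
    ext z; exact mem_quadrant_iff i z
  rw [this]
  exact (isOpen_lt continuous_const (by fun_prop)).inter (isOpen_lt continuous_const (by fun_prop))

namespace IsAdmissibleSet

variable {E : Set Plane} {a ν : ℝ} {g : Fin 4 → ℝ → ℝ} {q : Fin 4 → ℝ}

theorem mem_boundaryDomain (i : Fin 4) (x : ℝ) :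
    hsign i * x ∈ boundaryDomain a ν i ↔ x ∈ Icc ν a := by
  fin_cases i <;> simp [boundaryDomain, hsign, and_comm]

theorem isProfile (hE : IsAdmissibleSet E a ν g q) (i : Fin 4) :
    IsProfile a ν (q i) (profile g i) where
  pos := hE.pos
  nu_nonneg := hE.nu_nonneg
  nu_lt := hE.nu_lt
  q_mem := hE.q_mem i
  continuousOn := by
    refine continuousOn_const.mul ((hE.continuousOn i).comp (by fun_prop) ?_)
    exact fun x hx => (mem_boundaryDomain i x).2 hx
  nonneg := by
    intro x hx
    have hx' := (mem_boundaryDomain i x).2 hx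
    fin_cases i
    · simpa [profile, vsign, hsign] using hE.upper_nonneg 0 (by simp) _ hx'
    · simpa [profile, vsign, hsign] using hE.upper_nonneg 1 (by simp) _ hx'
    · simpa [profile, vsign, hsign] using hE.lower_nonpos 2 (by simp) _ hx'
    · simpa [profile, vsign, hsign] using hE.lower_nonpos 3 (by simp) _ hx'
  end_zero := by
    fin_cases i
    · simpa [profile, vsign, hsign] using hE.right_eq_zero.1
    · simpa [profile, vsign, hsign] using hE.left_eq_zero.1
    · simpa [profile, vsign, hsign] using hE.left_eq_zero.2
    · simpa [profile, vsign, hsign] using hE.right_eq_zero.2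
  decay := by
    have hneg : Tendsto (fun x : ℝ => -x) (𝓝[<] a) (𝓝[>] (-a)) := tendsto_neg_nhdsLT
    have heven : ∀ x, ellipseFun a (-x) = ellipseFun a x := fun x => by simp [ellipseFun]
    fin_cases i
    · simpa [profile, vsign, hsign] using hE.decay_one
    · simpa [profile, vsign, hsign, Function.comp_def, heven] using hE.decay_two.comp hneg
    · simpa [profile, vsign, hsign, Function.comp_def, heven] using hE.decay_three.comp hneg
    · simpa [profile, vsign, hsign] using hE.decay_four
  crossing := by
    filter_upwards [hE.unique_crossing i, Ioo_mem_nhdsGT hE.pos] with h hh hpos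
    -- The reflection preserves norms and is its own inverse, so the unique crossing carries over.
    have key : ∀ x, (x ∈ Icc ν a ∧ x ^ 2 + profile g i x ^ 2 = (a - h) ^ 2) ↔
        (hsign i * x ∈ boundaryDomain a ν i ∧
          (!₂[hsign i * x, g i (hsign i * x)] : Plane) ∈ Metric.sphere 0 (a - h)) := by
      intro x
      rw [mem_boundaryDomain, mem_sphere_zero_iff_norm,
        ← pow_left_inj₀ (norm_nonneg _) (by linarith [hpos.2] : 0 ≤ a - h) two_ne_zero,
        norm_sq_plane]
      simp only [profile, mul_pow, Matrix.cons_val_zero, Matrix.cons_val_one]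
      rw [pow_two (hsign i), hsign_sq, pow_two (vsign i), vsign_sq, one_mul, one_mul]
    obtain ⟨y, hy, hyu⟩ := hh
    have hyy : hsign i * (hsign i * y) = y := by rw [← mul_assoc, hsign_sq, one_mul]
    refine ⟨hsign i * y, (key _).2 (by rwa [hyy]), fun x hx => ?_⟩
    have := hyu _ ((key x).1 hx)
    rw [← this, ← mul_assoc, hsign_sq, one_mul]

/-- Near the poles, the interior of `E` lies strictly below the graphs of the profiles. -/
theorem mem_interior_iff (hE : IsAdmissibleSet E a ν g q) {i : Fin 4} {z : Plane}
    (hz : z ∈ quadrant i) (hν : ν < |z 0|) :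
    z ∈ interior E ↔ |z 0| < a ∧ |z 1| < profile g i |z 0| := by
  have hr : ∀ w : Plane, ν < w 0 → (w ∈ interior E ↔ w 0 < a ∧ g 3 (w 0) < w 1 ∧ w 1 < g 0 (w 0)) :=
    fun w hw => by
      have := Set.ext_iff.1 hE.interior_right w
      simpa [hw] using this
  have hl : ∀ w : Plane, w 0 < -ν → (w ∈ interior E ↔
      -a < w 0 ∧ g 2 (w 0) < w 1 ∧ w 1 < g 1 (w 0)) :=
    fun w hw => by
      have := Set.ext_iff.1 hE.interior_left w
      simpa [hw] using this
  have hup : ∀ i ∈ ({0, 1} : Set (Fin 4)), ∀ x ∈ boundaryDomain a ν i, 0 ≤ g i x := hE.upper_nonneg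
  have hlo := hE.lower_nonpos
  fin_cases i
  · obtain ⟨h0, h1⟩ : 0 < z 0 ∧ 0 < z 1 := hz
    rw [abs_of_pos h0] at hν
    rw [hr z hν, abs_of_pos h0, abs_of_pos h1]
    simp only [profile, vsign, hsign, Fin.zero_eta, Matrix.cons_val_zero, one_mul]
    -- Only the boundary function of the point's own quadrant matters: the other one has the
    -- opposite sign, so its inequality is automatic. The remaining three quadrants use the same
    -- observation.
    refine ⟨fun h => ⟨h.1, h.2.2⟩, fun h => ⟨h.1, ?_, h.2⟩⟩
    have : g 3 (z 0) ≤ 0 := hlo 3 (by simp) _ ⟨hν.le, h.1.le⟩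
    linarith
  · obtain ⟨h0, h1⟩ : z 0 < 0 ∧ 0 < z 1 := hz
    rw [abs_of_neg h0] at hν
    rw [hl z (by linarith), abs_of_neg h0, abs_of_pos h1]
    simp only [profile, vsign, hsign, Fin.mk_one, Matrix.cons_val_one, Matrix.cons_val_zero,
      one_mul, neg_mul, neg_neg]
    refine ⟨fun h => ⟨by linarith [h.1], h.2.2⟩, fun h => ⟨by linarith [h.1], ?_, h.2⟩⟩
    have : g 2 (z 0) ≤ 0 := hlo 2 (by simp) _ ⟨by linarith [h.1], by linarith⟩
    linarith
  · obtain ⟨h0, h1⟩ : z 0 < 0 ∧ z 1 < 0 := hz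
    rw [abs_of_neg h0] at hν
    rw [hl z (by linarith), abs_of_neg h0, abs_of_neg h1]
    simp only [profile, vsign, hsign, Fin.reduceFinMk, Matrix.cons_val, one_mul, neg_mul, neg_neg,
      neg_lt_neg_iff]
    refine ⟨fun h => ⟨by linarith [h.1], h.2.1⟩, fun h => ⟨by linarith [h.1], h.2, ?_⟩⟩
    have : 0 ≤ g 1 (z 0) := hup 1 (by simp) _ ⟨by linarith [h.1], by linarith⟩
    linarith
  · obtain ⟨h0, h1⟩ : 0 < z 0 ∧ z 1 < 0 := hz
    rw [abs_of_pos h0] at hν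
    rw [hr z hν, abs_of_pos h0, abs_of_neg h1]
    simp only [profile, vsign, hsign, Fin.reduceFinMk, Matrix.cons_val, one_mul, neg_mul,
      neg_lt_neg_iff]
    refine ⟨fun h => ⟨h.1, h.2.1⟩, fun h => ⟨h.1, h.2, ?_⟩⟩
    have : 0 ≤ g 0 (z 0) := hup 0 (by simp) _ ⟨hν.le, h.1.le⟩
    linarith

end IsAdmissibleSet

/-! ### Planar coordinates and null sets -/

/-- Reflection of the coordinate plane into the quadrant with the given index. -/
noncomputable def reflect (i : Fin 4) : ℝ × ℝ ≃ᵐ ℝ × ℝ :=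
  MeasurableEquiv.prodCongr
    (MeasurableEquiv.mulLeft₀ (hsign i) (left_ne_zero_of_mul_eq_one (hsign_sq i)))
    (MeasurableEquiv.mulLeft₀ (vsign i) (left_ne_zero_of_mul_eq_one (vsign_sq i)))

theorem reflect_apply (i : Fin 4) (x : ℝ × ℝ) : reflect i x = (hsign i * x.1, vsign i * x.2) := rfl

theorem measurePreserving_mul_of_abs_eq_one {c : ℝ} (hc : |c| = 1) :
    MeasurePreserving (fun x : ℝ => c * x) := by
  refine ⟨measurable_const_mul c, ?_⟩
  have h0 : c ≠ 0 := fun h => by simp [h] at hc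
  rw [Real.map_volume_mul_left h0, abs_inv, hc]
  simp

theorem measurePreserving_reflect (i : Fin 4) : MeasurePreserving (reflect i) :=
  (measurePreserving_mul_of_abs_eq_one (abs_hsign i)).prod
    (measurePreserving_mul_of_abs_eq_one (abs_vsign i))

/-- The identification of the product of two lines with the Euclidean plane. -/
noncomputable def planeEquiv : ℝ × ℝ ≃ᵐ Plane :=
  (MeasurableEquiv.finTwoArrow (α := ℝ)).symm.trans (MeasurableEquiv.toLp 2 (Fin 2 → ℝ))

theorem measurePreserving_planeEquiv : MeasurePreserving planeEquiv :=
  (PiLp.volume_preserving_toLp (Fin 2)).comp (volume_preserving_finTwoArrow ℝ).symm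

theorem continuous_planeEquiv : Continuous planeEquiv := by
  have : (planeEquiv : ℝ × ℝ → Plane) = fun x => !₂[x.1, x.2] := by
    ext x i; fin_cases i <;> rfl
  rw [this]
  fun_prop

theorem ae_plane_of_ae_prod {p : ℝ × ℝ → Prop} (h : ∀ᵐ x, p x) :
    ∀ᵐ z : Plane, p (z 0, z 1) :=
  measurePreserving_planeEquiv.symm.quasiMeasurePreserving.ae h

theorem ae_plane_fst_ne (b : ℝ) : ∀ᵐ z : Plane, z 0 ≠ b :=
  ae_plane_of_ae_prod (p := fun x => x.1 ≠ b)
    (by rw [ae_iff]; simpa using volume_vertical_eq_zero b)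

theorem ae_plane_snd_ne {φ : ℝ → ℝ} (hφ : Measurable φ) : ∀ᵐ z : Plane, z 1 ≠ φ (z 0) :=
  ae_plane_of_ae_prod (p := fun x => x.2 ≠ φ x.1)
    (by rw [ae_iff]; simpa using volume_graph_eq_zero hφ)

theorem measurable_plane_apply (i : Fin 2) : Measurable fun z : Plane => z i := by fun_prop

namespace IsProfile

variable {a ν q : ℝ} {G : ℝ → ℝ}

theorem continuous_IccExtend (hG : IsProfile a ν q G) :
    Continuous (IccExtend hG.nu_lt.le ((Icc ν a).domRestrict G)) :=
  (continuousOn_iff_continuous_domRestrict.1 hG.continuousOn).Icc_extend'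

theorem IccExtend_eq (hG : IsProfile a ν q G) {x : ℝ} (hx : x ∈ Icc ν a) :
    IccExtend hG.nu_lt.le ((Icc ν a).domRestrict G) x = G x := by
  rw [IccExtend_of_mem _ _ hx]; rfl

end IsProfile

/-! ### Where almost diametral points of `E` can lie -/

/-- The closed region under the boundary function in the quadrant `i`. -/
def subgraph (a ν : ℝ) (g : Fin 4 → ℝ → ℝ) (i : Fin 4) : Set Plane :=
  {z | hsign i * z 0 ∈ Icc ν a ∧ 0 ≤ vsign i * z 1 ∧
    vsign i * z 1 ≤ profile g i (hsign i * z 0)}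

/-- The points that the process can reach, outside a null set. -/
def goodSet (E : Set Plane) (ν : ℝ) : Set Plane :=
  {z | z ∈ closure (interior E) ∧ z 0 ≠ 0 ∧ z 1 ≠ 0 ∧ (ν < |z 0| → z ∈ interior E)}

theorem measurableSet_goodSet (E : Set Plane) (ν : ℝ) : MeasurableSet (goodSet E ν) := by
  have h0 := measurable_plane_apply 0
  have h1 := measurable_plane_apply 1
  refine isClosed_closure.measurableSet.inter (MeasurableSet.inter
    (h0 (measurableSet_singleton 0).compl) (MeasurableSet.inter
    (h1 (measurableSet_singleton 0).compl) ?_))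
  have : {z : Plane | ν < |z 0| → z ∈ interior E} = {z : Plane | ν < |z 0|}ᶜ ∪ interior E := by
    ext z; simp [imp_iff_not_or]
  change MeasurableSet {z : Plane | ν < |z 0| → z ∈ interior E}
  rw [this]
  exact (measurableSet_lt measurable_const (by fun_prop)).compl.union isOpen_interior.measurableSet

namespace IsAdmissibleSet

variable {E : Set Plane} {a ν : ℝ} {g : Fin 4 → ℝ → ℝ} {q : Fin 4 → ℝ}

theorem isClosed_subgraph (hE : IsAdmissibleSet E a ν g q) (i : Fin 4) :
    IsClosed (subgraph a ν g i) := by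
  have hG := hE.isProfile i
  have : subgraph a ν g i = {z | hsign i * z 0 ∈ Icc ν a} ∩ ({z | 0 ≤ vsign i * z 1} ∩
      {z | vsign i * z 1 ≤ IccExtend hG.nu_lt.le ((Icc ν a).domRestrict (profile g i))
        (hsign i * z 0)}) := by
    ext z
    simp only [subgraph, mem_inter_iff, mem_ofPred_eq]
    refine and_congr_right fun hz => ?_
    rw [hG.IccExtend_eq hz]
  rw [this]
  refine (isClosed_Icc.preimage (by fun_prop)).inter
    ((isClosed_le continuous_const (by fun_prop)).inter (isClosed_le (by fun_prop) ?_))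
  exact hG.continuous_IccExtend.comp (by fun_prop)

theorem closure_interior_subset (hE : IsAdmissibleSet E a ν g q) :
    ∃ h ∈ Ioo 0 a, closure (interior E) ⊆
      (Metric.closedBall 0 (a - h) ∩ {z | |z 0| ≤ ν}) ∪ ⋃ i, subgraph a ν g i := by
  obtain ⟨h, hdisc, hh⟩ := ((eventually_all.2 hE.inside_disc).and
    (Ioo_mem_nhdsGT hE.pos)).exists
  refine ⟨h, hh, ?_⟩
  -- The hypotheses say nothing about points on the axes or on the lines `x = ±ν`. Away from these
  -- the inclusion holds pointwise; the remaining interior points are limits of such points, and the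
  -- right-hand side is closed.
  have hdense : Dense {z : Plane | z 0 ≠ 0 ∧ z 1 ≠ 0 ∧ z 0 ≠ ν ∧ z 0 ≠ -ν} := by
    apply Measure.dense_of_ae (μ := (volume : Measure Plane))
    filter_upwards [ae_plane_fst_ne 0, ae_plane_snd_ne (φ := fun _ => 0) measurable_const,
      ae_plane_fst_ne ν, ae_plane_fst_ne (-ν)] with z h1 h2 h3 h4 using ⟨h1, h2, h3, h4⟩
  have hcl : IsClosed ((Metric.closedBall (0 : Plane) (a - h) ∩ {z | |z 0| ≤ ν}) ∪
      ⋃ i, subgraph a ν g i) := by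
    refine (Metric.isClosed_closedBall.inter (isClosed_le (by fun_prop) continuous_const)).union
      (isClosed_iUnion_of_finite hE.isClosed_subgraph)
  refine closure_minimal ((hdense.open_subset_closure_inter isOpen_interior).trans
    (closure_minimal ?_ hcl)) hcl
  rintro z ⟨hzE, h0, h1, h2, h3⟩
  obtain ⟨i, hi⟩ := exists_mem_quadrant h0 h1
  rcases lt_trichotomy |z 0| ν with hlt | heq | hgt
  · left
    refine ⟨hdisc i ⟨?_, hlt⟩, hlt.le⟩
    rw [interior_inter, (isOpen_quadrant i).interior_eq]
    exact ⟨hzE, hi⟩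
  · rcases abs_choice (z 0) with h | h <;> rw [h] at heq
    · exact absurd heq h2
    · exact absurd (by linarith) h3
  · right
    obtain ⟨h4, h5⟩ := (hE.mem_interior_iff hi hgt).1 hzE
    obtain ⟨e1, e2⟩ := abs_of_mem_quadrant hi
    rw [mem_iUnion]
    refine ⟨i, ?_⟩
    simp only [subgraph, mem_ofPred_eq]
    rw [← e1, ← e2]
    exact ⟨⟨hgt.le, h4.le⟩, abs_nonneg _, h5.le⟩

/-- In the central part the norm is at most `a - h`. Under a profile it is at most that of the graph
point above, which is below `a` except at the pole. -/
theorem norm_le_of_mem_closure (hE : IsAdmissibleSet E a ν g q) {z : Plane}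
    (hz : z ∈ closure (interior E)) : ‖z‖ ≤ a ∧ |z 0| ≤ a ∧ (|z 0| < a → ‖z‖ < a) := by
  obtain ⟨h, hh, hsub⟩ := hE.closure_interior_subset
  have ha := hE.pos
  have hz0 : |z 0| ≤ ‖z‖ := by
    refine (pow_le_pow_iff_left₀ (abs_nonneg _) (norm_nonneg _) two_ne_zero).1 ?_
    rw [sq_abs, norm_sq_plane]
    nlinarith [sq_nonneg (z 1)]
  rcases hsub hz with ⟨h1, -⟩ | h1
  · have : ‖z‖ ≤ a - h := by simpa using h1
    have h2 : ‖z‖ < a := by linarith [hh.1]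
    exact ⟨h2.le, by linarith, fun _ => h2⟩
  · obtain ⟨i, hi, h2, h3⟩ := mem_iUnion.1 h1
    have hG := hE.isProfile i
    have e0 : |z 0| = hsign i * z 0 := by
      rw [← abs_of_nonneg (hG.nu_nonneg.trans hi.1), abs_mul, abs_hsign, one_mul]
    have hn : ‖z‖ ^ 2 ≤ (hsign i * z 0) ^ 2 + profile g i (hsign i * z 0) ^ 2 := by
      rw [norm_sq_plane]
      have e1 : (vsign i * z 1) ^ 2 = z 1 ^ 2 := by rw [mul_pow, pow_two (vsign i), vsign_sq, one_mul]
      have e2 : (hsign i * z 0) ^ 2 = z 0 ^ 2 := by rw [mul_pow, pow_two (hsign i), hsign_sq, one_mul]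
      rw [e2, ← e1]
      gcongr
    have hlt : |z 0| < a → ‖z‖ < a := fun hlt => by
      refine lt_of_pow_lt_pow_left₀ 2 ha.le (lt_of_le_of_lt hn ?_)
      exact hG.sq_add_sq_lt ⟨hi.1, e0 ▸ hlt⟩
    refine ⟨?_, e0 ▸ hi.2, hlt⟩
    rcases (e0 ▸ hi.2 : |z 0| ≤ a).lt_or_eq with h4 | h4
    · exact (hlt h4).le
    · refine (pow_le_pow_iff_left₀ (norm_nonneg _) ha.le two_ne_zero).1 (hn.trans ?_)
      rw [← e0, h4, hG.end_zero]; simp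

/-- Almost diametral pairs lie near opposite poles. -/
theorem exists_near_poles (hE : IsAdmissibleSet E a ν g q) {x₀ : ℝ} (hx₀ : x₀ ∈ Ioo 0 a) :
    ∃ δ > 0, ∀ z ∈ closure (interior E), ∀ w ∈ closure (interior E), 2 * a - δ < dist z w →
      x₀ < |z 0| ∧ x₀ < |w 0| ∧ z 0 * w 0 < 0 := by
  have ha := hE.pos
  have hcomp : IsCompact (closure (interior E)) :=
    hE.isCompact.of_isClosed_subset isClosed_closure
      (closure_minimal interior_subset hE.isCompact.isClosed)
  have hK : IsCompact (closure (interior E) ∩ {z : Plane | |z 0| ≤ x₀}) :=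
    hcomp.inter_right (isClosed_le (by fun_prop) continuous_const)
  -- By compactness the norm is bounded away from `a` where `|z 0| ≤ x₀`.
  obtain ⟨δ, hδ, hδ'⟩ : ∃ δ > 0, ∀ z ∈ closure (interior E), a - δ < ‖z‖ → x₀ < |z 0| := by
    rcases (closure (interior E) ∩ {z : Plane | |z 0| ≤ x₀}).eq_empty_or_nonempty with h | h
    · refine ⟨1, one_pos, fun z hz _ => ?_⟩
      by_contra hcon
      exact (h ▸ ⟨hz, not_lt.1 hcon⟩ : z ∈ (∅ : Set Plane)).elim
    · obtain ⟨m, hm, hmax⟩ := hK.exists_isMaxOn h continuous_norm.continuousOn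
      have hma : ‖m‖ < a := (hE.norm_le_of_mem_closure hm.1).2.2 (lt_of_le_of_lt hm.2 hx₀.2)
      refine ⟨a - ‖m‖, by linarith, fun z hz hzn => ?_⟩
      by_contra hcon
      have := hmax ⟨hz, not_lt.1 hcon⟩
      simp only [mem_ofPred_eq] at this
      linarith
  -- The bound `δ` forces both norms above `a - δ`, `x₀² / a` excludes two points on the same side,
  -- and `a` keeps `2a - d` nonnegative for squaring.
  refine ⟨min (min δ (x₀ ^ 2 / a)) a, by have := hx₀.1; positivity, fun z hz w hw hzw => ?_⟩
  have hz1 := (hE.norm_le_of_mem_closure hz).1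
  have hw1 := (hE.norm_le_of_mem_closure hw).1
  have hd1 : min (min δ (x₀ ^ 2 / a)) a ≤ δ := (min_le_left _ _).trans (min_le_left _ _)
  have hd2 : min (min δ (x₀ ^ 2 / a)) a ≤ x₀ ^ 2 / a := (min_le_left _ _).trans (min_le_right _ _)
  have hd3 : min (min δ (x₀ ^ 2 / a)) a ≤ a := min_le_right _ _
  set d := min (min δ (x₀ ^ 2 / a)) a
  rw [dist_eq_norm] at hzw
  have htri := norm_sub_le z w
  have h1 := hδ' z hz (by linarith)
  have h2 := hδ' w hw (by linarith)
  refine ⟨h1, h2, ?_⟩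
  by_contra hcon
  rw [not_lt] at hcon
  -- The parallelogram law gives `‖z + w‖² < 4a² - (2a - d)² ≤ 4ad ≤ 4x₀²`, whereas first
  -- coordinates of equal sign would make it at least `4x₀²`.
  have hpar : ‖z + w‖ ^ 2 + ‖z - w‖ ^ 2 = 2 * ‖z‖ ^ 2 + 2 * ‖w‖ ^ 2 := by
    simp only [norm_sq_plane, PiLp.add_apply, PiLp.sub_apply]; ring
  have h3 : (z 0 + w 0) ^ 2 ≤ ‖z + w‖ ^ 2 := by
    rw [norm_sq_plane, PiLp.add_apply, PiLp.add_apply]; nlinarith [sq_nonneg (z 1 + w 1)]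
  have h4 : x₀ ^ 2 < z 0 ^ 2 := sq_lt_sq.2 (by rwa [abs_of_pos hx₀.1])
  have h5 : x₀ ^ 2 < w 0 ^ 2 := sq_lt_sq.2 (by rwa [abs_of_pos hx₀.1])
  have h6 : x₀ ^ 2 ≤ z 0 * w 0 := by
    refine abs_le_of_sq_le_sq' ?_ hcon |>.2
    nlinarith [mul_pos (sub_pos.2 h4) (sub_pos.2 h5), sq_nonneg x₀]
  have h7 : (2 * a - d) ^ 2 < ‖z - w‖ ^ 2 := by
    refine pow_lt_pow_left₀ hzw (by linarith) two_ne_zero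
  have h8 : d * a ≤ x₀ ^ 2 := (le_div_iff₀ ha).1 hd2
  have h9 : ‖z‖ ^ 2 ≤ a ^ 2 := pow_le_pow_left₀ (norm_nonneg _) hz1 2
  have h10 : ‖w‖ ^ 2 ≤ a ^ 2 := pow_le_pow_left₀ (norm_nonneg _) hw1 2
  nlinarith [sq_nonneg d]

/-- Near the poles, the norm is bounded away from `a` linearly. -/
theorem exists_norm_le_near_poles (hE : IsAdmissibleSet E a ν g q) :
    ∃ κ > 0, ∃ x₀ ∈ Ioo 0 a, ∀ z ∈ goodSet E ν, x₀ < |z 0| →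
      |z 0| < a ∧ ‖z‖ ≤ a - κ * (a - |z 0|) ∧ z 1 ^ 2 ≤ 2 * a * (a - |z 0|) := by
  have ha := hE.pos
  choose κ hκ x hx hle using fun i => (hE.isProfile i).eventually_sq_le
  obtain ⟨j, -, hj⟩ := Finset.exists_min_image Finset.univ κ ⟨0, Finset.mem_univ _⟩
  obtain ⟨l, -, hl⟩ := Finset.exists_max_image Finset.univ x ⟨0, Finset.mem_univ _⟩
  -- The worst `κ` and the worst threshold serve all quadrants. From `‖z‖² ≤ a² - κ(a² - x²)` and `a
  -- + |x| ≥ a`, taking the square root leaves the rate `κ / 2`.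
  refine ⟨κ j / 2, by linarith [(hκ j).1], max (x l) (a / 2), ⟨lt_max_of_lt_right (by linarith),
    max_lt (hx l).2 (by linarith)⟩, ?_⟩
  rintro z ⟨-, h0, h1, hint⟩ hz
  obtain ⟨i, hi⟩ := exists_mem_quadrant h0 h1
  have hzx : x i < |z 0| := lt_of_le_of_lt ((hl i (Finset.mem_univ _)).trans (le_max_left _ _)) hz
  have hzν : ν < |z 0| := lt_of_le_of_lt (hx i).1 hzx
  obtain ⟨h2, h3⟩ := (hE.mem_interior_iff hi hzν).1 (hint hzν)
  have h4 := hle i _ ⟨hzx, h2⟩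
  have h5 : |z 1| ^ 2 ≤ profile g i |z 0| ^ 2 := by gcongr
  have h6 : |z 0| ^ 2 = z 0 ^ 2 := sq_abs _
  have h7 : |z 1| ^ 2 = z 1 ^ 2 := sq_abs _
  have hκj : κ j ≤ κ i := hj i (Finset.mem_univ _)
  have hz0 : 0 ≤ |z 0| := abs_nonneg _
  have hpos : 0 < a ^ 2 - |z 0| ^ 2 := by nlinarith
  have h8 : z 1 ^ 2 ≤ (1 - κ j) * (a ^ 2 - |z 0| ^ 2) := by
    rw [← h7]
    refine (h5.trans h4).trans ?_
    gcongr
  refine ⟨h2, ?_, ?_⟩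
  · have hnn : 0 ≤ a - κ j / 2 * (a - |z 0|) := by nlinarith [(hκ j).1, (hκ j).2]
    refine (pow_le_pow_iff_left₀ (norm_nonneg _) hnn two_ne_zero).1 ?_
    rw [norm_sq_plane, ← h6]
    nlinarith [mul_nonneg (hκ j).1.le (sq_nonneg (a - |z 0|)),
      mul_nonneg (mul_nonneg (hκ j).1.le (hκ j).1.le) (sq_nonneg (a - |z 0|))]
  · nlinarith [(hκ j).1]

end IsAdmissibleSet

/-- Beyond `ν`, the closure of the interior lies under the four profiles, and a point there is
interior unless it is on a profile graph, an axis or a line `x = ±a`. These are null sets; extending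
each profile continuously to the line makes its graph manifestly one. -/
theorem IsAdmissibleDensity.goodSet_compl_null {P : Measure Plane} {f : Plane → ℝ} {E : Set Plane}
    {a ν : ℝ} {g : Fin 4 → ℝ → ℝ} {q : Fin 4 → ℝ} (hf : IsAdmissibleDensity P f E a)
    (hE : IsAdmissibleSet E a ν g q) : P (goodSet E ν)ᶜ = 0 := by
  have hac : P ≪ volume := by
    rw [hf.eq_withDensity]; exact withDensity_absolutelyContinuous _ _
  have h1 : ∀ᵐ z ∂P, z ∈ E := hf.compl_null
  have h2 : ∀ᵐ z ∂P, z ∉ E \ closure (interior E) :=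
    measure_eq_zero_iff_ae_notMem.1 hf.thin_null
  have h3 : ∀ᵐ z ∂P, z 0 ≠ 0 := hac.ae_le (ae_plane_fst_ne 0)
  have h4 : ∀ᵐ z ∂P, z 1 ≠ 0 := hac.ae_le (ae_plane_snd_ne (φ := fun _ => 0) measurable_const)
  have h5 : ∀ᵐ z ∂P, ∀ i, z 1 ≠ vsign i * IccExtend hE.nu_lt.le
      ((Icc ν a).domRestrict (profile g i)) (hsign i * z 0) := by
    rw [ae_all_iff]
    intro i
    exact hac.ae_le (ae_plane_snd_ne (φ := fun x => vsign i * IccExtend hE.nu_lt.le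
      ((Icc ν a).domRestrict (profile g i)) (hsign i * x)) (Continuous.measurable
      (continuous_const.mul ((hE.isProfile i).continuous_IccExtend.comp (by fun_prop)))))
  have h6 : ∀ᵐ z ∂P, z 0 ≠ a := hac.ae_le (ae_plane_fst_ne a)
  have h7 : ∀ᵐ z ∂P, z 0 ≠ -a := hac.ae_le (ae_plane_fst_ne (-a))
  obtain ⟨h, -, hsub⟩ := hE.closure_interior_subset
  change ∀ᵐ z ∂P, z ∈ goodSet E ν
  filter_upwards [h1, h2, h3, h4, h5, h6, h7] with z h1 h2 h3 h4 h5 h6 h7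
  have hcl : z ∈ closure (interior E) := by
    by_contra hcon
    exact h2 ⟨h1, hcon⟩
  refine ⟨hcl, h3, h4, fun hν => ?_⟩
  rcases hsub hcl with h8 | h8
  · exact absurd h8.2 (not_le.2 hν)
  obtain ⟨i, hi, h9, h10⟩ := mem_iUnion.1 h8
  have hi0 : 0 < hsign i * z 0 :=
    lt_of_le_of_ne (hE.nu_nonneg.trans hi.1) (mul_ne_zero
      (left_ne_zero_of_mul_eq_one (hsign_sq i)) h3).symm
  have hi1 : 0 < vsign i * z 1 :=
    lt_of_le_of_ne h9 (mul_ne_zero (left_ne_zero_of_mul_eq_one (vsign_sq i)) h4).symm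
  have hq : z ∈ quadrant i := (mem_quadrant_iff i z).2 ⟨hi0, hi1⟩
  obtain ⟨e1, e2⟩ := abs_of_mem_quadrant hq
  rw [hE.mem_interior_iff hq hν, e1, e2]
  refine ⟨lt_of_le_of_ne hi.2 fun h => ?_, lt_of_le_of_ne h10 fun h => ?_⟩
  · rw [← e1] at h
    rcases abs_choice (z 0) with h' | h' <;> rw [h'] at h
    · exact h6 h
    · exact h7 (by linarith)
  · apply h5 i
    rw [(hE.isProfile i).IccExtend_eq hi, ← h, ← mul_assoc, vsign_sq, one_mul]

/-! ### Convergence of the rescaled intensity measure -/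

/-- Parabolic rescaling around the two poles: the points near `(a, 0)` are mapped to the right and
those near `(-a, 0)` to the left half plane. -/
noncomputable def scaleMap (a k : ℝ) (z : Plane) : ℝ × ℝ :=
  if 0 < z 0 then (k ^ 2 * (a - z 0), k * z 1) else (k ^ 2 * (-a - z 0), k * z 1)

theorem measurable_scaleMap (a k : ℝ) : Measurable (scaleMap a k) :=
  Measurable.ite (measurableSet_lt measurable_const (by fun_prop)) (by fun_prop) (by fun_prop)

theorem poleDensity_eq (f : Plane → ℝ) (a : ℝ) (i : Fin 4) :
    poleDensity f a i = f (pole (hsign i * a)) := by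
  fin_cases i <;> simp [poleDensity, hsign]

/-- The chart of a quadrant. -/
noncomputable def quadrantChart (i : Fin 4) : ℝ × ℝ ≃ᵐ Plane := (reflect i).trans planeEquiv

theorem quadrantChart_apply_zero (i : Fin 4) (x : ℝ × ℝ) : quadrantChart i x 0 = hsign i * x.1 :=
  rfl

theorem quadrantChart_apply_one (i : Fin 4) (x : ℝ × ℝ) : quadrantChart i x 1 = vsign i * x.2 :=
  rfl

theorem measurePreserving_quadrantChart (i : Fin 4) : MeasurePreserving (quadrantChart i) :=
  measurePreserving_planeEquiv.comp (measurePreserving_reflect i)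

theorem continuous_quadrantChart (i : Fin 4) : Continuous (quadrantChart i) := by
  refine continuous_planeEquiv.comp ?_
  change Continuous fun x : ℝ × ℝ => (hsign i * x.1, vsign i * x.2)
  fun_prop

theorem quadrantChart_mem_quadrant_iff (i : Fin 4) (x : ℝ × ℝ) :
    quadrantChart i x ∈ quadrant i ↔ 0 < x.1 ∧ 0 < x.2 := by
  rw [mem_quadrant_iff, quadrantChart_apply_zero, quadrantChart_apply_one, ← mul_assoc,
    ← mul_assoc, hsign_sq, vsign_sq, one_mul, one_mul]

theorem quadrantChart_pole (i : Fin 4) (a : ℝ) : quadrantChart i (a, 0) = pole (hsign i * a) := by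
  ext j
  fin_cases j
  · change quadrantChart i (a, 0) 0 = pole (hsign i * a) 0
    rw [quadrantChart_apply_zero]; simp [pole]
  · change quadrantChart i (a, 0) 1 = pole (hsign i * a) 1
    rw [quadrantChart_apply_one]; simp [pole]

theorem scaleMap_quadrantChart (a k : ℝ) (i : Fin 4) {x : ℝ × ℝ} (hx : 0 < x.1) :
    scaleMap a k (quadrantChart i x) = reflect i (k ^ 2 * (a - x.1), k * x.2) := by
  rw [reflect_apply]
  simp only [scaleMap, quadrantChart_apply_zero, quadrantChart_apply_one]
  have hv : k * (vsign i * x.2) = vsign i * (k * x.2) := by ring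
  rw [hv]
  fin_cases i <;> simp [hsign, hx, hx.le, not_lt.2] <;> ring

section

variable {P : Measure Plane} {f : Plane → ℝ} {E : Set Plane} {a ν : ℝ}
  {g : Fin 4 → ℝ → ℝ} {q : Fin 4 → ℝ}

/-- Continuity of `f` is available only on `E`, so the pole must belong to `E` for `f` at the pole
to be the limit. Positive area in every disc around the pole puts it in the closure of `E`. -/
theorem IsAdmissibleSet.pole_mem (hE : IsAdmissibleSet E a ν g q) (i : Fin 4) :
    pole (hsign i * a) ∈ E := by
  rw [← hE.isCompact.isClosed.closure_eq, Metric.mem_closure_iff]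
  intro ε hε
  have key : ∀ (j : Fin 4) (w : Plane), 0 < volume (E ∩ quadrant j ∩ Metric.ball w ε) →
      ∃ b ∈ E, dist w b < ε := by
    intro j w h
    obtain ⟨b, hb⟩ := nonempty_of_measure_ne_zero h.ne'
    exact ⟨b, hb.1.1, by rw [dist_comm]; exact hb.2⟩
  fin_cases i
  · simpa [hsign] using key 0 _ (hE.area_right 0 (by simp) ε hε)
  · simpa [hsign] using key 1 _ (hE.area_left 1 (by simp) ε hε)
  · simpa [hsign] using key 1 _ (hE.area_left 1 (by simp) ε hε)
  · simpa [hsign] using key 0 _ (hE.area_right 0 (by simp) ε hε)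

theorem goodSet_subset (hE : IsAdmissibleSet E a ν g q) : goodSet E ν ⊆ E := fun _ hz =>
  closure_minimal interior_subset hE.isCompact.isClosed hz.1

theorem IsAdmissibleDensity.measureReal_eq_setIntegral (hf : IsAdmissibleDensity P f E a)
    {B : Set Plane} (hB : MeasurableSet B) : P.real B = ∫ z in B, f z := by
  rw [integral_eq_lintegral_of_nonneg_ae (Eventually.of_forall hf.nonneg)
    hf.measurable.aestronglyMeasurable, measureReal_def]
  conv_lhs => rw [hf.eq_withDensity, withDensity_apply _ hB]

theorem IsAdmissibleDensity.tendsto_at_pole (hf : IsAdmissibleDensity P f E a)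
    (hE : IsAdmissibleSet E a ν g q) (i : Fin 4) :
    Tendsto f (𝓝[E] (pole (hsign i * a))) (𝓝 (poleDensity f a i)) := by
  obtain ⟨ε, hε, h1, h2⟩ := hf.continuousOn
  rw [poleDensity_eq]
  have key : ∀ w ∈ E, ContinuousOn f (E ∩ Metric.ball w ε) → Tendsto f (𝓝[E] w) (𝓝 (f w)) := by
    intro w hw hc
    have := hc w ⟨hw, Metric.mem_ball_self hε⟩
    rwa [ContinuousWithinAt, nhdsWithin_inter_of_mem' (nhdsWithin_le_nhds
      (Metric.ball_mem_nhds w hε))] at this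
  have hp := hE.pole_mem i
  fin_cases i
  · simp [hsign] at hp ⊢; exact key _ hp h1
  · simp [hsign] at hp ⊢; exact key _ hp h2
  · simp [hsign] at hp ⊢; exact key _ hp h2
  · simp [hsign] at hp ⊢; exact key _ hp h1

theorem IsAdmissibleDensity.measureReal_quadrant_inter (hf : IsAdmissibleDensity P f E a)
    (i : Fin 4) (k : ℝ) {C : Set (ℝ × ℝ)} (hC : MeasurableSet C) :
    P.real (quadrant i ∩ (goodSet E ν ∩ scaleMap a k ⁻¹' C)) =
      ∫ x in {x : ℝ × ℝ | 0 < x.1 ∧ 0 < x.2} ∩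
        {x | (k ^ 2 * (a - x.1), k * x.2) ∈ reflect i ⁻¹' C},
        (goodSet E ν).indicator f (quadrantChart i x) := by
  have hm : MeasurableSet (quadrant i ∩ scaleMap a k ⁻¹' C) :=
    (isOpen_quadrant i).measurableSet.inter (measurable_scaleMap a k hC)
  have hG := measurableSet_goodSet E ν
  have e1 : quadrant i ∩ (goodSet E ν ∩ scaleMap a k ⁻¹' C) =
      (quadrant i ∩ scaleMap a k ⁻¹' C) ∩ goodSet E ν := by
    ext z; simp only [mem_inter_iff]; tauto
  have e2 : quadrantChart i ⁻¹' (quadrant i ∩ scaleMap a k ⁻¹' C) =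
      {x : ℝ × ℝ | 0 < x.1 ∧ 0 < x.2} ∩
        {x | (k ^ 2 * (a - x.1), k * x.2) ∈ reflect i ⁻¹' C} := by
    ext x
    simp only [mem_preimage, mem_inter_iff, mem_ofPred_eq, quadrantChart_mem_quadrant_iff]
    refine and_congr_right fun hx => ?_
    rw [scaleMap_quadrantChart a k i hx.1]
  rw [e1, hf.measureReal_eq_setIntegral (hm.inter hG), ← setIntegral_indicator hG, ← e2]
  exact ((measurePreserving_quadrantChart i).setIntegral_preimage_emb
    (quadrantChart i).measurableEmbedding _ _).symm

/-- The rescaled intensity measures converge to a measure with constant density in each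
quadrant. -/
theorem IsAdmissibleDensity.tendsto_scaled_measure [IsProbabilityMeasure P]
    (hf : IsAdmissibleDensity P f E a)
    (hE : IsAdmissibleSet E a ν g q) {C : Set (ℝ × ℝ)} (hC : MeasurableSet C)
    (hCb : Bornology.IsBounded C) :
    Tendsto (fun k : ℝ => k ^ 3 * P.real (goodSet E ν ∩ scaleMap a k ⁻¹' C)) atTop
      (𝓝 (∑ i, poleDensity f a i *
        volume.real (reflect i ⁻¹' C ∩ parabolaRegion a (q i)))) := by
  -- Points of the good set avoid both axes, so the open quadrants partition it.
  have hsum : ∀ k : ℝ, P.real (goodSet E ν ∩ scaleMap a k ⁻¹' C) =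
      ∑ i, P.real (quadrant i ∩ (goodSet E ν ∩ scaleMap a k ⁻¹' C)) := by
    intro k
    rw [← measureReal_biUnion_finset]
    · congr 1
      ext z
      simp only [mem_iUnion, mem_inter_iff, Finset.mem_univ, exists_prop, true_and]
      constructor
      · intro hz
        obtain ⟨i, hi⟩ := exists_mem_quadrant hz.1.2.1 hz.1.2.2.1
        exact ⟨i, hi, hz⟩
      · rintro ⟨i, -, hz⟩
        exact hz
    · intro i _ j _ hij
      refine (Set.disjoint_left.2 fun z hzi hzj => ?_ : Disjoint (quadrant i) (quadrant j)).mono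
        inter_subset_left inter_subset_left
      fin_cases i <;> fin_cases j <;> simp [quadrant] at hij hzi hzj <;> linarith
    · intro i _
      exact (isOpen_quadrant i).measurableSet.inter ((measurableSet_goodSet E ν).inter
        (measurable_scaleMap a k hC))
  simp_rw [hsum, Finset.mul_sum, hf.measureReal_quadrant_inter _ _ hC]
  refine tendsto_finsetSum _ fun i _ => ?_
  have hG := hE.isProfile i
  have hto : Tendsto (quadrantChart i) (𝓝 (a, 0)) (𝓝 (pole (hsign i * a))) := by
    rw [← quadrantChart_pole]; exact (continuous_quadrantChart i).tendsto _
  have hν : ∀ᶠ x : ℝ × ℝ in 𝓝 (a, 0), ν < x.1 :=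
    (continuous_fst.tendsto _).eventually_const_lt hE.nu_lt
  have habs : ∀ x : ℝ × ℝ, 0 < x.1 → 0 < x.2 →
      |quadrantChart i x 0| = x.1 ∧ |quadrantChart i x 1| = x.2 := by
    intro x h1 h2
    obtain ⟨e1, e2⟩ := abs_of_mem_quadrant ((quadrantChart_mem_quadrant_iff i x).2 ⟨h1, h2⟩)
    rw [e1, e2, quadrantChart_apply_zero, quadrantChart_apply_one, ← mul_assoc, ← mul_assoc,
      hsign_sq, vsign_sq, one_mul, one_mul]
    exact ⟨rfl, rfl⟩
  refine tendsto_scaled_integral (G := profile g i) hE.pos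
    ((hf.measurable.indicator (measurableSet_goodSet E ν)).comp (quadrantChart i).measurable)
    (fun x => indicator_nonneg (fun z _ => hf.nonneg z) _) hG.decay ?_ ?_
    ((reflect i).measurable hC) ?_
  · filter_upwards [hν] with x hx hx2 hne
    have hgood := mem_of_indicator_ne_zero hne
    have hx1 : 0 < x.1 := lt_of_le_of_lt hE.nu_nonneg hx
    obtain ⟨e1, e2⟩ := habs x hx1 hx2
    have hint := hgood.2.2.2 (by rwa [e1])
    rwa [hE.mem_interior_iff ((quadrantChart_mem_quadrant_iff i x).2 ⟨hx1, hx2⟩) (by rwa [e1]),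
      e1, e2] at hint
  · have hreg : ∀ᶠ x : ℝ × ℝ in 𝓝[{x | x.1 < a ∧ 0 < x.2 ∧ x.2 < profile g i x.1}] (a, 0),
        quadrantChart i x ∈ goodSet E ν := by
      filter_upwards [self_mem_nhdsWithin, nhdsWithin_le_nhds hν] with x hx hxν
      have hx1 : 0 < x.1 := lt_of_le_of_lt hE.nu_nonneg hxν
      obtain ⟨e1, e2⟩ := habs x hx1 hx.2.1
      have hint : quadrantChart i x ∈ interior E := by
        rw [hE.mem_interior_iff ((quadrantChart_mem_quadrant_iff i x).2 ⟨hx1, hx.2.1⟩)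
          (by rwa [e1]), e1, e2]
        exact ⟨hx.1, hx.2.2⟩
      refine ⟨subset_closure hint, ?_, ?_, fun _ => hint⟩
      · rw [← abs_pos, e1]; exact hx1
      · rw [← abs_pos, e2]; exact hx.2.1
    have hto' : Tendsto (quadrantChart i)
        (𝓝[{x | x.1 < a ∧ 0 < x.2 ∧ x.2 < profile g i x.1}] (a, 0))
        (𝓝[E] (pole (hsign i * a))) :=
      tendsto_nhdsWithin_iff.2 ⟨hto.mono_left nhdsWithin_le_nhds,
        hreg.mono fun x hx => goodSet_subset hE hx⟩
    refine ((hf.tendsto_at_pole hE i).comp hto').congr' ?_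
    filter_upwards [hreg] with x hx
    simp [indicator_of_mem hx]
  · obtain ⟨M, hM⟩ := hCb.exists_norm_le
    refine isBounded_iff_forall_norm_le.2 ⟨M, fun x hx => ?_⟩
    have := hM _ hx
    rwa [reflect_apply, Prod.norm_def, norm_mul, norm_mul, Real.norm_eq_abs (hsign i),
      Real.norm_eq_abs (vsign i), abs_hsign, abs_vsign, one_mul, one_mul] at this

end

/-! ### Supports of Poisson configurations and measurability of the diameter -/

/-- In a finite counting measure every point of the support is an atom. -/
theorem measure_singleton_ne_zero_of_mem_support {X : Type*} [MetricSpace X] [MeasurableSpace X]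
    [BorelSpace X] {ν : Measure X} [IsFiniteMeasure ν]
    (hν : ∀ B, MeasurableSet B → ∃ k : ℕ∞, ν B = (k : ℝ≥0∞)) {z : X} (hz : z ∈ ν.support) :
    ν {z} ≠ 0 := by
  intro h0
  -- Outer regularity gives an open neighbourhood of measure below `1`; an integer value below `1`
  -- is `0`, which is impossible at a point of the support.
  obtain ⟨U, hU, hUo, hU1⟩ := Set.exists_isOpen_lt_of_lt {z} 1 (h0 ▸ zero_lt_one : ν {z} < 1)
  have hpos := (Measure.mem_support_iff_forall z).1 hz U (hUo.mem_nhds (hU rfl))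
  obtain ⟨k, hk⟩ := hν U hUo.measurableSet
  rw [hk] at hpos hU1
  have h1 : (k : ℝ≥0∞) < ((1 : ℕ∞) : ℝ≥0∞) := by simpa using hU1
  rw [ENat.toENNReal_lt] at h1
  rw [Order.lt_one_iff.1 h1] at hpos
  simp at hpos

/-- For a general measure this needs `B` open. Here the support consists of atoms, so arbitrary
cells can be tested, and emptiness of a cell becomes an event about counts. -/
theorem disjoint_support_iff {X : Type*} [MetricSpace X] [SecondCountableTopology X]
    [MeasurableSpace X] [BorelSpace X] {ν : Measure X} [IsFiniteMeasure ν]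
    (hν : ∀ B, MeasurableSet B → ∃ k : ℕ∞, ν B = (k : ℝ≥0∞)) (B : Set X) :
    Disjoint ν.support B ↔ ν B = 0 := by
  constructor
  · intro h
    by_contra hne
    obtain ⟨z, hzB, hz⟩ := Measure.nonempty_inter_support_of_pos (pos_iff_ne_zero.2 hne)
    exact Set.disjoint_left.1 h hz hzB
  · intro h
    rw [Set.disjoint_left]
    intro z hz hzB
    exact measure_singleton_ne_zero_of_mem_support hν hz
      (measure_mono_null (singleton_subset_iff.2 hzB) h)

namespace IsPoissonProcess

variable {Ω X : Type*} [MeasurableSpace Ω] [MeasurableSpace X] {Φ : Ω → Measure X}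
  {Λ : Measure X} {μ : Measure Ω}

theorem measurable_apply (hΦ : IsPoissonProcess Φ Λ μ) {B : Set X} (hB : MeasurableSet B) :
    Measurable fun ω => Φ ω B := (Measure.measurable_coe hB).comp hΦ.measurable

theorem measure_eq_zero (hΦ : IsPoissonProcess Φ Λ μ) {B : Set X} (hB : MeasurableSet B)
    (hfin : Λ B ≠ ∞) : μ.real {ω | Φ ω B = 0} = Real.exp (-Λ.real B) := by
  have h := congrArg (fun m : Measure ℝ≥0∞ => m {0}) (hΦ.law B hB hfin)
  beta_reduce at h
  rw [Measure.map_apply (hΦ.measurable_apply hB) (measurableSet_singleton 0),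
    Measure.map_apply (by fun_prop) (measurableSet_singleton 0)] at h
  have e1 : (fun k : ℕ => (k : ℝ≥0∞)) ⁻¹' {0} = {0} := by ext k; simp
  have e2 : (fun ω => Φ ω B) ⁻¹' {0} = {ω | Φ ω B = 0} := rfl
  rw [e1, e2, poissonMeasure_singleton] at h
  rw [measureReal_def, h, ENNReal.toReal_ofReal (by positivity)]
  simp [measureReal_def, ENNReal.coe_toNNReal_eq_toReal]

theorem ae_ne_top (hΦ : IsPoissonProcess Φ Λ μ) {B : Set X} (hB : MeasurableSet B)
    (hfin : Λ B ≠ ∞) : ∀ᵐ ω ∂μ, Φ ω B ≠ ∞ := by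
  have h := congrArg (fun m : Measure ℝ≥0∞ => m {∞}) (hΦ.law B hB hfin)
  beta_reduce at h
  rw [Measure.map_apply (hΦ.measurable_apply hB) (measurableSet_singleton ∞),
    Measure.map_apply (by fun_prop) (measurableSet_singleton ∞)] at h
  have e1 : (fun k : ℕ => (k : ℝ≥0∞)) ⁻¹' {∞} = ∅ := by ext k; simp
  rw [e1, measure_empty] at h
  rw [ae_iff]
  simp only [ne_eq, not_not]
  exact h

theorem ae_eq_zero [IsProbabilityMeasure μ] (hΦ : IsPoissonProcess Φ Λ μ) {B : Set X}
    (hB : MeasurableSet B) (h0 : Λ B = 0) : ∀ᵐ ω ∂μ, Φ ω B = 0 := by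
  have h := hΦ.measure_eq_zero hB (by simp [h0])
  rw [measureReal_def Λ, h0, ENNReal.toReal_zero, neg_zero, Real.exp_zero] at h
  have hm : MeasurableSet {ω | Φ ω B = 0} := hΦ.measurable_apply hB (measurableSet_singleton 0)
  rw [ae_iff, ← compl_ofPred, prob_compl_eq_zero_iff hm]
  have := (ENNReal.toReal_eq_one_iff _).1 h
  exact this

end IsPoissonProcess

/-- The configurations that occur almost surely: finitely many points, all in the good set. -/
structure IsGoodConfiguration (ν : Measure Plane) (B : Set Plane) : Prop where
  counting : ∀ A, MeasurableSet A → ∃ k : ℕ∞, ν A = (k : ℝ≥0∞)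
  ne_top : ν univ ≠ ∞
  compl_null : ν Bᶜ = 0

theorem IsPoissonProcess.ae_isGoodConfiguration {Ω : Type*} [MeasurableSpace Ω]
    {μ : Measure Ω} [IsProbabilityMeasure μ] {Φ : Ω → Measure Plane} {Λ : Measure Plane}
    [IsFiniteMeasure Λ] (hΦ : IsPoissonProcess Φ Λ μ) {B : Set Plane} (hB : MeasurableSet B)
    (h0 : Λ Bᶜ = 0) : ∀ᵐ ω ∂μ, IsGoodConfiguration (Φ ω) B := by
  filter_upwards [hΦ.ae_ne_top .univ (measure_ne_top _ _), hΦ.ae_eq_zero hB.compl h0]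
    with ω h1 h2 using ⟨hΦ.counting ω, h1, h2⟩

namespace IsGoodConfiguration

variable {ν : Measure Plane} {B : Set Plane}

theorem isFiniteMeasure (h : IsGoodConfiguration ν B) : IsFiniteMeasure ν := ⟨h.ne_top.lt_top⟩

theorem support_subset (h : IsGoodConfiguration ν B) : ν.support ⊆ B := by
  have := h.isFiniteMeasure
  exact disjoint_compl_right_iff_subset.1 ((disjoint_support_iff h.counting Bᶜ).2 h.compl_null)

end IsGoodConfiguration

theorem lt_diam_iff {S : Set Plane} (hS : Bornology.IsBounded S) {t : ℝ} (ht : 0 ≤ t) :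
    t < Metric.diam S ↔ ∃ z ∈ S, ∃ w ∈ S, t < dist z w := by
  constructor
  · intro h
    by_contra! hcon
    exact absurd (Metric.diam_le_of_forall_dist_le ht hcon) (not_le.2 h)
  · rintro ⟨z, hz, w, hw, h⟩
    exact h.trans_le (Metric.dist_le_diam_of_mem hS hz hw)

/-- The diameter exceeds `t ≥ 0` exactly when two basic open sets, all of whose cross distances
exceed `t`, both carry mass. A countable basis makes this a countable union of events about counts.
-/
theorem IsPoissonProcess.aemeasurable_diam_support {Ω : Type*} [MeasurableSpace Ω]
    {μ : Measure Ω} {Φ : Ω → Measure Plane} {Λ : Measure Plane}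
    (hΦ : IsPoissonProcess Φ Λ μ) {B : Set Plane} (hB : Bornology.IsBounded B)
    (hgood : ∀ᵐ ω ∂μ, IsGoodConfiguration (Φ ω) B) :
    AEMeasurable (fun ω => Metric.diam (Φ ω).support) μ := by
  refine NullMeasurable.aemeasurable ?_
  refine measurable_of_Ioi fun t => ?_
  change NullMeasurableSet {ω | t < Metric.diam (Φ ω).support} μ
  rcases lt_or_ge t 0 with ht | ht
  · convert! nullMeasurableSet_univ
    exact eq_univ_of_forall fun ω => ht.trans_le Metric.diam_nonneg
  set 𝓑 := TopologicalSpace.countableBasis Plane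
  set I : Set (Set Plane × Set Plane) := {p ∈ 𝓑 ×ˢ 𝓑 | ∀ z ∈ p.1, ∀ w ∈ p.2, t < dist z w} with hI
  have hIc : I.Countable := ((TopologicalSpace.countable_countableBasis Plane).prod
    (TopologicalSpace.countable_countableBasis Plane)).mono fun p hp => hp.1
  have hmeas : MeasurableSet (⋃ p ∈ I, {ω | Φ ω p.1 ≠ 0} ∩ {ω | Φ ω p.2 ≠ 0}) := by
    refine MeasurableSet.biUnion hIc fun p hp => ?_
    have h1 := (TopologicalSpace.isBasis_countableBasis Plane).isOpen hp.1.1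
    have h2 := (TopologicalSpace.isBasis_countableBasis Plane).isOpen hp.1.2
    exact ((hΦ.measurable_apply h1.measurableSet) (measurableSet_singleton 0).compl).inter
      ((hΦ.measurable_apply h2.measurableSet) (measurableSet_singleton 0).compl)
  refine hmeas.nullMeasurableSet.congr ?_
  filter_upwards [hgood] with ω hω
  refine propext ?_
  change ω ∈ (⋃ p ∈ I, {ω | Φ ω p.1 ≠ 0} ∩ {ω | Φ ω p.2 ≠ 0}) ↔ t < Metric.diam (Φ ω).support
  rw [lt_diam_iff (hB.subset hω.support_subset) ht]
  simp only [mem_iUnion, mem_inter_iff, mem_ofPred_eq, exists_prop]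
  constructor
  · rintro ⟨p, hp, h1, h2⟩
    obtain ⟨z, hz1, hz⟩ := Measure.nonempty_inter_support_of_pos (pos_iff_ne_zero.2 h1)
    obtain ⟨w, hw1, hw⟩ := Measure.nonempty_inter_support_of_pos (pos_iff_ne_zero.2 h2)
    exact ⟨z, hz, w, hw, hp.2 z hz1 w hw1⟩
  · rintro ⟨z, hz, w, hw, h⟩
    have hopen : IsOpen {p : Plane × Plane | t < dist p.1 p.2} :=
      isOpen_lt continuous_const continuous_dist
    obtain ⟨U, V, hU, hV, hzU, hwV, hUV⟩ := isOpen_prod_iff.1 hopen z w h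
    obtain ⟨U', hU', hzU', hUU'⟩ :=
      (TopologicalSpace.isBasis_countableBasis Plane).exists_subset_of_mem_open hzU hU
    obtain ⟨V', hV', hwV', hVV'⟩ :=
      (TopologicalSpace.isBasis_countableBasis Plane).exists_subset_of_mem_open hwV hV
    have hUV' : ∀ x ∈ U', ∀ y ∈ V', t < dist x y := by
      intro x hx y hy
      have hxy : (x, y) ∈ U ×ˢ V := mk_mem_prod (hUU' hx) (hVV' hy)
      simpa only [mem_ofPred_eq] using hUV hxy
    refine ⟨(U', V'), ⟨⟨hU', hV'⟩, hUV'⟩, ?_, ?_⟩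
    · exact ((Measure.mem_support_iff_forall z).1 hz U'
        (((TopologicalSpace.isBasis_countableBasis Plane).isOpen hU').mem_nhds hzU')).ne'
    · exact ((Measure.mem_support_iff_forall w).1 hw V'
        (((TopologicalSpace.isBasis_countableBasis Plane).isOpen hV').mem_nhds hwV')).ne'

/-! ### Distances in rescaled coordinates and localisation -/

/-- The rescaled defect of the distance of two points given in rescaled coordinates. -/
noncomputable def scaledCost (a k : ℝ) (x y : ℝ × ℝ) : ℝ :=
  k ^ 2 * (2 * a - √((2 * a - (x.1 - y.1) / k ^ 2) ^ 2 + ((x.2 - y.2) / k) ^ 2))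

/-- The limit of `scaledCost a k` as `k → ∞`. -/
noncomputable def limitCost (a : ℝ) (x y : ℝ × ℝ) : ℝ :=
  x.1 - y.1 - (x.2 - y.2) ^ 2 / (4 * a)

/-- The points of the right half plane of norm at most `R`. -/
def rightWindow (R : ℝ) : Set (ℝ × ℝ) := {x | 0 < x.1} ∩ Metric.closedBall 0 R

/-- The points of the left half plane of norm at most `R`. -/
def leftWindow (R : ℝ) : Set (ℝ × ℝ) := {x | x.1 < 0} ∩ Metric.closedBall 0 R

theorem measurableSet_rightWindow (R : ℝ) : MeasurableSet (rightWindow R) :=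
  (measurableSet_lt measurable_const measurable_fst).inter Metric.isClosed_closedBall.measurableSet

theorem measurableSet_leftWindow (R : ℝ) : MeasurableSet (leftWindow R) :=
  (measurableSet_lt measurable_fst measurable_const).inter Metric.isClosed_closedBall.measurableSet

theorem totallyBounded_rightWindow (R : ℝ) : TotallyBounded (rightWindow R) :=
  (isCompact_closedBall _ _).totallyBounded.subset inter_subset_right

theorem totallyBounded_leftWindow (R : ℝ) : TotallyBounded (leftWindow R) :=
  (isCompact_closedBall _ _).totallyBounded.subset inter_subset_right

theorem uniformContinuousOn_limitCost (a R : ℝ) :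
    UniformContinuousOn (fun p : (ℝ × ℝ) × (ℝ × ℝ) => limitCost a p.1 p.2)
      (rightWindow R ×ˢ leftWindow R) := by
  refine (IsCompact.uniformContinuousOn_of_continuous
    ((isCompact_closedBall (0 : ℝ × ℝ) R).prod (isCompact_closedBall (0 : ℝ × ℝ) R)) ?_).mono
    (prod_mono inter_subset_right inter_subset_right)
  unfold limitCost
  fun_prop

/-- Multiplying by the conjugate `2a + D`, where `D` is the distance, removes the product of `k²`
with a vanishing difference and leaves an expression continuous in `k⁻¹` up to `0`. -/
theorem scaledCost_eq {a k : ℝ} (ha : 0 < a) (hk : k ≠ 0) (x y : ℝ × ℝ) :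
    scaledCost a k x y = (4 * a * (x.1 - y.1) - (x.2 - y.2) ^ 2 - (k⁻¹ * (x.1 - y.1)) ^ 2) /
      (2 * a + √((2 * a - k⁻¹ ^ 2 * (x.1 - y.1)) ^ 2 + (k⁻¹ * (x.2 - y.2)) ^ 2)) := by
  have h0 : 0 ≤ (2 * a - k⁻¹ ^ 2 * (x.1 - y.1)) ^ 2 + (k⁻¹ * (x.2 - y.2)) ^ 2 := by positivity
  have h1 : (2 * a - (x.1 - y.1) / k ^ 2) ^ 2 + ((x.2 - y.2) / k) ^ 2 =
      (2 * a - k⁻¹ ^ 2 * (x.1 - y.1)) ^ 2 + (k⁻¹ * (x.2 - y.2)) ^ 2 := by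
    field_simp
  rw [scaledCost, h1, eq_div_iff (by positivity)]
  have h2 := Real.sq_sqrt h0
  set D := √((2 * a - k⁻¹ ^ 2 * (x.1 - y.1)) ^ 2 + (k⁻¹ * (x.2 - y.2)) ^ 2)
  have h3 : k ^ 2 * (2 * a - D) * (2 * a + D) = k ^ 2 * (4 * a ^ 2 - D ^ 2) := by ring
  rw [h3, h2]
  field_simp
  ring

theorem tendsto_scaledCost {a : ℝ} (ha : 0 < a) (R : ℝ) {η : ℝ} (hη : 0 < η) :
    ∀ᶠ k in atTop, ∀ x ∈ rightWindow R, ∀ y ∈ leftWindow R,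
      |scaledCost a k x y - limitCost a x y| < η := by
  set F : ℝ → (ℝ × ℝ) × (ℝ × ℝ) → ℝ := fun h p =>
    (4 * a * (p.1.1 - p.2.1) - (p.1.2 - p.2.2) ^ 2 - (h * (p.1.1 - p.2.1)) ^ 2) /
      (2 * a + √((2 * a - h ^ 2 * (p.1.1 - p.2.1)) ^ 2 + (h * (p.1.2 - p.2.2)) ^ 2)) with hF
  have hcont : Continuous fun z : ℝ × ((ℝ × ℝ) × (ℝ × ℝ)) => F z.1 z.2 - F 0 z.2 := by
    have hc : Continuous fun z : ℝ × ((ℝ × ℝ) × (ℝ × ℝ)) => F z.1 z.2 := by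
      refine Continuous.div (by fun_prop) (by fun_prop) fun z => ?_
      positivity
    have hd : Continuous fun z : ℝ × ((ℝ × ℝ) × (ℝ × ℝ)) => ((0 : ℝ), z.2) := by fun_prop
    exact hc.sub (hc.comp hd)
  have hlim : ∀ p, F 0 p = limitCost a p.1 p.2 := fun p => by
    simp only [hF, limitCost]
    have : √((2 * a - 0 ^ 2 * (p.1.1 - p.2.1)) ^ 2 + (0 * (p.1.2 - p.2.2)) ^ 2) = 2 * a := by
      rw [← Real.sqrt_sq (by positivity : (0 : ℝ) ≤ 2 * a)]
      congr 1
      rw [Real.sqrt_sq (by positivity)]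
      ring
    rw [this]
    field_simp
    ring
  have hK := (isCompact_closedBall (0 : ℝ × ℝ) R).prod (isCompact_closedBall (0 : ℝ × ℝ) R)
  -- Joint continuity in `h = k⁻¹` and the pair of points, over a compact set of pairs, makes the
  -- convergence uniform.
  have hev : ∀ᶠ h in 𝓝 (0 : ℝ), ∀ p ∈ Metric.closedBall (0 : ℝ × ℝ) R ×ˢ
      Metric.closedBall (0 : ℝ × ℝ) R, |F h p - F 0 p| < η := by
    refine hK.eventually_forall_of_forall_eventually fun p _ => ?_
    have hopen : IsOpen {z : ℝ × ((ℝ × ℝ) × (ℝ × ℝ)) | |F z.1 z.2 - F 0 z.2| < η} :=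
      isOpen_lt hcont.abs continuous_const
    exact hopen.mem_nhds (by simpa using hη)
  filter_upwards [(tendsto_inv_atTop_zero (𝕜 := ℝ)).eventually hev, eventually_gt_atTop 0]
    with k hk hk0 x hx y hy
  have h := hk (x, y) ⟨hx.2, hy.2⟩
  rwa [hlim, show F k⁻¹ (x, y) = scaledCost a k x y from (scaledCost_eq ha hk0.ne' x y).symm] at h

theorem scaledCost_scaleMap {a k : ℝ} (hk : k ≠ 0) {z w : Plane} (hz : 0 < z 0) (hw : w 0 < 0) :
    scaledCost a k (scaleMap a k z) (scaleMap a k w) = k ^ 2 * (2 * a - dist z w) := by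
  rw [scaledCost, scaleMap, scaleMap, if_pos hz, if_neg hw.le.not_gt, EuclideanSpace.dist_eq,
    Fin.sum_univ_two, Real.dist_eq, Real.dist_eq, sq_abs, sq_abs]
  congr 4
  · field_simp
    ring
  · field_simp

namespace IsAdmissibleSet

variable {E : Set Plane} {a ν : ℝ} {g : Fin 4 → ℝ → ℝ} {q : Fin 4 → ℝ}

/-- As `|z 0| ≤ a`, points measured from the left pole never get a positive first coordinate, so the
sign of the rescaled first coordinate identifies the pole. -/
theorem pos_of_scaleMap_fst_pos (hE : IsAdmissibleSet E a ν g q) {k : ℝ} {z : Plane}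
    (hz : z ∈ goodSet E ν) (h : 0 < (scaleMap a k z).1) : 0 < z 0 := by
  have h1 := (abs_le.1 (hE.norm_le_of_mem_closure hz.1).2.1).1
  by_contra hcon
  rw [scaleMap, if_neg hcon] at h
  nlinarith [sq_nonneg k]

theorem neg_of_scaleMap_fst_neg (hE : IsAdmissibleSet E a ν g q) {k : ℝ} {z : Plane}
    (hz : z ∈ goodSet E ν) (h : (scaleMap a k z).1 < 0) : z 0 < 0 := by
  have h1 := (abs_le.1 (hE.norm_le_of_mem_closure hz.1).2.1).2
  by_contra hcon
  have h2 : 0 < z 0 := lt_of_le_of_ne (not_lt.1 hcon) (Ne.symm hz.2.1)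
  rw [scaleMap, if_pos h2] at h
  nlinarith [sq_nonneg k]

/-- A pair of defect below `t / k²` has its points near opposite poles, and the defect is at least
the sum of the terms `κ(a - |x|)` of its two points. Each rescaled point then lies in a window
depending on `t` only, uniformly over all configurations `S`. -/
theorem exists_forall_scaled_diam_lt_iff (hE : IsAdmissibleSet E a ν g q) (t : ℝ) :
    ∃ R₀, ∀ R ≥ R₀, ∀ᶠ k in atTop, ∀ S ⊆ goodSet E ν,
      (k ^ 2 * (2 * a - Metric.diam S) < t ↔
        ∃ x ∈ scaleMap a k '' S ∩ rightWindow R, ∃ y ∈ scaleMap a k '' S ∩ leftWindow R,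
          scaledCost a k x y < t) := by
  have ha := hE.pos
  obtain ⟨κ, hκ, x₀, hx₀, hnear⟩ := hE.exists_norm_le_near_poles
  obtain ⟨δ, hδ, hpoles⟩ := hE.exists_near_poles hx₀
  -- The two entries bound the coordinates: `k²(a - |z 0|) ≤ t / κ`, hence `(k * z 1)² ≤ 2a(t / κ)`,
  -- and `|y| ≤ y² + 1` avoids a square root.
  refine ⟨max (t / κ) (2 * a * (t / κ) + 1), fun R hR => ?_⟩
  have hsq : Tendsto (fun k : ℝ => k ^ 2) atTop atTop := tendsto_pow_atTop two_ne_zero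
  filter_upwards [eventually_gt_atTop 0, hsq.eventually_ge_atTop (t / δ),
    hsq.eventually_ge_atTop (t / (2 * a))] with k hk hkδ hka S hS
  have hk2 : 0 < k ^ 2 := by positivity
  have hkδ' : t / k ^ 2 ≤ δ := by
    rw [div_le_iff₀ hδ] at hkδ
    rwa [div_le_iff₀ hk2, mul_comm]
  have hka' : 0 ≤ 2 * a - t / k ^ 2 := by
    rw [div_le_iff₀ (by positivity)] at hka
    rw [sub_nonneg, div_le_iff₀ hk2, mul_comm]
    exact hka
  have hrw : ∀ d : ℝ, k ^ 2 * (2 * a - d) < t ↔ 2 * a - t / k ^ 2 < d := fun d => by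
    rw [← lt_div_iff₀' hk2]
    constructor <;> intro h <;> linarith
  have hbdd : Bornology.IsBounded S :=
    (hE.isCompact.isBounded.subset (goodSet_subset hE)).subset hS
  rw [hrw, lt_diam_iff hbdd hka']
  have hbound : ∀ z ∈ S, x₀ < |z 0| → κ * (a - |z 0|) < t / k ^ 2 →
      scaleMap a k z ∈ Metric.closedBall (0 : ℝ × ℝ) R := by
    intro z hz hz0 hlt
    obtain ⟨h1, -, h3⟩ := hnear z (hS hz) hz0
    have h4 : k ^ 2 * (a - |z 0|) ≤ t / κ := by
      rw [lt_div_iff₀ hk2] at hlt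
      rw [le_div_iff₀ hκ]
      linarith
    have h6 : (k * z 1) ^ 2 ≤ 2 * a * (t / κ) := by
      calc (k * z 1) ^ 2 = k ^ 2 * z 1 ^ 2 := by ring
        _ ≤ k ^ 2 * (2 * a * (a - |z 0|)) := by gcongr
        _ = 2 * a * (k ^ 2 * (a - |z 0|)) := by ring
        _ ≤ _ := by gcongr
    have h7 : |k * z 1| ≤ R := by
      refine le_trans ?_ ((le_max_right _ _).trans hR)
      rw [← sq_abs] at h6
      nlinarith [sq_nonneg (|k * z 1| - 1), abs_nonneg (k * z 1)]
    have h8 : 0 ≤ k ^ 2 * (a - |z 0|) := mul_nonneg hk2.le (by linarith)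
    have h9 := h4.trans ((le_max_left _ _).trans hR)
    rw [mem_closedBall_zero_iff, Prod.norm_def, Real.norm_eq_abs, Real.norm_eq_abs, scaleMap]
    split_ifs with hpos
    · rw [abs_of_pos hpos] at h8 h9
      exact max_le (by rwa [abs_of_nonneg h8]) h7
    · rw [abs_of_nonpos (not_lt.1 hpos)] at h8 h9
      refine max_le ?_ h7
      rw [← abs_neg]
      rw [show -(k ^ 2 * (-a - z 0)) = k ^ 2 * (a - -z 0) by ring]
      rwa [abs_of_nonneg h8]
  constructor
  · rintro ⟨z, hz, w, hw, hzw⟩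
    wlog hpos : 0 < z 0 generalizing z w
    · obtain ⟨h1, h2, h3⟩ := hpoles z (hS hz).1 w (hS hw).1 (by linarith)
      refine this w hw z hz (by rwa [dist_comm]) ?_
      by_contra hcon
      nlinarith [not_lt.1 hpos, not_lt.1 hcon]
    obtain ⟨h1, h2, h3⟩ := hpoles z (hS hz).1 w (hS hw).1 (by linarith)
    have hneg : w 0 < 0 := by
      by_contra hcon
      nlinarith [not_lt.1 hcon]
    obtain ⟨hz1, hz2, -⟩ := hnear z (hS hz) h1
    obtain ⟨hw1, hw2, -⟩ := hnear w (hS hw) h2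
    have hle : dist z w ≤ ‖z‖ + ‖w‖ := by
      rw [dist_eq_norm]
      exact norm_sub_le z w
    have hzp : 0 < κ * (a - |z 0|) := mul_pos hκ (by linarith)
    have hwp : 0 < κ * (a - |w 0|) := mul_pos hκ (by linarith)
    refine ⟨scaleMap a k z, ⟨mem_image_of_mem _ hz, ?_, hbound z hz h1 (by linarith)⟩,
      scaleMap a k w, ⟨mem_image_of_mem _ hw, ?_, hbound w hw h2 (by linarith)⟩, ?_⟩
    · rw [abs_of_pos hpos] at hz1
      rw [mem_ofPred_eq, scaleMap, if_pos hpos]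
      exact mul_pos hk2 (by linarith)
    · rw [abs_of_neg hneg] at hw1
      rw [mem_ofPred_eq, scaleMap, if_neg hneg.le.not_gt]
      exact mul_neg_of_pos_of_neg hk2 (by linarith)
    · rwa [scaledCost_scaleMap hk.ne' hpos hneg, hrw]
  · rintro ⟨_, ⟨⟨z, hz, rfl⟩, hz'⟩, _, ⟨⟨w, hw, rfl⟩, hw'⟩, h⟩
    have hpos := hE.pos_of_scaleMap_fst_pos (hS hz) hz'.1
    have hneg := hE.neg_of_scaleMap_fst_neg (hS hw) hw'.1
    rw [scaledCost_scaleMap hk.ne' hpos hneg, hrw] at h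
    exact ⟨z, hz, w, hw, h⟩

end IsAdmissibleSet

/-! ### Norm-angle sequences and the limiting minimum -/

/-- The pathwise properties of a norm-angle sequence. -/
structure IsRegularSeq (τ : ℝ) (z : ℕ → ℝ × ℝ) : Prop where
  pos : ∀ m, 0 < (z m).1
  sq_le : ∀ m, (z m).2 ^ 2 ≤ τ ^ 2 * (z m).1
  le_succ : ∀ m, (z m).1 ≤ (z (m + 1)).1
  exists_lt : ∀ n : ℕ, ∃ m, (n : ℝ) < (z m).1

theorem measurableSet_isRegularSeq (τ : ℝ) : MeasurableSet {z | IsRegularSeq τ z} := by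
  have h1 : ∀ m, Measurable fun z : ℕ → ℝ × ℝ => (z m).1 := fun m => by fun_prop
  have h2 : ∀ m, Measurable fun z : ℕ → ℝ × ℝ => (z m).2 := fun m => by fun_prop
  have heq : {z | IsRegularSeq τ z} =
      (⋂ m, {z : ℕ → ℝ × ℝ | 0 < (z m).1}) ∩ (⋂ m, {z | (z m).2 ^ 2 ≤ τ ^ 2 * (z m).1}) ∩
        (⋂ m, {z | (z m).1 ≤ (z (m + 1)).1}) ∩ ⋂ n : ℕ, ⋃ m, {z | (n : ℝ) < (z m).1} := by
    ext z
    simp only [mem_ofPred_eq, mem_inter_iff, mem_iInter, mem_iUnion]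
    exact ⟨fun h => ⟨⟨⟨h.1, h.2⟩, h.3⟩, h.4⟩, fun h => ⟨h.1.1.1, h.1.1.2, h.1.2, h.2⟩⟩
  rw [heq]
  refine MeasurableSet.inter (MeasurableSet.inter (MeasurableSet.inter ?_ ?_) ?_) ?_
  · exact .iInter fun m => measurableSet_lt measurable_const (h1 m)
  · exact .iInter fun m => measurableSet_le ((h2 m).pow_const 2) ((h1 m).const_mul _)
  · exact .iInter fun m => measurableSet_le (h1 m) (h1 (m + 1))
  · exact .iInter fun n => .iUnion fun m => measurableSet_lt measurable_const (h1 m)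

/-- The norm-angle sequence built from the interarrival times and the uniform variables. -/
noncomputable def normAngleSeq (σ τ : ℝ) (yu : ℕ → ℝ × ℝ) (m : ℕ) : ℝ × ℝ :=
  (σ * (∑ j ∈ Finset.range (m + 1), (yu j).1) ^ (2 / 3 : ℝ),
    (yu m).2 * τ * σ ^ (1 / 2 : ℝ) * (∑ j ∈ Finset.range (m + 1), (yu j).1) ^ (1 / 3 : ℝ))

theorem measurable_normAngleSeq (σ τ : ℝ) : Measurable (normAngleSeq σ τ) := by
  unfold normAngleSeq
  fun_prop

theorem normAngle_eq_map (σ τ : ℝ) :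
    normAngle σ τ = (Measure.infinitePi fun _ : ℕ => expUnif).map (normAngleSeq σ τ) := rfl

theorem ae_isRegularSeq {σ : ℝ} (hσ : 0 < σ) (τ : ℝ) :
    ∀ᵐ z ∂normAngle σ τ, IsRegularSeq τ z := by
  rw [normAngle_eq_map, ae_map_iff (measurable_normAngleSeq σ τ).aemeasurable
    (measurableSet_isRegularSeq τ)]
  filter_upwards [ae_infinitePi_pos_mem, ae_exists_lt_renewal] with yu h1 h2
  have hs : ∀ m, 0 < ∑ j ∈ Finset.range (m + 1), (yu j).1 := fun m =>
    Finset.sum_pos (fun j _ => (h1 j).1) ⟨0, by simp⟩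
  refine ⟨fun m => ?_, fun m => ?_, fun m => ?_, fun n => ?_⟩
  · exact mul_pos hσ (Real.rpow_pos_of_pos (hs m) _)
  · have e1 : (σ ^ (1 / 2 : ℝ)) ^ 2 = σ := by
      rw [← Real.rpow_natCast, ← Real.rpow_mul hσ.le]
      norm_num
    have e2 : ((∑ j ∈ Finset.range (m + 1), (yu j).1) ^ (1 / 3 : ℝ)) ^ 2 =
        (∑ j ∈ Finset.range (m + 1), (yu j).1) ^ (2 / 3 : ℝ) := by
      rw [← Real.rpow_natCast, ← Real.rpow_mul (hs m).le]
      norm_num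
    simp only [normAngleSeq]
    rw [mul_pow, mul_pow, mul_pow, e1, e2]
    have h3 : (yu m).2 ^ 2 ≤ 1 := pow_le_one₀ (h1 m).2.1 (h1 m).2.2
    have h4 : 0 ≤ τ ^ 2 * (σ * (∑ j ∈ Finset.range (m + 1), (yu j).1) ^ (2 / 3 : ℝ)) :=
      mul_nonneg (sq_nonneg _) (mul_nonneg hσ.le (Real.rpow_nonneg (hs m).le _))
    nlinarith
  · refine mul_le_mul_of_nonneg_left (Real.rpow_le_rpow (hs m).le ?_ (by norm_num)) hσ.le
    rw [Finset.sum_range_succ _ (m + 1)]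
    linarith [(h1 (m + 1)).1]
  · obtain ⟨m, hm⟩ := h2 ((n / σ) ^ (3 / 2 : ℝ))
    refine ⟨m, ?_⟩
    have h3 : (n : ℝ) / σ < (∑ j ∈ Finset.range (m + 1), (yu j).1) ^ (2 / 3 : ℝ) := by
      have h4 := Real.rpow_lt_rpow (by positivity) hm (by norm_num : (0 : ℝ) < 2 / 3)
      rwa [← Real.rpow_mul (by positivity), show (3 / 2 * (2 / 3) : ℝ) = 1 by norm_num,
        Real.rpow_one] at h4
    rw [div_lt_iff₀ hσ] at h3
    simp only [normAngleSeq]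
    linarith

theorem IsRegularSeq.finite_le {τ : ℝ} {z : ℕ → ℝ × ℝ} (hz : IsRegularSeq τ z) (C : ℝ) :
    {m | (z m).1 ≤ C}.Finite := by
  obtain ⟨n, hn⟩ := exists_nat_ge C
  obtain ⟨m, hm⟩ := hz.exists_lt n
  refine (finite_lt_nat m).subset fun l hl => ?_
  by_contra hcon
  have hmono := monotone_nat_of_le_succ (f := fun m => (z m).1) hz.le_succ (not_lt.1 hcon)
  have hl' : (z l).1 ≤ C := hl
  simp only at hmono
  linarith

/-- The first entries are positive and tend to infinity, so only finitely many index pairs have cost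
below a given level and the infimum is attained. -/
theorem isLeast_iInf_of_add_le {τ τ' : ℝ} {z w : ℕ → ℝ × ℝ} (hz : IsRegularSeq τ z)
    (hw : IsRegularSeq τ' w) {c : ℕ × ℕ → ℝ} (hc : ∀ kl : ℕ × ℕ, (z kl.1).1 + (w kl.2).1 ≤ c kl) :
    IsLeast (range c) (⨅ kl, c kl) := by
  have ht : Tendsto c cofinite atTop := by
    refine tendsto_atTop.2 fun C => ?_
    rw [eventually_cofinite]
    refine ((hz.finite_le C).prod (hw.finite_le C)).subset fun kl hkl => ?_
    have h1 : c kl < C := not_le.1 hkl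
    have h2 := hc kl
    have h3 := hz.pos kl.1
    have h4 := hw.pos kl.2
    exact ⟨by change _ ≤ C; linarith, by change _ ≤ C; linarith⟩
  obtain ⟨p, hp⟩ := ht.exists_forall_le
  have hl : IsLeast (range c) (c p) := ⟨mem_range_self p, by rintro _ ⟨r, rfl⟩; exact hp r⟩
  have : ⨅ kl, c kl = c p := hl.csInf_eq
  rwa [this]

theorem isLeast_minPlus {a τ τ' : ℝ} (ha : 0 < a) {z w : ℕ → ℝ × ℝ} (hz : IsRegularSeq τ z)
    (hw : IsRegularSeq τ' w) : IsLeast (range (costPlus a z w)) (minPlus a z w) :=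
  isLeast_iInf_of_add_le hz hw fun kl => by unfold costPlus; simp; positivity

theorem isLeast_minMinus {a τ τ' : ℝ} (ha : 0 < a) {z w : ℕ → ℝ × ℝ} (hz : IsRegularSeq τ z)
    (hw : IsRegularSeq τ' w) : IsLeast (range (costMinus a z w)) (minMinus a z w) :=
  isLeast_iInf_of_add_le hz hw fun kl => by unfold costMinus; simp; positivity

theorem iInf_lt_iff_of_isLeast {ι : Type*} {c : ι → ℝ} {m t : ℝ} (h : IsLeast (range c) m) :
    m < t ↔ ∃ i, c i < t := by
  constructor
  · obtain ⟨i, hi⟩ := h.1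
    exact fun hm => ⟨i, hi ▸ hm⟩
  · rintro ⟨i, hi⟩
    exact (h.2 (mem_range_self i)).trans_lt hi

theorem measurable_minPlus (a : ℝ) :
    Measurable fun p : (ℕ → ℝ × ℝ) × (ℕ → ℝ × ℝ) => minPlus a p.1 p.2 :=
  Measurable.iInf fun kl => by unfold costPlus; fun_prop

theorem measurable_minMinus (a : ℝ) :
    Measurable fun p : (ℕ → ℝ × ℝ) × (ℕ → ℝ × ℝ) => minMinus a p.1 p.2 :=
  Measurable.iInf fun kl => by unfold costMinus; fun_prop

/-- The position of a norm-angle pair of the given quadrant in rescaled coordinates. -/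
noncomputable def limitPoint (a : ℝ) (i : Fin 4) (p : ℝ × ℝ) : ℝ × ℝ :=
  reflect i (p.1 + (a * p.2) ^ 2 / (2 * a), a * p.2)

theorem measurable_limitPoint (a : ℝ) (i : Fin 4) : Measurable (limitPoint a i) :=
  (reflect i).measurable.comp (by fun_prop)

/-- The points of four norm-angle sequences in rescaled coordinates. -/
def limitSet (a : ℝ) (z : Fin 4 → ℕ → ℝ × ℝ) : Set (ℝ × ℝ) :=
  ⋃ i, range fun m => limitPoint a i (z i m)

/-- The smallest cost over all four pairs of quadrants at different poles. -/
noncomputable def minCost (a : ℝ) (z : Fin 4 → ℕ → ℝ × ℝ) : ℝ :=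
  min (min (minPlus a (z 0) (z 1)) (minMinus a (z 0) (z 2)))
    (min (minMinus a (z 1) (z 3)) (minPlus a (z 2) (z 3)))

theorem measurable_minCost (a : ℝ) : Measurable (minCost a) := by
  have h : ∀ i j, Measurable fun z : Fin 4 → ℕ → ℝ × ℝ => (z i, z j) := fun i j => by fun_prop
  exact (((measurable_minPlus a).comp (h 0 1)).min ((measurable_minMinus a).comp (h 0 2))).min
    (((measurable_minMinus a).comp (h 1 3)).min ((measurable_minPlus a).comp (h 2 3)))

/-- To leading order `a - ‖z‖` is `(a - |x|) - y² / (2a)`, so a norm-angle pair has first coordinate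
`p.1 + v² / (2a)` with `v = a * p.2`. The cost then combines by `v² / (2a) + w² / (2a) - (v - w)² /
(4a) = (v + w)² / (4a)`. -/
theorem limitCost_limitPoint {a : ℝ} {i j : Fin 4} (hi : hsign i = 1)
    (hj : hsign j = -1) (p r : ℝ × ℝ) :
    limitCost a (limitPoint a i p) (limitPoint a j r) =
      p.1 + r.1 + a / 4 * (vsign i * p.2 + vsign j * r.2) ^ 2 := by
  have h1 := vsign_sq i
  have h2 := vsign_sq j
  simp only [limitCost, limitPoint, reflect_apply, hi, hj]
  field_simp
  linear_combination (-4 * p.2 ^ 2 * a) * h1 + (-4 * r.2 ^ 2 * a) * h2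

theorem minCost_lt_iff {a : ℝ} (ha : 0 < a) {τ : Fin 4 → ℝ} {z : Fin 4 → ℕ → ℝ × ℝ}
    (hz : ∀ i, IsRegularSeq (τ i) (z i)) (t : ℝ) :
    minCost a z < t ↔ ∃ i j, hsign i = 1 ∧ hsign j = -1 ∧ ∃ k l,
      limitCost a (limitPoint a i (z i k)) (limitPoint a j (z j l)) < t := by
  rw [minCost, min_lt_iff, min_lt_iff, min_lt_iff,
    iInf_lt_iff_of_isLeast (isLeast_minPlus ha (hz 0) (hz 1)),
    iInf_lt_iff_of_isLeast (isLeast_minMinus ha (hz 0) (hz 2)),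
    iInf_lt_iff_of_isLeast (isLeast_minMinus ha (hz 1) (hz 3)),
    iInf_lt_iff_of_isLeast (isLeast_minPlus ha (hz 2) (hz 3))]
  have key : ∀ i j, hsign i = 1 → hsign j = -1 → ∀ k l,
      limitCost a (limitPoint a i (z i k)) (limitPoint a j (z j l)) =
      (z i k).1 + (z j l).1 + a / 4 * (vsign i * (z i k).2 + vsign j * (z j l).2) ^ 2 :=
    fun i j hi hj k l => limitCost_limitPoint hi hj _ _
  constructor
  · rintro ((⟨⟨k, l⟩, h⟩ | ⟨⟨k, l⟩, h⟩) | (⟨⟨k, l⟩, h⟩ | ⟨⟨k, l⟩, h⟩))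
    · refine ⟨0, 1, by simp [hsign], by simp [hsign], k, l, ?_⟩
      rw [key 0 1 (by simp [hsign]) (by simp [hsign])]
      simpa [vsign, costPlus] using h
    · refine ⟨0, 2, by simp [hsign], by simp [hsign], k, l, ?_⟩
      rw [key 0 2 (by simp [hsign]) (by simp [hsign])]
      simpa [vsign, costMinus, ← sub_eq_add_neg] using h
    -- The right-hand quadrant must come first in `limitCost`, whereas this minimum lists the
    -- left-hand one first; hence the swapped indices.
    · refine ⟨3, 1, by simp [hsign], by simp [hsign], l, k, ?_⟩
      rw [key 3 1 (by simp [hsign]) (by simp [hsign])]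
      refine lt_of_eq_of_lt ?_ h
      simp [vsign, costMinus]
      ring
    · refine ⟨3, 2, by simp [hsign], by simp [hsign], l, k, ?_⟩
      rw [key 3 2 (by simp [hsign]) (by simp [hsign])]
      refine lt_of_eq_of_lt ?_ h
      simp [vsign, costPlus]
      ring
  · rintro ⟨i, j, hi, hj, k, l, h⟩
    rw [key i j hi hj] at h
    have hi' : i = 0 ∨ i = 3 := by
      fin_cases i <;> simp [hsign] at hi ⊢ <;> norm_num at hi
    have hj' : j = 1 ∨ j = 2 := by
      fin_cases j <;> simp [hsign] at hj ⊢ <;> norm_num at hj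
    rcases hi' with rfl | rfl <;> rcases hj' with rfl | rfl
    · exact .inl (.inl ⟨(k, l), by simpa [vsign, costPlus] using h⟩)
    · exact .inl (.inr ⟨(k, l), by simpa [vsign, costMinus, ← sub_eq_add_neg] using h⟩)
    · refine .inr (.inl ⟨(l, k), lt_of_eq_of_lt ?_ h⟩)
      simp [vsign, costMinus]
      ring
    · refine .inr (.inr ⟨(l, k), lt_of_eq_of_lt ?_ h⟩)
      simp [vsign, costPlus]
      ring

/-- A cost below `t` forces both first entries below `t`, and `IsRegularSeq.sq_le` then bounds the
second entries. The window depends only on `t`, `a` and `τ`, not on the sequences. -/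
theorem exists_forall_minCost_lt_iff {a : ℝ} (ha : 0 < a) (τ : Fin 4 → ℝ) (t : ℝ) :
    ∃ R₀, ∀ R ≥ R₀, ∀ z : Fin 4 → ℕ → ℝ × ℝ, (∀ i, IsRegularSeq (τ i) (z i)) →
      (minCost a z < t ↔ ∃ x ∈ limitSet a z ∩ rightWindow R, ∃ y ∈ limitSet a z ∩ leftWindow R,
        limitCost a x y < t) := by
  set B : ℝ := ∑ i, τ i ^ 2 with hB
  have hB0 : 0 ≤ B := Finset.sum_nonneg fun i _ => sq_nonneg _
  refine ⟨max (t + a / 2 * (B * t)) (a * (B * t + 1)), fun R hR z hz => ?_⟩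
  rw [minCost_lt_iff ha hz]
  have hbound : ∀ i m, (z i m).1 < t →
      limitPoint a i (z i m) ∈ Metric.closedBall (0 : ℝ × ℝ) R := by
    intro i m hm
    have h1 := (hz i).sq_le m
    have h2 := (hz i).pos m
    have hτ : τ i ^ 2 ≤ B := Finset.single_le_sum (f := fun i => τ i ^ 2)
      (fun i _ => sq_nonneg _) (Finset.mem_univ i)
    have h3 : (z i m).2 ^ 2 ≤ B * t := h1.trans (by gcongr)
    have h4 : |(z i m).2| ≤ B * t + 1 := by
      rw [← sq_abs] at h3
      nlinarith [sq_nonneg (|(z i m).2| - 1), abs_nonneg (z i m).2]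
    rw [mem_closedBall_zero_iff, Prod.norm_def, limitPoint, reflect_apply, norm_mul, norm_mul,
      Real.norm_eq_abs, Real.norm_eq_abs, Real.norm_eq_abs, Real.norm_eq_abs, abs_hsign, abs_vsign,
      one_mul, one_mul]
    refine max_le (le_trans ?_ ((le_max_left _ _).trans hR))
      (le_trans ?_ ((le_max_right _ _).trans hR))
    · rw [abs_of_nonneg (by positivity)]
      have : (a * (z i m).2) ^ 2 / (2 * a) = a / 2 * (z i m).2 ^ 2 := by field_simp
      rw [this]
      exact add_le_add hm.le (mul_le_mul_of_nonneg_left h3 (by positivity))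
    · rw [abs_mul, abs_of_pos ha]
      exact mul_le_mul_of_nonneg_left h4 ha.le
  have hfst : ∀ i m, (limitPoint a i (z i m)).1 =
      hsign i * ((z i m).1 + (a * (z i m).2) ^ 2 / (2 * a)) := fun i m => rfl
  have hpos : ∀ i m, 0 < (z i m).1 + (a * (z i m).2) ^ 2 / (2 * a) := fun i m => by
    have := (hz i).pos m
    positivity
  constructor
  · rintro ⟨i, j, hi, hj, k, l, h⟩
    have h' := h
    rw [limitCost_limitPoint hi hj] at h'
    have hk := (hz i).pos k
    have hl := (hz j).pos l
    have h0 : 0 ≤ a / 4 * (vsign i * (z i k).2 + vsign j * (z j l).2) ^ 2 := by positivity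
    refine ⟨_, ⟨mem_iUnion.2 ⟨i, mem_range_self k⟩, ?_, hbound i k (by linarith)⟩, _,
      ⟨mem_iUnion.2 ⟨j, mem_range_self l⟩, ?_, hbound j l (by linarith)⟩, h⟩
    · rw [mem_ofPred_eq, hfst, hi, one_mul]
      exact hpos i k
    · rw [mem_ofPred_eq, hfst, hj, neg_one_mul, neg_lt_zero]
      exact hpos j l
  · rintro ⟨x, ⟨hx, hx', -⟩, y, ⟨hy, hy', -⟩, h⟩
    obtain ⟨i, k, rfl⟩ := mem_iUnion.1 hx
    obtain ⟨j, l, rfl⟩ := mem_iUnion.1 hy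
    simp only [mem_ofPred_eq, hfst] at hx' hy'
    have hi := pos_of_mul_pos_left hx' (hpos i k).le
    have hj : hsign j < 0 := by
      by_contra hcon
      exact absurd hy' (not_lt.2 (mul_nonneg (not_lt.1 hcon) (hpos j l).le))
    have hi' := abs_hsign i
    have hj' := abs_hsign j
    rw [abs_of_pos hi] at hi'
    rw [abs_of_neg hj] at hj'
    exact ⟨i, j, hi', by linarith, k, l, h⟩

/-! ### Matching the constants and the void probabilities of the limit -/

/-- Collecting the `v²` terms gives the factor `1 + κ / (2a) = 4 / (4 - q²)`, which turns the
inequality into `4v² < q² * 2au`. By `tauConst_sq`, this `κ` is `(aτ)²`. -/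
theorem arrivalRegion_eq_parabolaRegion {a q : ℝ} (ha : 0 < a) (hq : q ∈ Ioo (0 : ℝ) 2) :
    arrivalRegion a (2 * a * q ^ 2 / (4 - q ^ 2)) = parabolaRegion a q := by
  have h4 : 0 < 4 - q ^ 2 := by nlinarith [hq.1, hq.2]
  ext x
  have hiff : x.2 ^ 2 < 2 * a * q ^ 2 / (4 - q ^ 2) * (x.1 - x.2 ^ 2 / (2 * a)) ↔
      4 * x.2 ^ 2 < q ^ 2 * (2 * a * x.1) := by
    have : 2 * a * q ^ 2 / (4 - q ^ 2) * (x.1 - x.2 ^ 2 / (2 * a)) =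
        (2 * a * q ^ 2 * x.1 - q ^ 2 * x.2 ^ 2) / (4 - q ^ 2) := by
      field_simp
    rw [this, lt_div_iff₀ h4]
    constructor <;> intro h <;> linarith
  simp only [arrivalRegion, parabolaRegion, mem_ofPred_eq, hiff]
  constructor
  · rintro ⟨h2, h⟩
    have h1 : 0 < 2 * a * x.1 := by
      by_contra hcon
      nlinarith [sq_pos_of_pos h2, sq_nonneg q, not_lt.1 hcon,
        mul_nonneg (sq_nonneg q) (neg_nonneg.2 (not_lt.1 hcon))]
    refine ⟨by nlinarith, h2, ?_⟩
    refine lt_of_pow_lt_pow_left₀ 2 (by have := hq.1; positivity) ?_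
    rw [mul_pow, div_pow, Real.sq_sqrt h1.le]
    linarith
  · rintro ⟨h1, h2, h⟩
    refine ⟨h2, ?_⟩
    have h3 := pow_lt_pow_left₀ h h2.le two_ne_zero
    rw [mul_pow, div_pow, Real.sq_sqrt (by positivity)] at h3
    linarith

theorem capConst_pos {a q : ℝ} (ha : 0 < a) (hq : q ∈ Ioo (0 : ℝ) 2) : 0 < capConst a q := by
  have h4 : 0 < 4 - q ^ 2 := by nlinarith [hq.1, hq.2]
  have := hq.1
  unfold capConst
  positivity

theorem sigmaConst_pos {a q p : ℝ} (ha : 0 < a) (hq : q ∈ Ioo (0 : ℝ) 2) (hp : 0 < p) :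
    0 < sigmaConst a q p :=
  Real.rpow_pos_of_pos (mul_pos hp (capConst_pos ha hq)) _

theorem tauConst_sq {a q : ℝ} (ha : 0 < a) (hq : q ∈ Ioo (0 : ℝ) 2) :
    (a * tauConst a q) ^ 2 = 2 * a * q ^ 2 / (4 - q ^ 2) := by
  have h4 : 0 < 4 - q ^ 2 := by nlinarith [hq.1, hq.2]
  have : a * tauConst a q = q * √(2 * a) / √(4 - q ^ 2) := by
    unfold tauConst capConst
    field_simp
  rw [this, div_pow, mul_pow, Real.sq_sqrt h4.le, Real.sq_sqrt (by positivity)]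
  ring

/-- The reciprocal Jacobian of `arrivalMap` must be the density at the pole. It is, because `σ^(3/2)
= (pc)⁻¹` and `aτ = 3c / 2`. -/
theorem two_thirds_mul_sigmaConst {a q p : ℝ} (ha : 0 < a) (hq : q ∈ Ioo (0 : ℝ) 2)
    (hp : 0 < p) :
    (2 / 3 * sigmaConst a q p * (a * tauConst a q * sigmaConst a q p ^ (1 / 2 : ℝ)))⁻¹ = p := by
  have hc := capConst_pos ha hq
  have hpc := mul_pos hp hc
  have h1 : sigmaConst a q p * sigmaConst a q p ^ (1 / 2 : ℝ) = (p * capConst a q)⁻¹ := by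
    rw [sigmaConst, ← Real.rpow_mul hpc.le, ← Real.rpow_add hpc, ← Real.rpow_neg_one]
    norm_num
  have h2 : 2 / 3 * sigmaConst a q p * (a * tauConst a q * sigmaConst a q p ^ (1 / 2 : ℝ)) =
      2 / 3 * (a * tauConst a q) * (sigmaConst a q p * sigmaConst a q p ^ (1 / 2 : ℝ)) := by ring
  rw [h2, h1, tauConst]
  field_simp

theorem limitPoint_normAngleSeq {a σ τ : ℝ} (i : Fin 4) {yu : ℕ → ℝ × ℝ}
    (h : ∀ j, 0 < (yu j).1 ∧ (yu j).2 ∈ Icc (0 : ℝ) 1) (m : ℕ) :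
    limitPoint a i (normAngleSeq σ τ yu m) =
      reflect i (arrivalMap a σ (a * τ * σ ^ (1 / 2 : ℝ)) (renewalPoint 0 yu m)) := by
  have hs : 0 ≤ ∑ j ∈ Finset.range (m + 1), (yu j).1 := Finset.sum_nonneg fun j _ => (h j).1.le
  have e2 : (∑ j ∈ Finset.range (m + 1), (yu j).1) ^ (2 / 3 : ℝ) =
      ((∑ j ∈ Finset.range (m + 1), (yu j).1) ^ (1 / 3 : ℝ)) ^ 2 := by
    rw [← Real.rpow_natCast, ← Real.rpow_mul hs]
    norm_num
  rw [limitPoint, normAngleSeq, arrivalMap, renewalPoint]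
  simp only [zero_add, e2]
  congr 1
  ext
  · simp only [add_right_inj]
    ring
  · simp only
    ring

theorem measurableSet_forall_limitPoint_notMem (a : ℝ) (i : Fin 4) {C : Set (ℝ × ℝ)}
    (hC : MeasurableSet C) : MeasurableSet {z : ℕ → ℝ × ℝ | ∀ m, limitPoint a i (z m) ∉ C} := by
  rw [ofPred_forall]
  exact .iInter fun m => ((measurable_limitPoint a i).comp (measurable_pi_apply m)) hC.compl

/-- The void probabilities of a norm-angle sequence in rescaled coordinates. -/
theorem normAngle_void {a q p : ℝ} (ha : 0 < a) (hq : q ∈ Ioo (0 : ℝ) 2) (hp : 0 < p) (i : Fin 4)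
    {C : Set (ℝ × ℝ)} (hC : MeasurableSet C) (hCb : Bornology.IsBounded C) :
    (normAngle (sigmaConst a q p) (tauConst a q)).real {z | ∀ m, limitPoint a i (z m) ∉ C} =
      Real.exp (-(p * volume.real (reflect i ⁻¹' C ∩ parabolaRegion a q))) := by
  have hσ := sigmaConst_pos ha hq hp
  have hτ : 0 < tauConst a q := by
    have := capConst_pos ha hq
    unfold tauConst
    positivity
  set σ := sigmaConst a q p with hσdef
  set τ := tauConst a q with hτdef
  set β := a * τ * σ ^ (1 / 2 : ℝ) with hβdef
  have hβ : 0 < β := by positivity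
  set B := arrivalMap a σ β ⁻¹' (reflect i ⁻¹' C) with hBdef
  have hBm : MeasurableSet B :=
    measurable_arrivalMap a σ β ((reflect i).measurable hC)
  have hA := measurableSet_forall_limitPoint_notMem a i hC
  have hae : normAngleSeq σ τ ⁻¹' {z | ∀ m, limitPoint a i (z m) ∉ C}
      =ᵐ[Measure.infinitePi fun _ : ℕ => expUnif] voidEvent B 0 := by
    filter_upwards [ae_infinitePi_pos_mem] with yu hyu
    refine propext (forall_congr' fun m => ?_)
    rw [limitPoint_normAngleSeq i hyu m]
    rfl
  obtain ⟨R, hR⟩ := hCb.subset_closedBall 0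
  -- A bounded target bounds the arrival time through `σ s^(2/3) ≤ |R|`; the added `1` makes the
  -- inequality strict.
  have hBT : ∀ x ∈ B, x.1 < (|R| / σ + 1) ^ (3 / 2 : ℝ) := by
    intro x hx
    have h1 := hR hx
    rw [mem_closedBall_zero_iff, Prod.norm_def] at h1
    have h2 := (le_max_left _ _).trans h1
    rw [reflect_apply, norm_mul, Real.norm_eq_abs, abs_hsign, one_mul] at h2
    rcases le_or_gt x.1 0 with h0 | h0
    · exact h0.trans_lt (by positivity)
    have h3 : σ * (x.1 ^ (1 / 3 : ℝ)) ^ 2 ≤ |R| := by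
      refine le_trans (le_trans ?_ (le_abs_self _)) (h2.trans (le_abs_self R))
      rw [arrivalMap]
      simp only [le_add_iff_nonneg_right]
      positivity
    have h4 : (x.1 ^ (1 / 3 : ℝ)) ^ 2 < |R| / σ + 1 := by
      have : (x.1 ^ (1 / 3 : ℝ)) ^ 2 ≤ |R| / σ := by
        rw [le_div_iff₀ hσ]
        linarith
      linarith
    rw [← Real.rpow_natCast, ← Real.rpow_mul h0.le] at h4
    have h5 := Real.rpow_lt_rpow (by positivity) h4 (by norm_num : (0 : ℝ) < 3 / 2)
    rw [← Real.rpow_mul h0.le] at h5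
    norm_num at h5
    norm_num
    exact h5
  have hκ : (0 : ℝ) < (a * τ) ^ 2 := by positivity
  have hβσ : β ^ 2 = (a * τ) ^ 2 * σ := by
    rw [hβdef, mul_pow, ← Real.rpow_natCast (σ ^ (1 / 2 : ℝ)), ← Real.rpow_mul hσ.le]
    norm_num
  rw [normAngle_eq_map, measureReal_def, Measure.map_apply (measurable_normAngleSeq σ τ) hA,
    measure_congr hae, ← measureReal_def, measure_voidEvent hBm (by positivity) hBT, hBdef,
    volume_preimage_arrivalMap ha hσ hβ hκ hβσ ((reflect i).measurable hC),
    tauConst_sq ha hq, arrivalRegion_eq_parabolaRegion ha hq, two_thirds_mul_sigmaConst ha hq hp]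

theorem disjoint_limitSet_iff {a : ℝ} {z : Fin 4 → ℕ → ℝ × ℝ} {C : Set (ℝ × ℝ)} :
    Disjoint (limitSet a z) C ↔ ∀ i, z i ∈ {z : ℕ → ℝ × ℝ | ∀ m, limitPoint a i (z m) ∉ C} := by
  rw [limitSet, disjoint_iUnion_left]
  simp only [Set.disjoint_left, forall_mem_range, mem_ofPred_eq]

theorem setOf_disjoint_limitSet {Ω : Type*} (Z : Fin 4 → Ω → ℕ → ℝ × ℝ) (a : ℝ) (C : Set (ℝ × ℝ)) :
    {ω | Disjoint (limitSet a fun i => Z i ω) C} =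
      ⋂ i ∈ Finset.univ, Z i ⁻¹' {z : ℕ → ℝ × ℝ | ∀ m, limitPoint a i (z m) ∉ C} := by
  ext ω
  simp only [mem_ofPred_eq, disjoint_limitSet_iff, mem_iInter, mem_preimage, Finset.mem_univ,
    forall_const]

section

variable {Ω' : Type*} [MeasurableSpace Ω'] {μ' : Measure Ω'}
  {Z : Fin 4 → Ω' → ℕ → ℝ × ℝ} {a : ℝ} {q p : Fin 4 → ℝ}

theorem nullMeasurableSet_disjoint_limitSet (hZ : ∀ i, AEMeasurable (Z i) μ') {C : Set (ℝ × ℝ)}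
    (hC : MeasurableSet C) : NullMeasurableSet {ω | Disjoint (limitSet a fun i => Z i ω) C} μ' := by
  rw [setOf_disjoint_limitSet]
  exact Finset.nullMeasurableSet_biInter _ fun i _ =>
    (hZ i).nullMeasurable (measurableSet_forall_limitPoint_notMem a i hC)

/-- Independence multiplies the void probabilities of the four sequences, so the exponents add up to
the total limiting intensity of `C`. -/
theorem measure_disjoint_limitSet (ha : 0 < a) (hq : ∀ i, q i ∈ Ioo (0 : ℝ) 2) (hp : ∀ i, 0 < p i)
    (hZ : ∀ i, HasLaw (Z i) (normAngle (sigmaConst a (q i) (p i)) (tauConst a (q i))) μ')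
    (hindep : iIndepFun Z μ') {C : Set (ℝ × ℝ)} (hC : MeasurableSet C)
    (hCb : Bornology.IsBounded C) :
    μ'.real {ω | Disjoint (limitSet a fun i => Z i ω) C} =
      Real.exp (-∑ i, p i * volume.real (reflect i ⁻¹' C ∩ parabolaRegion a (q i))) := by
  rw [setOf_disjoint_limitSet, measureReal_def, hindep.measure_inter_preimage_eq_mul Finset.univ
    (fun i _ => measurableSet_forall_limitPoint_notMem a i hC), ENNReal.toReal_prod,
    ← Finset.sum_neg_distrib, Real.exp_sum]
  refine Finset.prod_congr rfl fun i _ => ?_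
  rw [← normAngle_void ha (hq i) (hp i) i hC hCb, ← (hZ i).map_eq, measureReal_def,
    Measure.map_apply_of_aemeasurable (hZ i).aemeasurable
      (measurableSet_forall_limitPoint_notMem a i hC)]

end

/-! ### Convergence of the rescaled diameter -/

variable {P : Measure Plane} {f : Plane → ℝ} {E : Set Plane} {a ν : ℝ} {g : Fin 4 → ℝ → ℝ}
  {q : Fin 4 → ℝ}

theorem disjoint_image_inter_iff {α β : Type*} {φ : α → β} {S B : Set α} {C : Set β}
    (hS : S ⊆ B) : Disjoint (φ '' S) C ↔ Disjoint S (B ∩ φ ⁻¹' C) := by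
  simp only [Set.disjoint_left, forall_mem_image, mem_inter_iff, mem_preimage, not_and]
  exact ⟨fun h z hz _ => h hz, fun h z hz => h hz (hS hz)⟩

theorem ae_disjoint_image_support_iff {Ω : Type*} [MeasurableSpace Ω] {μ : Measure Ω}
    {Φ : Ω → Measure Plane} {B : Set Plane} (hgood : ∀ᵐ ω ∂μ, IsGoodConfiguration (Φ ω) B)
    (φ : Plane → ℝ × ℝ) (C : Set (ℝ × ℝ)) :
    {ω | Disjoint (φ '' (Φ ω).support) C} =ᵐ[μ] {ω | Φ ω (B ∩ φ ⁻¹' C) = 0} := by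
  filter_upwards [hgood] with ω hω
  have := hω.isFiniteMeasure
  refine propext ?_
  change Disjoint (φ '' (Φ ω).support) C ↔ Φ ω (B ∩ φ ⁻¹' C) = 0
  rw [disjoint_image_inter_iff hω.support_subset, disjoint_support_iff hω.counting]

theorem IsAdmissibleDensity.poleDensity_pos (hf : IsAdmissibleDensity P f E a) (i : Fin 4) :
    0 < poleDensity f a i := by
  have h1 := hf.pos_right
  have h2 := hf.pos_left
  fin_cases i <;> simpa [poleDensity]

theorem tendstoInDistribution_scaled_diam [IsProbabilityMeasure P]
    (hE : IsAdmissibleSet E a ν g q) (hf : IsAdmissibleDensity P f E a)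
    {Ω : ℕ → Type*} [∀ n, MeasurableSpace (Ω n)] {μ : ∀ n, Measure (Ω n)}
    [∀ n, IsProbabilityMeasure (μ n)] {Φ : ∀ n, Ω n → Measure Plane}
    (hΦ : ∀ n : ℕ, IsPoissonProcess (Φ n) ((n : ℝ≥0∞) • P) (μ n))
    {Ω' : Type*} [MeasurableSpace Ω'] {μ' : Measure Ω'} [IsProbabilityMeasure μ']
    {Z : Fin 4 → Ω' → ℕ → ℝ × ℝ}
    (hZ : ∀ i, HasLaw (Z i)
      (normAngle (sigmaConst a (q i) (poleDensity f a i)) (tauConst a (q i))) μ')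
    (hindep : iIndepFun Z μ')
    (hreg : ∀ᵐ ω ∂μ', ∀ i, IsRegularSeq (tauConst a (q i)) (Z i ω)) :
    TendstoInDistribution
      (fun (n : ℕ) (ω : Ω n) =>
        (n : ℝ) ^ (2 / 3 : ℝ) * (2 * a - Metric.diam (Φ n ω).support))
      atTop (fun ω => minCost a fun i => Z i ω) μ μ' := by
  have ha := hE.pos
  have hgm := measurableSet_goodSet E ν
  have hfin : ∀ n : ℕ, IsFiniteMeasure ((n : ℝ≥0∞) • P) := fun n =>
    P.smul_finite (ENNReal.natCast_ne_top n)
  have hgood : ∀ n, ∀ᵐ ω ∂μ n, IsGoodConfiguration (Φ n ω) (goodSet E ν) := fun n =>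
    (hΦ n).ae_isGoodConfiguration hgm (by simp [hf.goodSet_compl_null hE])
  have hgb : Bornology.IsBounded (goodSet E ν) := hE.isCompact.isBounded.subset (goodSet_subset hE)
  -- With this `k`, the intensity factor `n` is `k³`, the reciprocal Jacobian of the unscaling, and
  -- the normalisation `n^(2/3)` is `k²`.
  set k : ℕ → ℝ := fun n => (n : ℝ) ^ (1 / 3 : ℝ) with hk
  have hk2 : ∀ n : ℕ, (n : ℝ) ^ (2 / 3 : ℝ) = k n ^ 2 := fun n => by
    simp only [hk]
    rw [← Real.rpow_natCast, ← Real.rpow_mul n.cast_nonneg]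
    norm_num
  have hk3 : ∀ n : ℕ, (n : ℝ) = k n ^ 3 := fun n => by
    simp only [hk]
    rw [← Real.rpow_natCast, ← Real.rpow_mul n.cast_nonneg]
    norm_num
  have hktop : Tendsto k atTop atTop :=
    (tendsto_rpow_atTop (by norm_num)).comp tendsto_natCast_atTop_atTop
  refine tendstoInDistribution_of_levy
    (fun n => (aemeasurable_const.sub ((hΦ n).aemeasurable_diam_support hgb (hgood n))).const_mul _)
    ((measurable_minCost a).comp_aemeasurable (aemeasurable_pi_lambda _ fun i => (hZ i).aemeasurable))
    fun t η hη => ?_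
  obtain ⟨R₁, hR₁⟩ := hE.exists_forall_scaled_diam_lt_iff t
  obtain ⟨R₂, hR₂⟩ := exists_forall_minCost_lt_iff ha (fun i => tauConst a (q i)) (t + η)
  obtain ⟨R₃, hR₃⟩ := exists_forall_minCost_lt_iff ha (fun i => tauConst a (q i)) (t - η)
  -- One window has to serve the diameter at level `t` and the limit at the levels `t + η` and `t -
  -- η`.
  set R := max R₁ (max R₂ R₃) with hR
  have hbdd : ∀ C ⊆ rightWindow R ∪ leftWindow R, Bornology.IsBounded C := fun C hC =>
    Metric.isBounded_closedBall.subset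
      (hC.trans (union_subset inter_subset_right inter_subset_right) :
        C ⊆ Metric.closedBall (0 : ℝ × ℝ) R)
  have hNm : ∀ n C, MeasurableSet C →
      MeasurableSet {ω | Φ n ω (goodSet E ν ∩ scaleMap a (k n) ⁻¹' C) = 0} := fun n C hC =>
    (hΦ n).measurable_apply (hgm.inter (measurable_scaleMap a _ hC)) (measurableSet_singleton 0)
  have hlevy := eventually_levy_of_tendsto_void (μ := μ) (μ' := μ')
    (N := fun n ω => scaleMap a (k n) '' (Φ n ω).support)
    (N' := fun ω => limitSet a fun i => Z i ω)
    (totallyBounded_rightWindow R) (totallyBounded_leftWindow R)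
    (measurableSet_rightWindow R) (measurableSet_leftWindow R)
    (fun n C hC _ => (hNm n C hC).nullMeasurableSet.congr
      (ae_disjoint_image_support_iff (hgood n) _ C).symm)
    (fun C hC _ => nullMeasurableSet_disjoint_limitSet (fun i => (hZ i).aemeasurable) hC)
    -- Both void probabilities are exponentials of minus an intensity, so their convergence reduces
    -- to that of the rescaled intensity measures.
    (fun C hC hCs => by
      rw [measure_disjoint_limitSet ha hE.q_mem hf.poleDensity_pos hZ hindep hC (hbdd C hCs)]
      have h := ((hf.tendsto_scaled_measure hE hC (hbdd C hCs)).comp hktop).neg.rexp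
      refine h.congr fun n => ?_
      rw [measureReal_congr (ae_disjoint_image_support_iff (hgood n) _ C),
        (hΦ n).measure_eq_zero (hgm.inter (measurable_scaleMap a _ hC)) (measure_ne_top _ _),
        measureReal_ennreal_smul_apply, ENNReal.toReal_natCast, Function.comp_apply, ← hk3])
    (uniformContinuousOn_limitCost a R)
    (fun ε hε => hktop.eventually (tendsto_scaledCost ha R hε)) t hη
  have hlim : ∀ s, (∀ z : Fin 4 → ℕ → ℝ × ℝ, (∀ i, IsRegularSeq (tauConst a (q i)) (z i)) →
      (minCost a z < s ↔ ∃ x ∈ limitSet a z ∩ rightWindow R, ∃ y ∈ limitSet a z ∩ leftWindow R,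
        limitCost a x y < s)) →
      μ'.real {ω | ∃ x ∈ (limitSet a fun i => Z i ω) ∩ rightWindow R,
        ∃ y ∈ (limitSet a fun i => Z i ω) ∩ leftWindow R, limitCost a x y < s} =
      μ'.real {ω | minCost a (fun i => Z i ω) < s} := fun s hs => by
    refine measureReal_congr ?_
    filter_upwards [hreg] with ω hω
    exact propext (hs _ hω).symm
  rw [hlim _ (hR₂ R (le_trans (le_max_left _ _) (le_max_right _ _))),
    hlim _ (hR₃ R (le_trans (le_max_right _ _) (le_max_right _ _)))] at hlevy
  filter_upwards [hlevy, hktop.eventually (hR₁ R (le_max_left _ _))] with n hn hn'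
  have heq : (μ n).real {ω | (n : ℝ) ^ (2 / 3 : ℝ) * (2 * a - Metric.diam (Φ n ω).support) < t} =
      (μ n).real {ω | ∃ x ∈ scaleMap a (k n) '' (Φ n ω).support ∩ rightWindow R,
        ∃ y ∈ scaleMap a (k n) '' (Φ n ω).support ∩ leftWindow R, scaledCost a (k n) x y < t} := by
    refine measureReal_congr ?_
    filter_upwards [hgood n] with ω hω
    refine propext ?_
    change _ * _ < t ↔ _
    rw [hk2, hn' _ hω.support_subset]
    rfl
  rwa [heq]

end PlanarDiameter

theorem theorem1
    -- the distribution of one point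
    (P : Measure Plane) [IsProbabilityMeasure P] (f : Plane → ℝ)
    (E : Set Plane) (a ν : ℝ) (g : Fin 4 → ℝ → ℝ) (q : Fin 4 → ℝ)
    (hE : IsAdmissibleSet E a ν g q) (hf : IsAdmissibleDensity P f E a)
    -- the Poisson processes with intensity measures `n P`
    {Ω : ℕ → Type*} [∀ n, MeasurableSpace (Ω n)] (μ : ∀ n, Measure (Ω n))
    [∀ n, IsProbabilityMeasure (μ n)] (Φ : ∀ n, Ω n → Measure Plane)
    (hΦ : ∀ n : ℕ, IsPoissonProcess (Φ n) ((n : ℝ≥0∞) • P) (μ n))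
    -- the independent norm-angle sequences
    {Ω' : Type*} [MeasurableSpace Ω'] (μ' : Measure Ω') [IsProbabilityMeasure μ']
    (Z : Fin 4 → Ω' → ℕ → ℝ × ℝ)
    (hZ : ∀ i, HasLaw (Z i)
      (normAngle (sigmaConst a (q i) (poleDensity f a i)) (tauConst a (q i))) μ')
    (hindep : iIndepFun Z μ') :
    -- the four minima are attained almost surely
    (∀ᵐ ω ∂μ',
      IsLeast (Set.range (costPlus a (Z 0 ω) (Z 1 ω))) (minPlus a (Z 0 ω) (Z 1 ω)) ∧
      IsLeast (Set.range (costMinus a (Z 0 ω) (Z 2 ω))) (minMinus a (Z 0 ω) (Z 2 ω)) ∧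
      IsLeast (Set.range (costMinus a (Z 1 ω) (Z 3 ω))) (minMinus a (Z 1 ω) (Z 3 ω)) ∧
      IsLeast (Set.range (costPlus a (Z 2 ω) (Z 3 ω))) (minPlus a (Z 2 ω) (Z 3 ω))) ∧
    TendstoInDistribution
      (fun (n : ℕ) (ω : Ω n) =>
        (n : ℝ) ^ (2 / 3 : ℝ) * (2 * a - Metric.diam (Φ n ω).support))
      atTop
      (fun ω => min (min (minPlus a (Z 0 ω) (Z 1 ω)) (minMinus a (Z 0 ω) (Z 2 ω)))
        (min (minMinus a (Z 1 ω) (Z 3 ω)) (minPlus a (Z 2 ω) (Z 3 ω))))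
      μ μ' := by
  have hreg : ∀ᵐ ω ∂μ', ∀ i, IsRegularSeq (tauConst a (q i)) (Z i ω) := by
    refine ae_all_iff.2 fun i => ?_
    refine ae_of_ae_map (hZ i).aemeasurable ?_
    rw [(hZ i).map_eq]
    exact ae_isRegularSeq (sigmaConst_pos hE.pos (hE.q_mem i) (hf.poleDensity_pos i)) _
  refine ⟨?_, tendstoInDistribution_scaled_diam hE hf hΦ hZ hindep hreg⟩
  filter_upwards [hreg] with ω hω
  exact ⟨isLeast_minPlus hE.pos (hω 0) (hω 1), isLeast_minMinus hE.pos (hω 0) (hω 2),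
    isLeast_minMinus hE.pos (hω 1) (hω 3), isLeast_minPlus hE.pos (hω 2) (hω 3)⟩
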